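/- Let $n\ge 3$ be odd, let $\Bbbk$ be an algebraically closed field of characteristic $0$ and let $q\in\Bbbk$ be a primitive $n$th root of unity. Let $D_n$ be the Drinfeld double of the Taft algebra: the $\Bbbk$-algebra generated by $a,b,c,d$ with relations $$ba=q\,ab,\quad db=q\,bd,\quad ca=q\,ac,\quad dc=q\,cd,\quad bc=cb,\quad da-q\,ad=1-bc,\quad a^n=d^n=0,\quad b^n=c^n=1,$$ with coproduct $\Delta(a)=a\otimes b+1\otimes a$, $\Delta(d)=d\otimes c+1\otimes d$, $\Delta(b)=b\otimes b$, $\Delta(c)=c\otimes c$ and counit $\varepsilon(a)=\varepsilon(d)=0$, $\varepsilon(b)=\varepsilon(c)=1$. For $1\le\ell\le n$ and $r\in\mathbb Z_n$ let $V(\ell,r)$ be the $D_n$-module with basis $v_1,\dots,v_\ell$ and action $a.v_j=v_{j+1}$ $(j<\ell)$, $a.v_\ell=0$, $b.v_j=q^{r+j-1}v_j$, $c.v_j=q^{j-(r+\ell)}v_j$, $d.v_1=0$, $d.v_j=\frac{(q^{j-1}-1)(1-q^{j-1-\ell})}{q-1}v_{j-1}$ $(j>1)$. Let $G_0(D_n)$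 be the Grothendieck ring of finite-dimensional $D_n$-modules (relations from short exact sequences, product from $\otimes$), let $G_0^{\mathbb C}(D_n)=\mathbb C\otimes_{\mathbb Z}G_0(D_n)$, and put $g=[V(1,1)]$, $x=[V(2,0)]$. For a finite-dimensional module $W$ the McKay matrix $M_W$ has rows and columns indexed by the pairs $(\ell,r)$, and its entry at $((\ell,r),(\ell',r'))$ is the composition multiplicity $[V(\ell,r)\otimes W:V(\ell',r')]$; write $M_{(\ell,s)}=M_{V(\ell,s)}$. Let $\zeta\in\mathbb C$ be a primitive $n$th root of unity and put $$f(x,g)=\sum_{i=0}^{\lfloor n/2\rfloor}(-1)^i\frac{n}{n-i}\binom{n-i}{i}g^i x^{n-2i}-2,\qquad \lambda_{j,r}=\zeta^r(\zeta^j+\zeta^{-j}),\qquad E_u=\frac1n\sum_{v=0}^{n-1}\zeta^{-uv}g^v,$$ $$F_{j,r}=\frac{f(x,\zeta^{2r})}{x-\lambda_{j,r}}E_{2r}\ \ (0\le j\le\tfrac{n-1}2),\qquad G_{j,r}=\frac{f(x,\zeta^{2r})}{(x-\lambda_{j,r})^2}E_{2r}\ \ (1\le j\le\tfrac{n-1}2),\qquad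 r\in\mathbb Z_n,$$ where the fractions are exact quotients of polynomials in $x$, and $$\xi_r=\prod_{j=1}^{(n-1)/2}(\lambda_{0,r}-\lambda_{j,r})^2,\qquad \vartheta_{j,r}=(\lambda_{j,r}-\lambda_{0,r})\prod_{1\le k\le (n-1)/2,\ k\ne j}(\lambda_{j,r}-\lambda_{k,r})^2 .$$ Then the $V(\ell,r)$ are, up to isomorphism, precisely the simple $D_n$-modules, without repetition; their classes $[V(\ell,r)]$ form a basis of $G_0^{\mathbb C}(D_n)$; there is an isomorphism of $\mathbb C$-algebras $\mathbb C\langle g\rangle[x]/(f(x,g))\cong G_0^{\mathbb C}(D_n)$, where $\langle g\rangle$ is cyclic of order $n$, sending $g\mapsto[V(1,1)]$ and $x\mapsto[V(2,0)]$; and the following hold. (a) The $\frac{n(n-1)}2$ elements $F_{j,r}$, $1\le j\le\frac{n-1}2$, $r\in\mathbb Z_n$, form a $\mathbb C$-basis of the Jacobson radical $J$ of $G_0^{\mathbb C}(D_n)$, and $J^2=0$. (b) There are scalars $\nu_{j,r}\in\mathbb C$ with $G_{j,r}^2=\vartheta_{j,r}G_{j,r}+\nu_{j,r}F_{j,r}$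 such that, with $G'_{j,r}=\vartheta_{j,r}^{-1}\bigl(G_{j,r}-\frac{\nu_{j,r}}{\vartheta_{j,r}}F_{j,r}\bigr)$, the elements $\xi_r^{-1}F_{0,r}$ and $G'_{j,r}$ ($1\le j\le\frac{n-1}2$, $r\in\mathbb Z_n$) are orthogonal idempotents whose images form a $\mathbb C$-basis of $G_0^{\mathbb C}(D_n)/J$. Let $\mathsf f_{j,r}$ and $\mathsf g_{j,r}$ be the row vectors of coordinates of $F_{j,r}$ and $G_{j,r}$ in the basis $[V(\ell,s)]$, and let $M=M_{(2,0)}$. (c) $\mathsf f_{j,r}\ne0$ and $\mathsf f_{j,r}M=\lambda_{j,r}\mathsf f_{j,r}$ for $0\le j\le\frac{n-1}2$, $r\in\mathbb Z_n$. (d) $\mathsf g_{j,r}M=\lambda_{j,r}\mathsf g_{j,r}+\mathsf f_{j,r}$ for $1\le j\le\frac{n-1}2$, $r\in\mathbb Z_n$. (e) The vectors $\mathsf f_{j,r}$ ($0\le j\le\frac{n-1}2$) and $\mathsf g_{j,r}$ ($1\le j\le\frac{n-1}2$), $r\in\mathbb Z_n$, together form a basis of $\mathbb C^{n^2}$. For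 every $t\in\mathbb C$, the left eigenspace $\{v: vM=tv\}$ is spanned by the $\mathsf f_{j,r}$ with $\lambda_{j,r}=t$, and the generalized left eigenspace of $M$ for $t$ is spanned by the $\mathsf f_{j,r}$ and $\mathsf g_{j,r}$ with $\lambda_{j,r}=t$. Moreover, for every $1\le\ell\le n$ and $s\in\mathbb Z_n$ there are scalars $\mu_{j,r}$ such that $\mathsf f_{j,r}M_{(\ell,s)}=\mu_{j,r}\mathsf f_{j,r}$ for all $j,r$ and $\mathsf g_{j,r}M_{(\ell,s)}\in\mu_{j,r}\mathsf g_{j,r}+\mathbb C\,\mathsf f_{j,r}$ for all $j\ge1$, $r$, and, for every $t\in\mathbb C$, the generalized left eigenspace of $M_{(\ell,s)}$ for $t$ is spanned by the $\mathsf f_{j,r}$ and $\mathsf g_{j,r}$ with $\mu_{j,r}=t$. -/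

import Mathlib

open scoped TensorProduct

universe u

/-! ### Finite-dimensional modules and the Grothendieck ring of a bialgebra -/

/-- A finite-dimensional (left, unital) module over a `k`-algebra `A`, given by its representation
`ρ : A → End_k(V)`. -/
structure FDModule (k : Type u) (A : Type u) [Field k] [Ring A] [Algebra k A] where
  carrier : Type u
  [addCommGroup : AddCommGroup carrier]
  [module : Module k carrier]
  [finite : FiniteDimensional k carrier]
  ρ : A →ₐ[k] Module.End k carrier

namespace FDModule

section Algebra

variable {k A : Type u} [Field k] [Ring A] [Algebra k A]

instance (V : FDModule k A) : AddCommGroup V.carrier := V.addCommGroup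
instance (V : FDModule k A) : Module k V.carrier := V.module
instance (V : FDModule k A) : FiniteDimensional k V.carrier := V.finite

/-- The `A`-module structure of an `FDModule`: `a • v = ρ(a) v`. -/
noncomputable instance instModule (V : FDModule k A) : Module A V.carrier :=
  Module.compHom V.carrier V.ρ.toRingHom

theorem smul_def (V : FDModule k A) (a : A) (v : V.carrier) : a • v = V.ρ a v := rfl

instance (V : FDModule k A) : IsScalarTower k A V.carrier :=
  ⟨fun c a v => by simp [smul_def]⟩

/-- There is a short exact sequence `0 → U → V → W → 0` of `A`-modules. -/
def ShortExact (U V W : FDModule k A) : Prop :=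
  ∃ (f : U.carrier →ₗ[A] V.carrier) (g : V.carrier →ₗ[A] W.carrier),
    Function.Injective f ∧ Function.Exact f g ∧ Function.Surjective g

/-- The zero module. -/
noncomputable def zero (k A : Type u) [Field k] [Ring A] [Algebra k A] : FDModule k A where
  carrier := PUnit
  ρ := { toFun := fun _ => 0
         map_one' := Subsingleton.elim _ _
         map_mul' := fun _ _ => Subsingleton.elim _ _
         map_zero' := rfl
         map_add' := fun _ _ => Subsingleton.elim _ _
         commutes' := fun _ => Subsingleton.elim _ _ }

/-- The multiplicity `[V : S]` of the simple module `S` as a composition factor of `V`: the number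
of factors isomorphic to `S` in a composition series `0 = V₀ ⊂ V₁ ⊂ ⋯ ⊂ V_m = V`.  (By the
Jordan–Hölder theorem every composition series gives the same number, so that the supremum is over
a one-element set.) -/
noncomputable def multiplicity (V S : FDModule k A) : ℕ :=
  sSup {m : ℕ | ∃ s : CompositionSeries (Submodule A V.carrier), s.head = ⊥ ∧ s.last = ⊤ ∧
    m = Nat.card {i : Fin s.length // Nonempty
      ((s i.succ ⧸ (s i.castSucc).comap (s i.succ).subtype) ≃ₗ[A] S.carrier)}}

/-- The subgroup of relations `[V] - [U] - [W]`, one for each short exact sequence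
`0 → U → V → W → 0`, in the free abelian group on finite-dimensional modules. -/
def relations (k A : Type u) [Field k] [Ring A] [Algebra k A] :
    AddSubgroup (FreeAbelianGroup (FDModule k A)) :=
  AddSubgroup.closure {t | ∃ U V W : FDModule k A, ShortExact U V W ∧
    t = FreeAbelianGroup.of V - FreeAbelianGroup.of U - FreeAbelianGroup.of W}

end Algebra

end FDModule

/-- The Grothendieck group `G₀(A)` of finite-dimensional `A`-modules.  Isomorphic modules
automatically have the same class, by the exact sequences `0 → 0 → U → V → 0`. -/
def G0 (k A : Type u) [Field k] [Ring A] [Algebra k A] : Type (u + 1) :=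
  FreeAbelianGroup (FDModule k A) ⧸ FDModule.relations k A

namespace G0

section Algebra

variable {k A : Type u} [Field k] [Ring A] [Algebra k A]

noncomputable instance : AddCommGroup (G0 k A) :=
  inferInstanceAs (AddCommGroup (FreeAbelianGroup (FDModule k A) ⧸ FDModule.relations k A))

/-- The class `[V]` of a module in the Grothendieck group. -/
def cls (V : FDModule k A) : G0 k A :=
  QuotientAddGroup.mk' (FDModule.relations k A) (FreeAbelianGroup.of V)

theorem cls_of_shortExact {U V W : FDModule k A} (h : FDModule.ShortExact U V W) :
    cls V = cls U + cls W := by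
  have h1 : QuotientAddGroup.mk' (FDModule.relations k A) (FreeAbelianGroup.of V -
      FreeAbelianGroup.of U - FreeAbelianGroup.of W) = 0 :=
    (QuotientAddGroup.eq_zero_iff _).2 (AddSubgroup.subset_closure ⟨U, V, W, h, rfl⟩)
  rw [map_sub, map_sub, sub_sub, sub_eq_zero] at h1
  exact h1

theorem cls_zero : cls (FDModule.zero k A) = 0 := by
  have h : FDModule.ShortExact (FDModule.zero k A) (FDModule.zero k A) (FDModule.zero k A) :=
    ⟨LinearMap.id, LinearMap.id, fun _ _ h => h,
      fun y => ⟨fun _ => ⟨y, rfl⟩, fun _ => rfl⟩, fun y => ⟨y, rfl⟩⟩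
  have := cls_of_shortExact h
  simpa using this

theorem cls_of_equiv {U V : FDModule k A} (e : U.carrier ≃ₗ[A] V.carrier) : cls U = cls V := by
  have h : FDModule.ShortExact (FDModule.zero k A) U V := by
    refine ⟨0, e.toLinearMap, ?_, ?_, e.surjective⟩
    · intro x y _
      exact Subsingleton.elim (α := PUnit) x y
    · intro y
      constructor
      · intro hy
        exact ⟨(0 : (FDModule.zero k A).carrier), by simpa using (e.map_eq_zero_iff.1 hy).symm⟩
      · rintro ⟨x, rfl⟩
        simp
  rw [cls_of_shortExact h, cls_zero, zero_add]

/-- An additive map out of `G₀(A)` from a function on modules that is additive on short exact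
sequences. -/
noncomputable def lift {B : Type*} [AddCommGroup B] (φ : FDModule k A → B)
    (h : ∀ U V W, FDModule.ShortExact U V W → φ V = φ U + φ W) : G0 k A →+ B :=
  QuotientAddGroup.lift (FDModule.relations k A) (FreeAbelianGroup.lift φ) (by
    rw [FDModule.relations, AddSubgroup.closure_le]
    rintro _ ⟨U, V, W, hs, rfl⟩
    simp [h U V W hs])

@[simp] theorem lift_cls {B : Type*} [AddCommGroup B] (φ : FDModule k A → B)
    (h : ∀ U V W, FDModule.ShortExact U V W → φ V = φ U + φ W) (V : FDModule k A) :
    lift φ h (cls V) = φ V :=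
  FreeAbelianGroup.lift_apply_of φ V

theorem hom_ext {B : Type*} [AddCommGroup B] {φ ψ : G0 k A →+ B}
    (h : ∀ V, φ (cls V) = ψ (cls V)) : φ = ψ := by
  apply QuotientAddGroup.addMonoidHom_ext
  ext V
  exact h V

end Algebra

end G0

namespace FDModule

section Rep

variable {k A : Type u} [Field k] [Ring A] [Bialgebra k A]
variable {U V W U' V' : Type u} [AddCommGroup U] [Module k U] [AddCommGroup V] [Module k V]
  [AddCommGroup W] [Module k W] [AddCommGroup U'] [Module k U'] [AddCommGroup V'] [Module k V']

/-- The tensor product of two representations of a bialgebra: `A` acts on `U ⊗ V` through the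
comultiplication. -/
noncomputable def tensorRep (ρ : A →ₐ[k] Module.End k U) (σ : A →ₐ[k] Module.End k V) :
    A →ₐ[k] Module.End k (U ⊗[k] V) :=
  (Module.endTensorEndAlgHom (R := k) (S := k) (A := k)).comp
    ((Algebra.TensorProduct.map ρ σ).comp (Bialgebra.comulAlgHom k A))

/-- The trivial representation on `k`: `A` acts through the counit. -/
noncomputable def trivialRep (k A : Type u) [Field k] [Ring A] [Bialgebra k A] :
    A →ₐ[k] Module.End k k :=
  (Algebra.lmul k k).comp (Bialgebra.counitAlgHom k A)

theorem tensorRep_tmul (ρ : A →ₐ[k] Module.End k U) (σ : A →ₐ[k] Module.End k V) (a : A)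
    (x : U) (y : V) :
    tensorRep ρ σ a (x ⊗ₜ[k] y) = TensorProduct.map ((LinearMap.applyₗ x).comp ρ.toLinearMap)
      ((LinearMap.applyₗ y).comp σ.toLinearMap) (Coalgebra.comul (R := k) a) := by
  change Module.endTensorEndAlgHom (R := k) (S := k) (A := k)
    (Algebra.TensorProduct.map ρ σ (Coalgebra.comul (R := k) a)) (x ⊗ₜ[k] y) = _
  induction Coalgebra.comul (R := k) a using TensorProduct.induction_on with
  | zero => simp
  | tmul a b => simp [Module.endTensorEndAlgHom_apply]
  | add s t hs ht => rw [map_add, map_add, map_add, LinearMap.add_apply, hs, ht]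

theorem orbit_tensorRep (ρ : A →ₐ[k] Module.End k U) (σ : A →ₐ[k] Module.End k V)
    (x : U) (y : V) :
    (LinearMap.applyₗ (x ⊗ₜ[k] y)).comp (tensorRep ρ σ).toLinearMap =
      (TensorProduct.map ((LinearMap.applyₗ x).comp ρ.toLinearMap)
        ((LinearMap.applyₗ y).comp σ.toLinearMap)).comp (Coalgebra.comul (R := k)) := by
  ext a
  exact tensorRep_tmul ρ σ a x y

theorem tensorRep_map {ρ : A →ₐ[k] Module.End k U} {σ : A →ₐ[k] Module.End k V}
    {ρ' : A →ₐ[k] Module.End k U'} {σ' : A →ₐ[k] Module.End k V'} (f : U →ₗ[k] U')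
    (g : V →ₗ[k] V') (hf : ∀ a x, f (ρ a x) = ρ' a (f x)) (hg : ∀ a y, g (σ a y) = σ' a (g y))
    (a : A) (t : U ⊗[k] V) :
    TensorProduct.map f g (tensorRep ρ σ a t) = tensorRep ρ' σ' a (TensorProduct.map f g t) := by
  induction t using TensorProduct.induction_on with
  | zero => simp
  | add s t hs ht => rw [map_add, map_add, hs, ht, map_add, map_add]
  | tmul x y =>
    rw [TensorProduct.map_tmul, tensorRep_tmul, tensorRep_tmul, ← LinearMap.comp_apply,
      ← TensorProduct.map_comp]
    congr 2
    · ext a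
      exact hf a x
    · ext a
      exact hg a y

theorem tensorRep_assoc (ρ : A →ₐ[k] Module.End k U) (σ : A →ₐ[k] Module.End k V)
    (τ : A →ₐ[k] Module.End k W) (a : A) (t : (U ⊗[k] V) ⊗[k] W) :
    TensorProduct.assoc k U V W (tensorRep (tensorRep ρ σ) τ a t) =
      tensorRep ρ (tensorRep σ τ) a (TensorProduct.assoc k U V W t) := by
  revert t
  refine LinearMap.congr_fun (f := (TensorProduct.assoc k U V W).toLinearMap.comp
    (tensorRep (tensorRep ρ σ) τ a)) (g := (tensorRep ρ (tensorRep σ τ) a).comp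
    (TensorProduct.assoc k U V W).toLinearMap) ?_
  refine TensorProduct.ext_threefold fun x y z => ?_
  simp only [LinearMap.comp_apply, LinearEquiv.coe_coe, TensorProduct.assoc_tmul,
    tensorRep_tmul, orbit_tensorRep]
  have key : ∀ (f : A →ₗ[k] U) (g : A →ₗ[k] V) (h : A →ₗ[k] W),
      TensorProduct.assoc k U V W (TensorProduct.map
        ((TensorProduct.map f g).comp (Coalgebra.comul (R := k))) h (Coalgebra.comul (R := k) a)) =
      TensorProduct.map f ((TensorProduct.map g h).comp (Coalgebra.comul (R := k)))
        (Coalgebra.comul (R := k) a) := by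
    intro f g h
    have e1 : TensorProduct.map ((TensorProduct.map f g).comp (Coalgebra.comul (R := k))) h =
        (TensorProduct.map (TensorProduct.map f g) h).comp
          ((Coalgebra.comul (R := k)).rTensor A) := by
      rw [LinearMap.rTensor, ← TensorProduct.map_comp, LinearMap.comp_id]
    have e2 : TensorProduct.map f ((TensorProduct.map g h).comp (Coalgebra.comul (R := k))) =
        (TensorProduct.map f (TensorProduct.map g h)).comp
          ((Coalgebra.comul (R := k)).lTensor A) := by
      rw [LinearMap.lTensor, ← TensorProduct.map_comp, LinearMap.comp_id]
    rw [e1, e2, LinearMap.comp_apply, LinearMap.comp_apply, ← Coalgebra.coassoc_apply]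
    exact LinearMap.congr_fun (TensorProduct.map_map_comp_assoc_eq f g h).symm _
  exact key _ _ _

theorem tensorRep_lid (ρ : A →ₐ[k] Module.End k U) (a : A) (t : k ⊗[k] U) :
    TensorProduct.lid k U (tensorRep (trivialRep k A) ρ a t) =
      ρ a (TensorProduct.lid k U t) := by
  induction t using TensorProduct.induction_on with
  | zero => simp
  | add s t hs ht => rw [map_add, map_add, hs, ht, map_add, map_add]
  | tmul c u =>
    have e : (LinearMap.applyₗ c).comp (trivialRep k A).toLinearMap =
        (LinearMap.mulRight k c).comp (Coalgebra.counit (R := k) (A := A)) := by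
      ext a
      simp [trivialRep]
    rw [tensorRep_tmul, e, ← LinearMap.comp_id ((LinearMap.applyₗ u).comp ρ.toLinearMap),
      TensorProduct.map_comp, LinearMap.comp_apply, ← LinearMap.rTensor,
      Coalgebra.rTensor_counit_comul]
    simp

theorem tensorRep_rid (ρ : A →ₐ[k] Module.End k U) (a : A) (t : U ⊗[k] k) :
    TensorProduct.rid k U (tensorRep ρ (trivialRep k A) a t) =
      ρ a (TensorProduct.rid k U t) := by
  induction t using TensorProduct.induction_on with
  | zero => simp
  | add s t hs ht => rw [map_add, map_add, hs, ht, map_add, map_add]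
  | tmul u c =>
    have e : (LinearMap.applyₗ c).comp (trivialRep k A).toLinearMap =
        (LinearMap.mulRight k c).comp (Coalgebra.counit (R := k) (A := A)) := by
      ext a
      simp [trivialRep]
    rw [tensorRep_tmul, e, ← LinearMap.comp_id ((LinearMap.applyₗ u).comp ρ.toLinearMap),
      TensorProduct.map_comp, LinearMap.comp_apply, ← LinearMap.lTensor,
      Coalgebra.lTensor_counit_comul]
    simp

end Rep

section Bialgebra

variable {k A : Type u} [Field k] [Ring A] [Bialgebra k A]

/-- The tensor product `U ⊗ V` of two modules over a bialgebra. -/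
noncomputable def tensor (U V : FDModule k A) : FDModule k A where
  carrier := U.carrier ⊗[k] V.carrier
  ρ := tensorRep U.ρ V.ρ

/-- The trivial module `k`. -/
noncomputable def trivial (k A : Type u) [Field k] [Ring A] [Bialgebra k A] : FDModule k A where
  carrier := k
  ρ := trivialRep k A

/-- A `k`-linear map that intertwines the actions is `A`-linear. -/
def homMk {U V : FDModule k A} (f : U.carrier →ₗ[k] V.carrier)
    (h : ∀ a v, f (U.ρ a v) = V.ρ a (f v)) : U.carrier →ₗ[A] V.carrier where
  toFun := f
  map_add' := f.map_add
  map_smul' := h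

/-- A `k`-linear equivalence that intertwines the actions is `A`-linear. -/
def equivMk {U V : FDModule k A} (f : U.carrier ≃ₗ[k] V.carrier)
    (h : ∀ a v, f (U.ρ a v) = V.ρ a (f v)) : U.carrier ≃ₗ[A] V.carrier where
  toFun := f
  map_add' := f.map_add
  map_smul' := h
  invFun := f.symm
  left_inv := f.left_inv
  right_inv := f.right_inv

theorem shortExact_tensor_right {U V W : FDModule k A} (h : ShortExact U V W) (X : FDModule k A) :
    ShortExact (U.tensor X) (V.tensor X) (W.tensor X) := by
  obtain ⟨f, g, hf, hfg, hg⟩ := h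
  refine ⟨homMk (U := U.tensor X) (V := V.tensor X)
      ((f.restrictScalars k).rTensor X.carrier)
      (tensorRep_map (f.restrictScalars k) LinearMap.id f.map_smul fun _ _ => rfl),
    homMk (U := V.tensor X) (V := W.tensor X)
      ((g.restrictScalars k).rTensor X.carrier)
      (tensorRep_map (g.restrictScalars k) LinearMap.id g.map_smul fun _ _ => rfl), ?_, ?_, ?_⟩
  · exact Module.Flat.rTensor_preserves_injective_linearMap (f.restrictScalars k) hf
  · exact rTensor_exact X.carrier (f := f.restrictScalars k) (g := g.restrictScalars k) hfg hg
  · exact LinearMap.rTensor_surjective X.carrier (g := g.restrictScalars k) hg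

theorem shortExact_tensor_left {U V W : FDModule k A} (h : ShortExact U V W) (X : FDModule k A) :
    ShortExact (X.tensor U) (X.tensor V) (X.tensor W) := by
  obtain ⟨f, g, hf, hfg, hg⟩ := h
  refine ⟨homMk (U := X.tensor U) (V := X.tensor V)
      ((f.restrictScalars k).lTensor X.carrier)
      (tensorRep_map LinearMap.id (f.restrictScalars k) (fun _ _ => rfl) f.map_smul),
    homMk (U := X.tensor V) (V := X.tensor W)
      ((g.restrictScalars k).lTensor X.carrier)
      (tensorRep_map LinearMap.id (g.restrictScalars k) (fun _ _ => rfl) g.map_smul), ?_, ?_, ?_⟩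
  · exact Module.Flat.lTensor_preserves_injective_linearMap (f.restrictScalars k) hf
  · exact lTensor_exact X.carrier (f := f.restrictScalars k) (g := g.restrictScalars k) hfg hg
  · exact LinearMap.lTensor_surjective X.carrier (g := g.restrictScalars k) hg

/-- Associativity of the tensor product of modules. -/
noncomputable def tensorAssoc (U V W : FDModule k A) :
    ((U.tensor V).tensor W).carrier ≃ₗ[A] (U.tensor (V.tensor W)).carrier :=
  equivMk (U := (U.tensor V).tensor W) (V := U.tensor (V.tensor W))
    (TensorProduct.assoc k U.carrier V.carrier W.carrier) (tensorRep_assoc U.ρ V.ρ W.ρ)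

/-- The trivial module is a left unit. -/
noncomputable def trivialTensor (U : FDModule k A) :
    ((trivial k A).tensor U).carrier ≃ₗ[A] U.carrier :=
  equivMk (U := (trivial k A).tensor U) (V := U) (TensorProduct.lid k U.carrier)
    (tensorRep_lid U.ρ)

/-- The trivial module is a right unit. -/
noncomputable def tensorTrivial (U : FDModule k A) :
    (U.tensor (trivial k A)).carrier ≃ₗ[A] U.carrier :=
  equivMk (U := U.tensor (trivial k A)) (V := U) (TensorProduct.rid k U.carrier)
    (tensorRep_rid U.ρ)

end Bialgebra

end FDModule

namespace G0

section Bialgebra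

variable {k A : Type u} [Field k] [Ring A] [Bialgebra k A]

/-- The product of the Grothendieck group, as a biadditive map with `[U] [V] = [U ⊗ V]`. -/
noncomputable def mulHom : G0 k A →+ G0 k A →+ G0 k A :=
  lift (fun U => lift (fun V => cls (U.tensor V))
      fun _ _ _ h => cls_of_shortExact (FDModule.shortExact_tensor_left h U))
    fun U V W h => hom_ext fun X => by
      simpa using cls_of_shortExact (FDModule.shortExact_tensor_right h X)

theorem mulHom_cls (U V : FDModule k A) : mulHom (cls U) (cls V) = cls (U.tensor V) := by
  simp [mulHom]

theorem mulHom_assoc (x y z : G0 k A) :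
    mulHom (mulHom x y) z = mulHom x (mulHom y z) := by
  let L : G0 k A →+ G0 k A →+ G0 k A →+ G0 k A :=
    (AddMonoidHom.compHom (mulHom (k := k) (A := A))).comp mulHom
  let R : G0 k A →+ G0 k A →+ G0 k A →+ G0 k A :=
    (((AddMonoidHom.compHom (M := G0 k A) (N := G0 k A →+ G0 k A)
      (P := G0 k A →+ G0 k A)).flip mulHom).comp AddMonoidHom.compHom).comp mulHom
  have h : L = R := by
    refine hom_ext fun U => hom_ext fun V => hom_ext fun W => ?_
    change mulHom (mulHom (cls U) (cls V)) (cls W) = mulHom (cls U) (mulHom (cls V) (cls W))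
    simp only [mulHom_cls]
    exact cls_of_equiv (FDModule.tensorAssoc U V W)
  exact DFunLike.congr_fun (DFunLike.congr_fun (DFunLike.congr_fun h x) y) z

/-- The ring structure of `G₀(A)`: `[U] [V] = [U ⊗ V]`, with unit the class of the trivial
module. -/
noncomputable instance : Ring (G0 k A) :=
  { (inferInstance : AddCommGroup (G0 k A)) with
    mul := fun x y => mulHom x y
    one := cls (FDModule.trivial k A)
    left_distrib := fun x y z => (mulHom x).map_add y z
    right_distrib := fun x y z => by
      change mulHom (x + y) z = mulHom x z + mulHom y z
      rw [map_add, AddMonoidHom.add_apply]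
    zero_mul := fun x => by
      change mulHom 0 x = 0
      rw [map_zero, AddMonoidHom.zero_apply]
    mul_zero := fun x => (mulHom x).map_zero
    mul_assoc := mulHom_assoc
    one_mul := fun x => DFunLike.congr_fun (hom_ext (φ := mulHom (cls (FDModule.trivial k A)))
      (ψ := AddMonoidHom.id _) fun V => by
        rw [mulHom_cls]; exact cls_of_equiv (FDModule.trivialTensor V)) x
    mul_one := fun x => DFunLike.congr_fun (hom_ext (φ := mulHom.flip (cls (FDModule.trivial k A)))
      (ψ := AddMonoidHom.id _) fun V => by
        rw [AddMonoidHom.flip_apply, mulHom_cls]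
        exact cls_of_equiv (FDModule.tensorTrivial V)) x }

theorem cls_mul_cls (U V : FDModule k A) : cls U * cls V = cls (U.tensor V) := mulHom_cls U V

theorem one_def : (1 : G0 k A) = cls (FDModule.trivial k A) := rfl

end Bialgebra

end G0

/-- The complex Grothendieck algebra `ℂ ⊗_ℤ G₀(A)`. -/
abbrev G0C (k A : Type u) [Field k] [Ring A] [Bialgebra k A] : Type (u + 1) :=
  ℂ ⊗[ℤ] G0 k A

/-- The class of a module in the complex Grothendieck algebra. -/
noncomputable def G0C.cls {k A : Type u} [Field k] [Ring A] [Bialgebra k A] (V : FDModule k A) :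
    G0C k A :=
  (1 : ℂ) ⊗ₜ[ℤ] G0.cls V

/-! ### The Drinfeld double of the Taft algebra -/

section QCommuting

variable {k : Type*} [Field k]

/-- Gaussian binomial coefficients evaluated at `q`. -/
def gaussCoeff (q : k) : ℕ → ℕ → k
  | _, 0 => 1
  | 0, _ + 1 => 0
  | m + 1, i + 1 => gaussCoeff q m i + q ^ (i + 1) * gaussCoeff q m (i + 1)

theorem gaussCoeff_zero_right (q : k) (m : ℕ) : gaussCoeff q m 0 = 1 := by
  cases m <;> rfl

theorem gaussCoeff_eq_zero (q : k) : ∀ m i : ℕ, m < i → gaussCoeff q m i = 0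
  | 0, i + 1, _ => rfl
  | m + 1, i + 1, h => by
    rw [gaussCoeff, gaussCoeff_eq_zero q m i (by omega),
      gaussCoeff_eq_zero q m (i + 1) (by omega)]
    simp

theorem gaussCoeff_self (q : k) : ∀ m : ℕ, gaussCoeff q m m = 1
  | 0 => rfl
  | m + 1 => by
    rw [gaussCoeff, gaussCoeff_self q m, gaussCoeff_eq_zero q m (m + 1) (by omega)]
    simp

theorem gaussCoeff_step (q : k) (m : ℕ) : ∀ i, i ≤ m →
    (q ^ (i + 1) - 1) * gaussCoeff q m (i + 1) = (q ^ (m - i) - 1) * gaussCoeff q m i := by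
  induction m with
  | zero =>
    intro i hi
    obtain rfl : i = 0 := by omega
    simp [gaussCoeff]
  | succ m ih =>
    have h1 : ∀ i, i ≤ m →
        (q ^ (i + 1) - 1) * gaussCoeff q (m + 1) (i + 1) =
          (q ^ (m + 1) - 1) * gaussCoeff q m i := by
      intro i hi
      have hp : q ^ (m + 1) = q ^ (i + 1) * q ^ (m - i) := by
        rw [← pow_add]; congr 1; omega
      rw [gaussCoeff, hp]
      linear_combination q ^ (i + 1) * ih i hi
    intro i hi
    rcases Nat.lt_or_ge m i with hlt | hle
    · obtain rfl : i = m + 1 := by omega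
      rw [gaussCoeff_eq_zero q (m + 1) (m + 1 + 1) (by omega)]
      simp
    · rw [h1 i hle]
      cases i with
      | zero => simp [gaussCoeff_zero_right]
      | succ i =>
        have hp : q ^ (m + 1) = q ^ (i + 1) * q ^ (m - i) := by
          rw [← pow_add]; congr 1; omega
        rw [gaussCoeff, hp, show m + 1 - (i + 1) = m - i by omega]
        linear_combination ih i (by omega)

theorem q_add_pow {R : Type*} [Ring R] [Algebra k R] (q : k) {x y : R}
    (h : y * x = q • (x * y)) (m : ℕ) :
    (x + y) ^ m = ∑ i ∈ Finset.range (m + 1), gaussCoeff q m i • (x ^ i * y ^ (m - i)) := by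
  have hyx : ∀ i, y * x ^ i = q ^ i • (x ^ i * y) := by
    intro i
    induction i with
    | zero => simp
    | succ i ih =>
      rw [pow_succ, ← mul_assoc, ih, smul_mul_assoc, mul_assoc, h, mul_smul_comm, smul_smul,
        pow_succ, mul_assoc]
  induction m with
  | zero => simp [gaussCoeff]
  | succ m ih =>
    rw [pow_succ', ih, add_mul, Finset.mul_sum, Finset.mul_sum,
      Finset.sum_range_succ' _ (m + 1)]
    have e1 : ∑ i ∈ Finset.range (m + 1), x * gaussCoeff q m i • (x ^ i * y ^ (m - i)) =
        ∑ i ∈ Finset.range (m + 1), gaussCoeff q m i • (x ^ (i + 1) * y ^ (m - i)) := by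
      refine Finset.sum_congr rfl fun i _ => ?_
      rw [mul_smul_comm, ← mul_assoc, ← pow_succ']
    have e2 : ∑ i ∈ Finset.range (m + 1), y * gaussCoeff q m i • (x ^ i * y ^ (m - i)) =
        ∑ i ∈ Finset.range (m + 1),
          (q ^ i * gaussCoeff q m i) • (x ^ i * y ^ (m + 1 - i)) := by
      refine Finset.sum_congr rfl fun i hi => ?_
      rw [Finset.mem_range] at hi
      rw [mul_smul_comm, ← mul_assoc, hyx, smul_mul_assoc, smul_smul, mul_assoc, ← pow_succ',
        mul_comm (q ^ i), show m - i + 1 = m + 1 - i by omega]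
    have e3 : ∑ i ∈ Finset.range (m + 1),
          (q ^ i * gaussCoeff q m i) • (x ^ i * y ^ (m + 1 - i)) =
        ∑ i ∈ Finset.range (m + 1),
          (q ^ (i + 1) * gaussCoeff q m (i + 1)) • (x ^ (i + 1) * y ^ (m - i)) + y ^ (m + 1) := by
      have := Finset.sum_range_succ (fun i =>
        (q ^ i * gaussCoeff q m i) • (x ^ i * y ^ (m + 1 - i))) (m + 1)
      rw [gaussCoeff_eq_zero q m (m + 1) (by omega), mul_zero, zero_smul, add_zero] at this
      rw [← this, Finset.sum_range_succ']
      simp [gaussCoeff_zero_right]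
    rw [e1, e2, e3, ← add_assoc, ← Finset.sum_add_distrib]
    congr 1
    · refine Finset.sum_congr rfl fun i _ => ?_
      rw [← add_smul, gaussCoeff, show m + 1 - (i + 1) = m - i by omega]
    · simp [gaussCoeff]

/-- If `yx = q xy` with `q` a primitive `n`-th root of unity, then `(x + y)^n = x^n + y^n`. -/
theorem q_add_pow_primitive {R : Type*} [Ring R] [Algebra k R] {q : k} {n : ℕ} (hn : 0 < n)
    (hq : IsPrimitiveRoot q n) {x y : R} (h : y * x = q • (x * y)) :
    (x + y) ^ n = x ^ n + y ^ n := by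
  have hz : ∀ i, i + 1 < n → gaussCoeff q n (i + 1) = 0 := by
    intro i
    induction i with
    | zero =>
      intro hi
      have := gaussCoeff_step q n 0 (by omega)
      rw [Nat.sub_zero, hq.pow_eq_one, sub_self, zero_mul] at this
      exact (mul_eq_zero.1 this).resolve_left
        (sub_ne_zero.2 (hq.pow_ne_one_of_pos_of_lt (by omega) hi))
    | succ i ih =>
      intro hi
      have := gaussCoeff_step q n (i + 1) (by omega)
      rw [ih (by omega), mul_zero] at this
      exact (mul_eq_zero.1 this).resolve_left
        (sub_ne_zero.2 (hq.pow_ne_one_of_pos_of_lt (by omega) hi))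
  obtain ⟨m, rfl⟩ : ∃ m, n = m + 1 := ⟨n - 1, by omega⟩
  rw [q_add_pow q h, Finset.sum_range_succ, Finset.sum_range_succ', gaussCoeff_self,
    gaussCoeff_zero_right, Finset.sum_eq_zero]
  · simp [add_comm]
  · intro i hi
    rw [Finset.mem_range] at hi
    rw [hz i (by omega), zero_smul]

end QCommuting

namespace TaftDouble

/-- The four generators of `D_n`. -/
inductive Gen : Type
  | a | b | c | d

/-- The defining relations of `D_n`:
`ba = q ab`, `db = q bd`, `ca = q ac`, `dc = q cd`, `bc = cb`, `da - q ad = 1 - bc`,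
`a^n = 0 = d^n`, `b^n = 1 = c^n`. -/
inductive Rel {k : Type u} [Field k] (n : ℕ) (q : k) :
    FreeAlgebra k Gen → FreeAlgebra k Gen → Prop
  | ba : Rel n q (.ι k .b * .ι k .a) (q • (.ι k .a * .ι k .b))
  | db : Rel n q (.ι k .d * .ι k .b) (q • (.ι k .b * .ι k .d))
  | ca : Rel n q (.ι k .c * .ι k .a) (q • (.ι k .a * .ι k .c))
  | dc : Rel n q (.ι k .d * .ι k .c) (q • (.ι k .c * .ι k .d))
  | bc : Rel n q (.ι k .b * .ι k .c) (.ι k .c * .ι k .b)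
  | da : Rel n q (.ι k .d * .ι k .a - q • (.ι k .a * .ι k .d)) (1 - .ι k .b * .ι k .c)
  | a_pow : Rel n q (.ι k .a ^ n) 0
  | d_pow : Rel n q (.ι k .d ^ n) 0
  | b_pow : Rel n q (.ι k .b ^ n) 1
  | c_pow : Rel n q (.ι k .c ^ n) 1

end TaftDouble

/-- The Drinfeld double `D_n` of the Taft algebra: the `k`-algebra with generators `a, b, c, d` and
the relations `TaftDouble.Rel`, for `q` a primitive `n`-th root of unity in `k`. -/
def TaftDouble {k : Type u} [Field k] {n : ℕ} {q : k} (_hn : 3 ≤ n) (_hq : IsPrimitiveRoot q n) :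
    Type u :=
  RingQuot (TaftDouble.Rel n q)

namespace TaftDouble

variable {k : Type u} [Field k] {n : ℕ} {q : k} {hn : 3 ≤ n} {hq : IsPrimitiveRoot q n}

noncomputable instance : Ring (TaftDouble hn hq) :=
  inferInstanceAs (Ring (RingQuot (TaftDouble.Rel n q)))

noncomputable instance : Algebra k (TaftDouble hn hq) :=
  inferInstanceAs (Algebra k (RingQuot (TaftDouble.Rel n q)))

/-- The generators, as elements of `D_n`. -/
noncomputable def gen (hn : 3 ≤ n) (hq : IsPrimitiveRoot q n) (x : Gen) : TaftDouble hn hq :=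
  RingQuot.mkAlgHom k (Rel n q) (FreeAlgebra.ι k x)

theorem rel {s t : FreeAlgebra k Gen} (h : Rel n q s t) :
    FreeAlgebra.lift k (gen hn hq) s = FreeAlgebra.lift k (gen hn hq) t := by
  have e : FreeAlgebra.lift k (gen hn hq) = RingQuot.mkAlgHom k (Rel n q) := by
    ext x
    simp [gen]
    rfl
  rw [e]
  exact RingQuot.mkAlgHom_rel k h

section relations

variable (hn hq)

theorem rel_ba : gen hn hq .b * gen hn hq .a = q • (gen hn hq .a * gen hn hq .b) := by
  simpa using rel (hn := hn) (hq := hq) Rel.ba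
theorem rel_db : gen hn hq .d * gen hn hq .b = q • (gen hn hq .b * gen hn hq .d) := by
  simpa using rel (hn := hn) (hq := hq) Rel.db
theorem rel_ca : gen hn hq .c * gen hn hq .a = q • (gen hn hq .a * gen hn hq .c) := by
  simpa using rel (hn := hn) (hq := hq) Rel.ca
theorem rel_dc : gen hn hq .d * gen hn hq .c = q • (gen hn hq .c * gen hn hq .d) := by
  simpa using rel (hn := hn) (hq := hq) Rel.dc
theorem rel_bc : gen hn hq .b * gen hn hq .c = gen hn hq .c * gen hn hq .b := by
  simpa using rel (hn := hn) (hq := hq) Rel.bc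
theorem rel_da : gen hn hq .d * gen hn hq .a - q • (gen hn hq .a * gen hn hq .d) =
    1 - gen hn hq .b * gen hn hq .c := by
  simpa using rel (hn := hn) (hq := hq) Rel.da
theorem rel_a_pow : gen hn hq .a ^ n = 0 := by
  simpa using rel (hn := hn) (hq := hq) Rel.a_pow
theorem rel_d_pow : gen hn hq .d ^ n = 0 := by
  simpa using rel (hn := hn) (hq := hq) Rel.d_pow
theorem rel_b_pow : gen hn hq .b ^ n = 1 := by
  simpa using rel (hn := hn) (hq := hq) Rel.b_pow
theorem rel_c_pow : gen hn hq .c ^ n = 1 := by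
  simpa using rel (hn := hn) (hq := hq) Rel.c_pow

end relations

/-- Elements `a, b, c, d` of an algebra that satisfy the relations of `D_n`. -/
structure Satisfies {B : Type*} [Ring B] [Algebra k B] (n : ℕ) (q : k) (a b c d : B) : Prop where
  ba : b * a = q • (a * b)
  db : d * b = q • (b * d)
  ca : c * a = q • (a * c)
  dc : d * c = q • (c * d)
  bc : b * c = c * b
  da : d * a - q • (a * d) = 1 - b * c
  a_pow : a ^ n = 0
  d_pow : d ^ n = 0
  b_pow : b ^ n = 1
  c_pow : c ^ n = 1

/-- The choice of values on the generators. -/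
def genMap {B : Type*} (a b c d : B) : Gen → B
  | .a => a
  | .b => b
  | .c => c
  | .d => d

/-- The universal property of `D_n`. -/
noncomputable def lift (hn : 3 ≤ n) (hq : IsPrimitiveRoot q n) {B : Type*} [Ring B] [Algebra k B]
    {a b c d : B} (h : Satisfies n q a b c d) : TaftDouble hn hq →ₐ[k] B :=
  RingQuot.liftAlgHom k (s := Rel n q) ⟨FreeAlgebra.lift k (genMap a b c d), by
    intro s t hst
    cases hst with
    | ba => simpa [genMap] using h.ba
    | db => simpa [genMap] using h.db
    | ca => simpa [genMap] using h.ca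
    | dc => simpa [genMap] using h.dc
    | bc => simpa [genMap] using h.bc
    | da => simpa [genMap] using h.da
    | a_pow => simpa [genMap] using h.a_pow
    | d_pow => simpa [genMap] using h.d_pow
    | b_pow => simpa [genMap] using h.b_pow
    | c_pow => simpa [genMap] using h.c_pow⟩

theorem lift_gen {B : Type*} [Ring B] [Algebra k B] {a b c d : B}
    (h : Satisfies n q a b c d) (x : Gen) : lift hn hq h (gen hn hq x) = genMap a b c d x := by
  change RingQuot.liftAlgHom k (s := Rel n q) _ (RingQuot.mkAlgHom k (Rel n q) _) = _
  simp

theorem algHom_ext {B : Type*} [Semiring B] [Algebra k B] {φ ψ : TaftDouble hn hq →ₐ[k] B}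
    (h : ∀ x, φ (gen hn hq x) = ψ (gen hn hq x)) : φ = ψ := by
  apply RingQuot.ringQuot_ext'
  ext x
  exact h x

variable (hn hq)

/-- The comultiplication: `Δ(a) = a ⊗ b + 1 ⊗ a`, `Δ(b) = b ⊗ b`, `Δ(c) = c ⊗ c`,
`Δ(d) = d ⊗ c + 1 ⊗ d`. -/
noncomputable def comul : TaftDouble hn hq →ₐ[k] TaftDouble hn hq ⊗[k] TaftDouble hn hq :=
  lift hn hq (a := gen hn hq .a ⊗ₜ gen hn hq .b + 1 ⊗ₜ gen hn hq .a)
    (b := gen hn hq .b ⊗ₜ gen hn hq .b) (c := gen hn hq .c ⊗ₜ gen hn hq .c)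
    (d := gen hn hq .d ⊗ₜ gen hn hq .c + 1 ⊗ₜ gen hn hq .d)
    { ba := by
        simp only [mul_add, add_mul, Algebra.TensorProduct.tmul_mul_tmul, mul_one, one_mul,
          rel_ba, TensorProduct.tmul_smul, TensorProduct.smul_tmul', smul_add]
      db := by
        simp only [mul_add, add_mul, Algebra.TensorProduct.tmul_mul_tmul, mul_one, one_mul,
          rel_db, rel_bc, TensorProduct.tmul_smul, TensorProduct.smul_tmul', smul_add]
      ca := by
        simp only [mul_add, add_mul, Algebra.TensorProduct.tmul_mul_tmul, mul_one, one_mul,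
          rel_ca, rel_bc, TensorProduct.tmul_smul, TensorProduct.smul_tmul', smul_add]
      dc := by
        simp only [mul_add, add_mul, Algebra.TensorProduct.tmul_mul_tmul, mul_one, one_mul,
          rel_dc, TensorProduct.tmul_smul, TensorProduct.smul_tmul', smul_add]
      bc := by
        simp only [Algebra.TensorProduct.tmul_mul_tmul, rel_bc]
      da := by
        have e : gen hn hq .d * gen hn hq .a =
            q • (gen hn hq .a * gen hn hq .d) + (1 - gen hn hq .b * gen hn hq .c) := by
          rw [← rel_da]; abel
        simp only [mul_add, add_mul, Algebra.TensorProduct.tmul_mul_tmul, mul_one, one_mul,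
          rel_ca, rel_db, e, ← rel_bc, TensorProduct.tmul_smul, TensorProduct.smul_tmul',
          smul_add, TensorProduct.add_tmul, TensorProduct.tmul_add, TensorProduct.sub_tmul,
          TensorProduct.tmul_sub, Algebra.TensorProduct.one_def]
        abel
      a_pow := by
        rw [add_comm, q_add_pow_primitive (by omega) hq]
        · simp [Algebra.TensorProduct.tmul_pow, rel_a_pow]
        · simp only [Algebra.TensorProduct.tmul_mul_tmul, mul_one, one_mul, rel_ba,
            TensorProduct.tmul_smul]
      d_pow := by
        rw [q_add_pow_primitive (by omega) hq]
        · simp [Algebra.TensorProduct.tmul_pow, rel_d_pow]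
        · simp only [Algebra.TensorProduct.tmul_mul_tmul, mul_one, one_mul, rel_dc,
            TensorProduct.tmul_smul]
      b_pow := by
        simp [Algebra.TensorProduct.tmul_pow, rel_b_pow, Algebra.TensorProduct.one_def]
      c_pow := by
        simp [Algebra.TensorProduct.tmul_pow, rel_c_pow, Algebra.TensorProduct.one_def] }

/-- The counit: `ε(a) = 0 = ε(d)`, `ε(b) = 1 = ε(c)`. -/
noncomputable def counit : TaftDouble hn hq →ₐ[k] k :=
  lift hn hq (a := 0) (b := 1) (c := 1) (d := 0)
    { ba := by simp
      db := by simp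
      ca := by simp
      dc := by simp
      bc := by simp
      da := by simp
      a_pow := zero_pow (by omega)
      d_pow := zero_pow (by omega)
      b_pow := by simp
      c_pow := by simp }

variable {hn hq}

theorem comul_gen (x : Gen) : comul hn hq (gen hn hq x) =
    genMap (gen hn hq .a ⊗ₜ gen hn hq .b + 1 ⊗ₜ gen hn hq .a)
      (gen hn hq .b ⊗ₜ gen hn hq .b) (gen hn hq .c ⊗ₜ gen hn hq .c)
      (gen hn hq .d ⊗ₜ gen hn hq .c + 1 ⊗ₜ gen hn hq .d) x :=
  lift_gen _ x

theorem counit_gen (x : Gen) : counit hn hq (gen hn hq x) = genMap 0 1 1 0 x :=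
  lift_gen _ x

/-- The bialgebra structure of `D_n`. -/
noncomputable instance : Bialgebra k (TaftDouble hn hq) :=
  Bialgebra.ofAlgHom (comul hn hq) (counit hn hq)
    (algHom_ext fun x => by
      cases x <;> simp [comul_gen, genMap, TensorProduct.add_tmul, TensorProduct.tmul_add,
        Algebra.TensorProduct.one_def, add_assoc])
    (algHom_ext fun x => by
      cases x <;> simp [comul_gen, counit_gen, genMap])
    (algHom_ext fun x => by
      cases x <;> simp [comul_gen, counit_gen, genMap])

/-! ### The simple modules -/

/-- The vector `v_{j+1}` of the standard basis `v₁, …, v_ℓ`, with the convention that it is `0` when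
`j ≥ ℓ`. -/
def stdVec (k : Type u) [Field k] (ℓ j : ℕ) : Fin ℓ → k :=
  if h : j < ℓ then Pi.single ⟨j, h⟩ 1 else 0

/-- The scalar `α_i(ℓ) = (q^i - 1)(1 - q^{i-ℓ}) / (q - 1)`. -/
def alpha (q : k) (ℓ i : ℕ) : k :=
  (q ^ i - 1) * (1 - q ^ ((i : ℤ) - (ℓ : ℤ))) / (q - 1)

/-- `a.v_j = v_{j+1}` for `1 ≤ j < ℓ`, `a.v_ℓ = 0`. -/
noncomputable def actA (k : Type u) [Field k] (ℓ : ℕ) : Module.End k (Fin ℓ → k) :=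
  (Pi.basisFun k (Fin ℓ)).constr k fun j => stdVec k ℓ (j + 1)

/-- `b.v_j = q^{r+j-1} v_j`. -/
noncomputable def actB (q : k) (ℓ : ℕ) (r : ℤ) : Module.End k (Fin ℓ → k) :=
  (Pi.basisFun k (Fin ℓ)).constr k fun j => q ^ (r + ((j : ℕ) + 1 : ℤ) - 1) • stdVec k ℓ j

/-- `c.v_j = q^{j-(r+ℓ)} v_j`. -/
noncomputable def actC (q : k) (ℓ : ℕ) (r : ℤ) : Module.End k (Fin ℓ → k) :=
  (Pi.basisFun k (Fin ℓ)).constr k fun j => q ^ (((j : ℕ) + 1 : ℤ) - (r + ℓ)) • stdVec k ℓ j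

/-- `d.v_j = α_{j-1}(ℓ) v_{j-1}` for `1 < j ≤ ℓ`, `d.v_1 = 0`. -/
noncomputable def actD (q : k) (ℓ : ℕ) : Module.End k (Fin ℓ → k) :=
  (Pi.basisFun k (Fin ℓ)).constr k fun j =>
    if (j : ℕ) = 0 then 0 else alpha q ℓ j • stdVec k ℓ (j - 1)

theorem stdVec_of_lt {ℓ j : ℕ} (h : j < ℓ) :
    stdVec k ℓ j = Pi.basisFun k (Fin ℓ) ⟨j, h⟩ := by
  simp [stdVec, h]

theorem stdVec_of_le {ℓ j : ℕ} (h : ℓ ≤ j) : stdVec k ℓ j = 0 := by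
  simp [stdVec, Nat.not_lt.2 h]

theorem end_ext {ℓ : ℕ} {f g : Module.End k (Fin ℓ → k)}
    (h : ∀ j, f (stdVec k ℓ j) = g (stdVec k ℓ j)) : f = g :=
  (Pi.basisFun k (Fin ℓ)).ext fun j => by simpa [stdVec_of_lt j.2] using h j

theorem actA_apply (ℓ j : ℕ) : actA k ℓ (stdVec k ℓ j) = stdVec k ℓ (j + 1) := by
  rcases Nat.lt_or_ge j ℓ with h | h
  · rw [stdVec_of_lt h, actA, Module.Basis.constr_basis]
  · rw [stdVec_of_le h, stdVec_of_le (by omega), map_zero]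

theorem actB_apply (ℓ j : ℕ) (r : ℤ) :
    actB q ℓ r (stdVec k ℓ j) = q ^ (r + j) • stdVec k ℓ j := by
  rcases Nat.lt_or_ge j ℓ with h | h
  · conv_lhs => rw [stdVec_of_lt h, actB, Module.Basis.constr_basis]
    congr 2
    simp only
    ring
  · rw [stdVec_of_le h, map_zero, smul_zero]

theorem actC_apply (ℓ j : ℕ) (r : ℤ) :
    actC q ℓ r (stdVec k ℓ j) = q ^ ((j : ℤ) + 1 - r - ℓ) • stdVec k ℓ j := by
  rcases Nat.lt_or_ge j ℓ with h | h
  · conv_lhs => rw [stdVec_of_lt h, actC, Module.Basis.constr_basis]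
    congr 2
    simp only
    ring
  · rw [stdVec_of_le h, map_zero, smul_zero]

theorem actD_zero (ℓ : ℕ) : actD q ℓ (stdVec k ℓ 0) = 0 := by
  rcases Nat.lt_or_ge 0 ℓ with h | h
  · rw [stdVec_of_lt h, actD, Module.Basis.constr_basis]
    simp
  · rw [stdVec_of_le h, map_zero]

theorem actD_succ (ℓ j : ℕ) :
    actD q ℓ (stdVec k ℓ (j + 1)) = alpha q ℓ (j + 1) • stdVec k ℓ j := by
  rcases Nat.lt_or_ge (j + 1) ℓ with h | h
  · rw [stdVec_of_lt h, actD, Module.Basis.constr_basis]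
    simp
  · rw [stdVec_of_le h, map_zero]
    rcases Nat.lt_or_ge j ℓ with h' | h'
    · have : ((j + 1 : ℕ) : ℤ) - (ℓ : ℤ) = 0 := by omega
      rw [alpha, this]
      simp
    · rw [stdVec_of_le h', smul_zero]

theorem actA_pow (ℓ m j : ℕ) : (actA k ℓ ^ m) (stdVec k ℓ j) = stdVec k ℓ (j + m) := by
  induction m with
  | zero => simp
  | succ m ih => rw [pow_succ', Module.End.mul_apply, ih, actA_apply, add_assoc]

theorem actD_pow (ℓ m j : ℕ) (h : j < m) : (actD q ℓ ^ m) (stdVec k ℓ j) = 0 := by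
  induction j generalizing m with
  | zero =>
    obtain ⟨m, rfl⟩ : ∃ m', m = m' + 1 := ⟨m - 1, by omega⟩
    rw [pow_succ, Module.End.mul_apply, actD_zero, map_zero]
  | succ j ih =>
    obtain ⟨m, rfl⟩ : ∃ m', m = m' + 1 := ⟨m - 1, by omega⟩
    rw [pow_succ, Module.End.mul_apply, actD_succ, map_smul, ih m (by omega), smul_zero]

theorem satisfies (hn : 3 ≤ n) (hq : IsPrimitiveRoot q n) {ℓ : ℕ} (hℓ : ℓ ≤ n) (r : ℤ) :
    Satisfies n q (actA k ℓ) (actB q ℓ r) (actC q ℓ r) (actD q ℓ) := by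
  have hq0 : q ≠ 0 := hq.ne_zero (by omega)
  have hq1 : q - 1 ≠ 0 := sub_ne_zero.2 (hq.ne_one (by omega))
  have hqn : ∀ z : ℤ, (q ^ z) ^ n = 1 := by
    intro z
    rw [← zpow_natCast, ← zpow_mul, mul_comm, zpow_mul, zpow_natCast, hq.pow_eq_one, one_zpow]
  refine ⟨?_, ?_, ?_, ?_, ?_, ?_, ?_, ?_, ?_, ?_⟩ <;> refine end_ext fun j => ?_
  · simp only [Module.End.mul_apply, LinearMap.smul_apply, actA_apply, actB_apply, map_smul,
      smul_smul]
    congr 1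
    rw [← zpow_one_add₀ hq0]
    congr 1
    push_cast
    ring
  · cases j with
    | zero => simp [Module.End.mul_apply, actB_apply, actD_zero]
    | succ j =>
      simp only [Module.End.mul_apply, LinearMap.smul_apply, actD_succ, actB_apply, map_smul,
        smul_smul]
      congr 1
      rw [show r + ((j + 1 : ℕ) : ℤ) = 1 + (r + j) by push_cast; ring, zpow_one_add₀ hq0]
      ring
  · simp only [Module.End.mul_apply, LinearMap.smul_apply, actA_apply, actC_apply, map_smul,
      smul_smul]
    congr 1
    rw [← zpow_one_add₀ hq0]
    congr 1
    push_cast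
    ring
  · cases j with
    | zero => simp [Module.End.mul_apply, actC_apply, actD_zero]
    | succ j =>
      simp only [Module.End.mul_apply, LinearMap.smul_apply, actD_succ, actC_apply, map_smul,
        smul_smul]
      congr 1
      rw [show ((j + 1 : ℕ) : ℤ) + 1 - r - ℓ = 1 + ((j : ℤ) + 1 - r - ℓ) by push_cast; ring,
        zpow_one_add₀ hq0]
      ring
  · simp only [Module.End.mul_apply, actB_apply, actC_apply, map_smul, smul_smul]
    rw [mul_comm]
  · have key : ∀ j : ℕ, alpha q ℓ (j + 1) - q * alpha q ℓ j =
        1 - q ^ (r + j) * q ^ ((j : ℤ) + 1 - r - ℓ) := by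
      intro j
      rw [← zpow_add₀ hq0, show r + (j : ℤ) + (j + 1 - r - ℓ) = (j : ℤ) + (j + 1 - ℓ) by ring,
        zpow_add₀ hq0, alpha, alpha,
        show ((j + 1 : ℕ) : ℤ) - ℓ = 1 + ((j : ℤ) - ℓ) by push_cast; ring,
        show (j : ℤ) + 1 - ℓ = 1 + ((j : ℤ) - ℓ) by ring, zpow_one_add₀ hq0, zpow_natCast]
      field_simp
      ring
    cases j with
    | zero =>
      have := key 0
      simp only [LinearMap.sub_apply, Module.End.mul_apply, LinearMap.smul_apply, actA_apply,
        actB_apply, actC_apply, actD_zero, actD_succ, map_smul, map_zero, smul_zero, sub_zero,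
        smul_smul, Module.End.one_apply]
      rw [mul_comm (q ^ _) (q ^ _), ← one_smul k (stdVec k ℓ 0), smul_smul, smul_smul, ← sub_smul,
        mul_one, mul_one, ← this]
      simp [alpha]
    | succ j =>
      have := key (j + 1)
      simp only [LinearMap.sub_apply, Module.End.mul_apply, LinearMap.smul_apply, actA_apply,
        actB_apply, actC_apply, actD_succ, map_smul, smul_smul, Module.End.one_apply]
      rw [← sub_smul, this, sub_smul, one_smul, mul_comm (q ^ _) (q ^ _)]
  · rw [actA_pow, stdVec_of_le (by omega), LinearMap.zero_apply]
  · rcases Nat.lt_or_ge j n with h | h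
    · rw [actD_pow ℓ n j h, LinearMap.zero_apply]
    · rw [stdVec_of_le (by omega), map_zero, map_zero]
  · have : ∀ m : ℕ, (actB q ℓ r ^ m) (stdVec k ℓ j) = (q ^ (r + j)) ^ m • stdVec k ℓ j := by
      intro m
      induction m with
      | zero => simp
      | succ m ih =>
        rw [pow_succ, Module.End.mul_apply, actB_apply, map_smul, ih, smul_smul, pow_succ']
    rw [this, hqn, one_smul, Module.End.one_apply]
  · have : ∀ m : ℕ, (actC q ℓ r ^ m) (stdVec k ℓ j) =
        (q ^ ((j : ℤ) + 1 - r - ℓ)) ^ m • stdVec k ℓ j := by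
      intro m
      induction m with
      | zero => simp
      | succ m ih =>
        rw [pow_succ, Module.End.mul_apply, actC_apply, map_smul, ih, smul_smul, pow_succ']
    rw [this, hqn, one_smul, Module.End.one_apply]

/-- The `D_n`-module `V(ℓ, r)` of dimension `ℓ ≤ n`.  It depends on `r` only modulo `n`. -/
noncomputable def V (hn : 3 ≤ n) (hq : IsPrimitiveRoot q n) (ℓ : ℕ) (hℓ : ℓ ≤ n) (r : ℤ) :
    FDModule k (TaftDouble hn hq) where
  carrier := Fin ℓ → k
  ρ := lift hn hq (satisfies hn hq hℓ r)

end TaftDouble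

/-! ### The elements of the complex Grothendieck algebra -/

open Polynomial in
/-- The polynomial `f(x, g) = ∑_{i=0}^{⌊n/2⌋} (-1)^i (n / (n-i)) (n-i choose i) g^i x^{n-2i} - 2` in
the variable `x`, with coefficients in a commutative `ℂ`-algebra that contains `g`. -/
noncomputable def chebF (n : ℕ) {R : Type*} [CommRing R] [Algebra ℂ R] (g : R) : R[X] :=
  ∑ i ∈ Finset.range (n / 2 + 1),
    C (algebraMap ℂ R ((-1) ^ i * ((n : ℂ) / ((n : ℂ) - (i : ℂ))) * ((n - i).choose i : ℂ)) * g ^ i)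
      * X ^ (n - 2 * i) - 2

/-- `λ_{j,r} = ζ^r (ζ^j + ζ^{-j})`. -/
noncomputable def lam (ζ : ℂ) (j r : ℕ) : ℂ := ζ ^ r * (ζ ^ j + (ζ ^ j)⁻¹)

/-- `ξ_r = ∏_{1 ≤ j ≤ (n-1)/2} (2 ζ^r - ζ^r (ζ^j + ζ^{-j}))²`. -/
noncomputable def xi (n : ℕ) (ζ : ℂ) (r : ℕ) : ℂ :=
  ∏ j ∈ Finset.Icc 1 ((n - 1) / 2), (2 * ζ ^ r - lam ζ j r) ^ 2

/-- `ϑ_{j,r} = (λ_{j,r} - λ_{0,r}) ∏_{1 ≤ k ≤ (n-1)/2, k ≠ j} (λ_{j,r} - λ_{k,r})²`. -/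
noncomputable def vartheta (n : ℕ) (ζ : ℂ) (j r : ℕ) : ℂ :=
  (lam ζ j r - lam ζ 0 r) *
    ∏ k ∈ (Finset.Icc 1 ((n - 1) / 2)).erase j, (lam ζ j r - lam ζ k r) ^ 2

namespace TaftDouble

variable {k : Type u} [Field k] {n : ℕ} {q : k} (hn : 3 ≤ n) (hq : IsPrimitiveRoot q n)

/-- The complex Grothendieck algebra of `D_n`. -/
abbrev Groth : Type (u + 1) := G0C k (TaftDouble hn hq)

/-- `g = [V(1,1)]`. -/
noncomputable def gElt : Groth hn hq := G0C.cls (V hn hq 1 (by omega) 1)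

/-- `x = [V(2,0)]`. -/
noncomputable def xElt : Groth hn hq := G0C.cls (V hn hq 2 (by omega) 0)

/-- `E_u = (1/n) ∑_{v=0}^{n-1} ζ^{-uv} g^v`. -/
noncomputable def eElt (ζ : ℂ) (u : ℕ) : Groth hn hq :=
  (1 / (n : ℂ)) • ∑ v ∈ Finset.range n, (ζ ^ (u * v))⁻¹ • gElt hn hq ^ v

open Polynomial in
/-- `F_{j,r} = (f(x, ζ^{2r}) / (x - λ_{j,r})) E_{2r}`; the quotient is an exact quotient of
polynomials in `x`. -/
noncomputable def fElt (ζ : ℂ) (j r : ℕ) : Groth hn hq :=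
  aeval (xElt hn hq) (chebF n (ζ ^ (2 * r)) /ₘ (X - C (lam ζ j r))) * eElt hn hq ζ (2 * r)

open Polynomial in
/-- `G_{j,r} = (f(x, ζ^{2r}) / (x - λ_{j,r})²) E_{2r}`, for `1 ≤ j ≤ (n-1)/2`; the quotient is an
exact quotient of polynomials in `x`. -/
noncomputable def gjElt (ζ : ℂ) (j r : ℕ) : Groth hn hq :=
  aeval (xElt hn hq) (chebF n (ζ ^ (2 * r)) /ₘ (X - C (lam ζ j r)) ^ 2) * eElt hn hq ζ (2 * r)

/-- The simple modules `V(ℓ, r)`, `1 ≤ ℓ ≤ n`, `0 ≤ r ≤ n - 1`, indexed by the pairs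
`(ℓ - 1, r)`. -/
noncomputable def simpleModule (i : Fin n × Fin n) : FDModule k (TaftDouble hn hq) :=
  V hn hq (i.1 + 1) i.1.2 (i.2 : ℕ)

/-- The McKay matrix of `W`: the entry at `(i, j)` is the multiplicity `[S_i ⊗ W : S_j]`. -/
noncomputable def mcKay (W : FDModule k (TaftDouble hn hq)) :
    Matrix (Fin n × Fin n) (Fin n × Fin n) ℂ :=
  Matrix.of fun i j =>
    (((simpleModule hn hq i).tensor W).multiplicity (simpleModule hn hq j) : ℂ)

end TaftDouble

/-! The simple modules come from highest weight theory. Since `d` is nilpotent and `b`, `c`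
normalise its kernel, every nonzero module contains a common eigenvector `w` of `b` and `c` killed
by `d`; its eigenvalues are powers of `q` and so have the form attached to some pair `(ℓ, r)`.
Either `a^ℓ w = 0` and `w` generates a copy of `V(ℓ, r)`, or `a^ℓ w` is again a highest weight
vector, of label `n - ℓ`, and is killed by `a^(n-ℓ)` because `a^n = 0` (`exists_equiv_V`). By
Jordan–Hölder, multiplicities are additive on exact sequences, so the simple classes form a basis of
the Grothendieck ring.

Write `u_ℓ = [V(ℓ,0)]`. Tensoring with `V(1,s)` shifts `r` by `s`, and tensoring with `V(2,0)` gives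
`u_ℓ x = u_{ℓ+1} + g u_{ℓ-1}` for `ℓ < n` and `u_n x = 2 g u_{n-1} + 2` (`cls_tensor_two_of_lt`,
`cls_tensor_two_self`). Thus `g` and `x` generate, the ring is commutative, and the Dickson
polynomials satisfy `D_m(x, g) = u_{m+1} - g u_{m-1}` for `1 ≤ m < n`, while the boundary relation
gives `D_n(x, g) = 2`. Since `f = D_n - 2`, comparing dimensions with `n²` yields the presentation.

From then on only `g^n = 1`, `f(x, g) = 0`, generation and the dimension matter
(`IsChebyshevAlgebra`). As `n` is odd, the idempotents `E_{2r}` are all the idempotents of the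
cyclic group algebra, and on the block of `E_{2r}` one has `g = ζ^{2r}`. Substituting `x = ζ^r (y +
y⁻¹)` turns `f(x, ζ^{2r})` into `y^n + y^{-n} - 2 = y^{-n} (y^n - 1)²`, so `λ_{0,r}` is a simple
root and the other `λ_{j,r}` are double roots (`chebF_eq_prod`). Each block is therefore a copy of
`ℂ` times `(n-1)/2` copies of the dual numbers; `F_{0,r}` spans the former, and `G_{j,r}`, `F_{j,r}`
span the latter, the `F_{j,r}` with `j ≥ 1` being the nilpotent part.

Finally, right multiplication by the McKay matrix of `W` on row vectors is multiplication by `[W]`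
(`vecMul_mcKay`). The products with `F_{j,r}` and `G_{j,r}` are thus Jordan chains, and since these
vectors form a basis, all eigenspaces can be read off. -/

/-! ### Additivity of composition multiplicities. -/

section CompositionMultiplicity

variable {A : Type*} [Ring A]

/-- The number of factors of a composition series that are isomorphic to `S`. -/
noncomputable def CompositionSeries.factorCount {M : Type*} [AddCommGroup M] [Module A M]
    (s : CompositionSeries (Submodule A M)) (S : Type*) [AddCommGroup S] [Module A S] : ℕ :=
  Nat.card {i : Fin s.length // Nonempty
    ((s i.succ ⧸ (s i.castSucc).comap (s i.succ).subtype) ≃ₗ[A] S)}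

/-- The multiplicity of `S` as a composition factor of `M`. -/
noncomputable def compMult (A : Type*) [Ring A] (M : Type*) [AddCommGroup M] [Module A M]
    (S : Type*) [AddCommGroup S] [Module A S] : ℕ :=
  sSup {m : ℕ | ∃ s : CompositionSeries (Submodule A M), s.head = ⊥ ∧ s.last = ⊤ ∧
    m = s.factorCount S}

variable {M N : Type*} [AddCommGroup M] [Module A M] [AddCommGroup N] [Module A N]
  (S : Type*) [AddCommGroup S] [Module A S]

theorem CompositionSeries.factorCount_congr (s : CompositionSeries (Submodule A M))
    (t : CompositionSeries (Submodule A N)) (e : Fin s.length ≃ Fin t.length)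
    (h : ∀ i, Nonempty ((s i.succ ⧸ (s i.castSucc).comap (s i.succ).subtype) ≃ₗ[A]
      (t (e i).succ ⧸ (t (e i).castSucc).comap (t (e i).succ).subtype))) :
    s.factorCount S = t.factorCount S := by
  refine Nat.card_congr (e.subtypeEquiv fun i => ?_)
  obtain ⟨f⟩ := h i
  exact ⟨fun ⟨g⟩ => ⟨f.symm.trans g⟩, fun ⟨g⟩ => ⟨f.trans g⟩⟩

theorem CompositionSeries.factorCount_eq_of_head_last {s t : CompositionSeries (Submodule A M)}
    (h0 : s.head = t.head) (h1 : s.last = t.last) : s.factorCount S = t.factorCount S := by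
  obtain ⟨e, he⟩ := CompositionSeries.jordan_holder s t h0 h1
  exact factorCount_congr S s t e fun i => ⟨(he i).linearEquiv⟩

theorem compMult_eq_factorCount (s : CompositionSeries (Submodule A M)) (h0 : s.head = ⊥)
    (h1 : s.last = ⊤) : compMult A M S = s.factorCount S := by
  have : {m : ℕ | ∃ s : CompositionSeries (Submodule A M), s.head = ⊥ ∧ s.last = ⊤ ∧
      m = s.factorCount S} = {s.factorCount S} := by
    ext m
    constructor
    · rintro ⟨t, ht0, ht1, rfl⟩
      exact CompositionSeries.factorCount_eq_of_head_last S (ht0.trans h0.symm) (ht1.trans h1.symm)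
    · rintro rfl
      exact ⟨s, h0, h1, rfl⟩
  rw [compMult, this, csSup_singleton]

/-- An injective map identifies the subquotient of two submodules with that of their images. -/
noncomputable def Submodule.subquotientMapEquiv (f : M →ₗ[A] N) (hf : Function.Injective f)
    (p p' : Submodule A M) :
    (p' ⧸ p.comap p'.subtype) ≃ₗ[A] (p'.map f ⧸ (p.map f).comap (p'.map f).subtype) :=
  Submodule.Quotient.equiv _ _ (p'.equivMapOfInjective f hf) (by
    ext ⟨y, x, hx, rfl⟩
    simp only [Submodule.mem_map, Submodule.mem_comap, Submodule.subtype_apply, Subtype.exists]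
    constructor
    · rintro ⟨z, hz, hzp, he⟩
      exact ⟨z, hzp, congrArg Subtype.val he⟩
    · rintro ⟨z, hz, he⟩
      obtain rfl := hf he
      exact ⟨z, hx, hz, rfl⟩)

/-- A surjective map identifies the subquotient of two submodules with that of their preimages. -/
noncomputable def Submodule.subquotientComapEquiv (f : M →ₗ[A] N) (hf : Function.Surjective f)
    (p p' : Submodule A N) :
    (p'.comap f ⧸ (p.comap f).comap (p'.comap f).subtype) ≃ₗ[A] (p' ⧸ p.comap p'.subtype) := by
  let g : p'.comap f →ₗ[A] (p' ⧸ p.comap p'.subtype) :=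
    (p.comap p'.subtype).mkQ ∘ₗ f.restrict (p := p'.comap f) (q := p') fun _ hx => hx
  have hk : LinearMap.ker g = (p.comap f).comap (p'.comap f).subtype := by
    ext x
    simp [g]
  have hg : Function.Surjective g := by
    intro y
    obtain ⟨⟨y, hy⟩, rfl⟩ := Submodule.mkQ_surjective _ y
    obtain ⟨x, rfl⟩ := hf y
    exact ⟨⟨x, hy⟩, rfl⟩
  exact (Submodule.quotEquivOfEq _ _ hk.symm).trans (g.quotKerEquivOfSurjective hg)

/-- The image of a composition series under an injective map. -/
def CompositionSeries.mapInjective (f : M →ₗ[A] N) (hf : Function.Injective f)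
    (s : CompositionSeries (Submodule A M)) : CompositionSeries (Submodule A N) :=
  s.map ⟨Submodule.map f, Submodule.map_covBy_of_injective hf⟩

theorem CompositionSeries.factorCount_mapInjective (f : M →ₗ[A] N) (hf : Function.Injective f)
    (s : CompositionSeries (Submodule A M)) :
    (s.mapInjective f hf).factorCount S = s.factorCount S :=
  (factorCount_congr S s (s.mapInjective f hf) (Equiv.refl _) fun i =>
    ⟨Submodule.subquotientMapEquiv f hf (s i.castSucc) (s i.succ)⟩).symm

theorem compMult_congr [IsNoetherian A M] [IsArtinian A M] (e : M ≃ₗ[A] N) :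
    compMult A M S = compMult A N S := by
  obtain ⟨s, h0, h1⟩ := exists_compositionSeries_of_isNoetherian_isArtinian A M
  rw [compMult_eq_factorCount S s h0 h1,
    compMult_eq_factorCount S (s.mapInjective e.toLinearMap e.injective),
    CompositionSeries.factorCount_mapInjective]
  · change Submodule.map e.toLinearMap s.head = ⊥
    rw [h0, Submodule.map_bot]
  · change Submodule.map e.toLinearMap s.last = ⊤
    rw [h1, Submodule.map_top, LinearEquiv.range]

theorem compMult_of_subsingleton [Subsingleton M] : compMult A M S = 0 := by
  rw [compMult_eq_factorCount S (RelSeries.singleton _ ⊥) rfl (Subsingleton.elim _ _)]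
  exact @Nat.card_of_isEmpty _ ⟨fun i => i.1.elim0⟩

theorem exists_compositionSeries_head_last [IsNoetherian A M] [IsArtinian A M]
    (p : Submodule A M) :
    ∃ s : CompositionSeries (Submodule A M), s.head = ⊥ ∧ s.last = p ∧
      compMult A p S = s.factorCount S := by
  obtain ⟨s, h0, h1⟩ := exists_compositionSeries_of_isNoetherian_isArtinian A p
  refine ⟨s.mapInjective p.subtype p.injective_subtype, ?_, ?_, ?_⟩
  · change Submodule.map p.subtype s.head = ⊥
    rw [h0, Submodule.map_bot]
  · change Submodule.map p.subtype s.last = p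
    rw [h1, Submodule.map_top, Submodule.range_subtype]
  · rw [compMult_eq_factorCount S s h0 h1, CompositionSeries.factorCount_mapInjective]

open Classical in
-- A composition series ending at `p` becomes one ending at `p'` by appending `p'`, which adds the
-- single factor `p' / p`; Jordan–Hölder allows this series to be used for `p'`. This one-step rule
-- drives all later inductions along submodules.
theorem compMult_covBy [IsNoetherian A M] [IsArtinian A M] {p p' : Submodule A M} (h : p ⋖ p') :
    compMult A p' S =
      compMult A p S + if Nonempty ((p' ⧸ p.comap p'.subtype) ≃ₗ[A] S) then 1 else 0 := by
  obtain ⟨s, h0, h1, hs⟩ := exists_compositionSeries_head_last S p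
  obtain ⟨t, ht0, ht1, ht⟩ := exists_compositionSeries_head_last S p'
  have hl : s.last ⋖ p' := h1 ▸ h
  let s₁ : CompositionSeries (Submodule A M) := RelSeries.snoc s p' hl
  have e : t.factorCount S = s₁.factorCount S :=
    CompositionSeries.factorCount_eq_of_head_last S
      (ht0.trans (h0.symm.trans (RelSeries.head_snoc s p' hl).symm))
      (ht1.trans (RelSeries.last_snoc s p' hl).symm)
  rw [ht, hs, e]
  have key : ∀ s' : CompositionSeries (Submodule A M), s'.factorCount S =
      ∑ i : Fin s'.length, if Nonempty
        ((s' i.succ ⧸ (s' i.castSucc).comap (s' i.succ).subtype) ≃ₗ[A] S) then 1 else 0 := by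
    intro s'
    rw [CompositionSeries.factorCount, Nat.card_eq_fintype_card, Fintype.card_subtype,
      Finset.sum_boole, Nat.cast_id]
  rw [key, key]
  have hc : ∀ i : Fin (s.length + 1), s₁ (Fin.castSucc i) = s i :=
    RelSeries.snoc_castSucc s p' hl
  have hlast : s₁ (Fin.last (s.length + 1)) = p' := RelSeries.last_snoc' s p' hl
  refine (Fin.sum_univ_castSucc (n := s.length) _).trans ?_
  have aux : ∀ a b c d : Submodule A M, a = c → b = d →
      (Nonempty ((b ⧸ a.comap b.subtype) ≃ₗ[A] S) ↔ Nonempty ((d ⧸ c.comap d.subtype) ≃ₗ[A] S)) := by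
    rintro a b _ _ rfl rfl
    rfl
  congr 1
  · refine Finset.sum_congr rfl fun i _ => if_congr (aux _ _ _ _ ?_ ?_) rfl rfl
    · exact hc _
    · exact hc i.succ
  · refine if_congr (aux _ _ _ _ ?_ ?_) rfl rfl
    · exact (hc (Fin.last _)).trans h1
    · exact hlast

open Classical in
-- Well-founded induction on a submodule `p` of `N`, comparing it with its preimage under `g`.
-- Preimages of covers are covers with the same simple factor, so both sides jump together, and the
-- preimage of `⊥` is `ker g`, a copy of `L`.
theorem compMult_of_exact {L : Type*} [AddCommGroup L] [Module A L] [IsNoetherian A M]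
    [IsArtinian A M] [IsNoetherian A N] [IsArtinian A N] {f : L →ₗ[A] M} {g : M →ₗ[A] N}
    (hf : Function.Injective f) (hfg : Function.Exact f g) (hg : Function.Surjective g) :
    compMult A M S = compMult A L S + compMult A N S := by
  have key : ∀ p : Submodule A N,
      compMult A (p.comap g) S = compMult A L S + compMult A p S := by
    intro p
    induction p using WellFoundedLT.induction with
    | ind p ih =>
      rcases eq_or_ne p ⊥ with rfl | hp
      · rw [compMult_of_subsingleton (M := (⊥ : Submodule A N)), add_zero]
        refine compMult_congr S (LinearEquiv.ofEq _ _ ?_ ≪≫ₗ (LinearEquiv.ofInjective f hf).symm)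
        rw [Submodule.comap_bot, hfg.linearMap_ker_eq]
      · obtain ⟨r, -, hr⟩ := exists_le_covBy_of_lt (bot_lt_iff_ne_bot.2 hp)
        rw [compMult_covBy S (Submodule.comap_covBy_of_surjective hg hr), compMult_covBy S hr,
          ih r hr.lt, add_assoc]
        congr 2
        have e := Submodule.subquotientComapEquiv g hg r p
        exact if_congr ⟨fun ⟨h⟩ => ⟨e.symm.trans h⟩, fun ⟨h⟩ => ⟨e.trans h⟩⟩ rfl rfl
  have := key ⊤
  rw [Submodule.comap_top, compMult_congr S (Submodule.topEquiv (R := A) (M := M)),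
    compMult_congr S (Submodule.topEquiv (R := A) (M := N))] at this
  exact this

open Classical in
theorem compMult_of_isSimpleModule [IsSimpleModule A M] :
    compMult A M S = if Nonempty (M ≃ₗ[A] S) then 1 else 0 := by
  have h := compMult_covBy S (bot_covBy_top (α := Submodule A M))
  rw [compMult_congr S (Submodule.topEquiv (R := A) (M := M)),
    compMult_of_subsingleton (M := (⊥ : Submodule A M)), zero_add] at h
  rw [h]
  have e : ((⊤ : Submodule A M) ⧸ (⊥ : Submodule A M).comap (⊤ : Submodule A M).subtype) ≃ₗ[A] M :=
    (Submodule.quotEquivOfEqBot _ (by rw [Submodule.comap_bot, Submodule.ker_subtype])).trans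
      Submodule.topEquiv
  exact if_congr ⟨fun ⟨h⟩ => ⟨e.symm.trans h⟩, fun ⟨h⟩ => ⟨e.trans h⟩⟩ rfl rfl

end CompositionMultiplicity

/-! ### Classes of submodules of a finite-dimensional module. -/

namespace FDModule

variable {k A : Type u} [Field k] [Ring A] [Algebra k A]

instance (V : FDModule k A) : IsNoetherian A V.carrier := isNoetherian_of_tower k inferInstance
instance (V : FDModule k A) : IsArtinian A V.carrier := isArtinian_of_tower k inferInstance

instance (V : FDModule k A) (p : Submodule A V.carrier) : FiniteDimensional k p :=
  inferInstanceAs (FiniteDimensional k (p.restrictScalars k))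

/-- A module over `A` that is finite-dimensional over `k`. -/
noncomputable def ofModule (k : Type u) {A : Type u} [Field k] [Ring A] [Algebra k A] (M : Type u)
    [AddCommGroup M] [Module k M] [Module A M] [IsScalarTower k A M] [FiniteDimensional k M] :
    FDModule k A where
  carrier := M
  ρ := Algebra.lsmul k k M

section ofModule

variable (M : Type u) [AddCommGroup M] [Module k M] [Module A M] [IsScalarTower k A M]
  [FiniteDimensional k M]

/-- The tautological isomorphism. -/
noncomputable def ofModuleEquiv : (ofModule (A := A) k M).carrier ≃ₗ[A] M :=
  { AddEquiv.refl M with map_smul' := fun _ _ => rfl }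

end ofModule

variable {V : FDModule k A}

/-- The class of a submodule. -/
noncomputable def subCls (p : Submodule A V.carrier) : G0 k A := G0.cls (ofModule k p)

theorem subCls_bot : subCls (⊥ : Submodule A V.carrier) = 0 := by
  rw [← G0.cls_zero]
  have : Subsingleton (zero k A).carrier := inferInstanceAs (Subsingleton PUnit)
  have : Subsingleton (ofModule (A := A) k (⊥ : Submodule A V.carrier)).carrier :=
    (ofModuleEquiv (k := k) (⊥ : Submodule A V.carrier)).toEquiv.subsingleton
  exact G0.cls_of_equiv 0

theorem subCls_top : subCls (⊤ : Submodule A V.carrier) = G0.cls V :=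
  G0.cls_of_equiv ((ofModuleEquiv _).trans Submodule.topEquiv)

/-- If `p ≤ p'` and `p' / p` is isomorphic to `W`, then `[p'] = [p] + [W]`. -/
theorem subCls_of_le {p p' : Submodule A V.carrier} (h : p ≤ p') {W : FDModule k A}
    (e : (p' ⧸ p.comap p'.subtype) ≃ₗ[A] W.carrier) : subCls p' = subCls p + G0.cls W := by
  refine G0.cls_of_shortExact ⟨(ofModuleEquiv (k := k) _).symm.toLinearMap ∘ₗ
    Submodule.inclusion h ∘ₗ (ofModuleEquiv (k := k) p).toLinearMap, e.toLinearMap ∘ₗ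
    (p.comap p'.subtype).mkQ ∘ₗ (ofModuleEquiv (k := k) p').toLinearMap, ?_, ?_, ?_⟩
  · simpa using Submodule.inclusion_injective h
  · intro x
    obtain ⟨x, rfl⟩ := (ofModuleEquiv (k := k) p').symm.surjective x
    simp only [LinearMap.comp_apply, LinearEquiv.coe_coe, LinearEquiv.apply_symm_apply,
      LinearEquiv.map_eq_zero_iff, Submodule.mkQ_apply, Submodule.Quotient.mk_eq_zero,
      Submodule.mem_comap, Submodule.subtype_apply, Set.mem_range, EmbeddingLike.apply_eq_iff_eq]
    constructor
    · intro hx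
      refine ⟨(ofModuleEquiv (k := k) p).symm ⟨x, hx⟩, ?_⟩
      rw [LinearEquiv.apply_symm_apply]
      rfl
    · rintro ⟨y, rfl⟩
      exact (ofModuleEquiv (k := k) p y).2
  · simpa using (Submodule.mkQ_surjective _)

/-- The general `compMult` also applies to submodules and quotients without packaging them as an
`FDModule`. -/
theorem multiplicity_eq_compMult (V S : FDModule k A) :
    V.multiplicity S = compMult A V.carrier S.carrier := rfl

end FDModule

/-! ### Simple classes as a basis of the Grothendieck group. -/

namespace G0

variable {k A : Type u} [Field k] [Ring A] [Algebra k A]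

/-- The multiplicity of a module `S` as a composition factor, on the Grothendieck group. -/
noncomputable def multHom (S : FDModule k A) : G0 k A →+ ℤ :=
  lift (fun V => (V.multiplicity S : ℤ)) fun _ _ _ ⟨_, _, hf, hfg, hg⟩ => by
    simp only [FDModule.multiplicity_eq_compMult]
    exact_mod_cast compMult_of_exact S.carrier hf hfg hg

theorem multHom_cls (S V : FDModule k A) : multHom S (cls V) = V.multiplicity S :=
  lift_cls _ _ _

variable {ι : Type*} [Fintype ι] (S : ι → FDModule k A)

/-- Climb the submodules of `V` one cover at a time. Each cover adds a simple factor, isomorphic to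
exactly one `S i`, and both sides increase by the class of that `S i`. -/
theorem cls_eq_sum_multiplicity (hinj : ∀ i j, Nonempty ((S i).carrier ≃ₗ[A] (S j).carrier) → i = j)
    (hex : ∀ T : FDModule k A, IsSimpleModule A T.carrier →
      ∃ i, Nonempty (T.carrier ≃ₗ[A] (S i).carrier)) (V : FDModule k A) :
    cls V = ∑ i, V.multiplicity (S i) • cls (S i) := by
  classical
  have key : ∀ p : Submodule A V.carrier,
      FDModule.subCls p = ∑ i, compMult A p (S i).carrier • cls (S i) := by
    intro p
    induction p using WellFoundedLT.induction with
    | ind p ih =>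
      rcases eq_or_ne p ⊥ with rfl | hp
      · rw [FDModule.subCls_bot, Finset.sum_eq_zero]
        intro i _
        rw [compMult_of_subsingleton, zero_smul]
      · obtain ⟨r, -, hr⟩ := exists_le_covBy_of_lt (bot_lt_iff_ne_bot.2 hp)
        have hs : IsSimpleModule A (p ⧸ r.comap p.subtype) :=
          (covBy_iff_quot_is_simple hr.le).1 hr
        let T : FDModule k A := FDModule.ofModule k (p ⧸ r.comap p.subtype)
        let eT : T.carrier ≃ₗ[A] (p ⧸ r.comap p.subtype) := FDModule.ofModuleEquiv _
        obtain ⟨i₀, ⟨e⟩⟩ := hex T (IsSimpleModule.congr eT)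
        have e' := eT.symm.trans e
        rw [FDModule.subCls_of_le hr.le e', ih r hr.lt]
        simp_rw [compMult_covBy _ hr, add_smul, Finset.sum_add_distrib]
        congr 1
        rw [Finset.sum_eq_single i₀, if_pos ⟨e'⟩, one_smul]
        · intro i _ hi
          rw [if_neg, zero_smul]
          rintro ⟨f⟩
          exact hi (hinj _ _ ⟨f.symm.trans e'⟩)
        · simp
  have := key ⊤
  rw [FDModule.subCls_top] at this
  rw [this]
  refine Finset.sum_congr rfl fun i _ => ?_
  rw [compMult_congr _ (Submodule.topEquiv (R := A) (M := V.carrier)),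
    FDModule.multiplicity_eq_compMult]

/-- The classes of the simple modules form a basis of the Grothendieck group. -/
noncomputable def simpleBasis (hsimple : ∀ i, IsSimpleModule A (S i).carrier)
    (hinj : ∀ i j, Nonempty ((S i).carrier ≃ₗ[A] (S j).carrier) → i = j)
    (hex : ∀ T : FDModule k A, IsSimpleModule A T.carrier →
      ∃ i, Nonempty (T.carrier ≃ₗ[A] (S i).carrier)) : Module.Basis ι ℤ (G0 k A) :=
  Module.Basis.ofEquivFun <| AddEquiv.toIntLinearEquiv
    { toFun := fun x i => multHom (S i) x
      invFun := fun c => ∑ i, c i • cls (S i)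
      map_add' := fun x y => by ext i; simp
      left_inv := by
        -- The round trip is packaged as an additive endomorphism, so that it only has to be
        -- compared with the identity on classes of modules.
        refine DFunLike.congr_fun (f := (⟨⟨fun x => ∑ i, multHom (S i) x • cls (S i), by simp⟩,
          fun x y => by simp [add_smul, Finset.sum_add_distrib]⟩ : G0 k A →+ G0 k A))
          (g := AddMonoidHom.id _) ?_
        refine hom_ext fun V => ?_
        simp only [AddMonoidHom.coe_mk, ZeroHom.coe_mk, multHom_cls, AddMonoidHom.id_apply,
          natCast_zsmul]
        exact (cls_eq_sum_multiplicity S hinj hex V).symm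
      right_inv := by
        classical
        intro c
        ext j
        -- Multiplicities between the given simple modules are Kronecker deltas.
        simp only [map_sum, map_zsmul, multHom_cls, FDModule.multiplicity_eq_compMult]
        rw [Finset.sum_eq_single j]
        · have := hsimple j
          rw [compMult_of_isSimpleModule, if_pos ⟨LinearEquiv.refl _ _⟩]
          simp
        · intro i _ hij
          have := hsimple i
          rw [compMult_of_isSimpleModule, if_neg fun h => hij (hinj _ _ h)]
          simp
        · simp }

variable (hsimple : ∀ i, IsSimpleModule A (S i).carrier)
    (hinj : ∀ i j, Nonempty ((S i).carrier ≃ₗ[A] (S j).carrier) → i = j)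
    (hex : ∀ T : FDModule k A, IsSimpleModule A T.carrier →
      ∃ i, Nonempty (T.carrier ≃ₗ[A] (S i).carrier))

theorem simpleBasis_repr_cls (V : FDModule k A) (i : ι) :
    (simpleBasis S hsimple hinj hex).repr (cls V) i = V.multiplicity (S i) :=
  multHom_cls (S i) V

theorem simpleBasis_apply (i : ι) : simpleBasis S hsimple hinj hex i = cls (S i) := by
  classical
  refine (congrFun (Module.Basis.coe_ofEquivFun _) i).trans ?_
  change ∑ j, (Pi.single i 1 : ι → ℤ) j • cls (S j) = _
  rw [Finset.sum_eq_single i]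
  · simp
  · intro j _ h
    simp [h]
  · simp

end G0

/-! ### Extension of scalars to the complex numbers. -/

namespace G0C

variable {k A : Type u} [Field k] [Ring A] [Bialgebra k A] {ι : Type*} [Fintype ι]
  (S : ι → FDModule k A) (hsimple : ∀ i, IsSimpleModule A (S i).carrier)
    (hinj : ∀ i j, Nonempty ((S i).carrier ≃ₗ[A] (S j).carrier) → i = j)
    (hex : ∀ T : FDModule k A, IsSimpleModule A T.carrier →
      ∃ i, Nonempty (T.carrier ≃ₗ[A] (S i).carrier))

/-- The classes of the simple modules form a basis of the complex Grothendieck algebra. -/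
noncomputable def simpleBasis : Module.Basis ι ℂ (G0C k A) :=
  (G0.simpleBasis S hsimple hinj hex).baseChange ℂ

theorem simpleBasis_apply (i : ι) : simpleBasis S hsimple hinj hex i = cls (S i) := by
  rw [simpleBasis, Module.Basis.baseChange_apply, G0.simpleBasis_apply]
  rfl

theorem simpleBasis_repr_cls (V : FDModule k A) (i : ι) :
    (simpleBasis S hsimple hinj hex).repr (cls V) i = V.multiplicity (S i) := by
  rw [simpleBasis, cls, Module.Basis.baseChange_repr_tmul, G0.simpleBasis_repr_cls]
  simp

theorem cls_mul_cls (U V : FDModule k A) : cls U * cls V = cls (U.tensor V) := by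
  rw [cls, cls, Algebra.TensorProduct.tmul_mul_tmul, one_mul, G0.cls_mul_cls]
  rfl

theorem one_def : (1 : G0C k A) = cls (FDModule.trivial k A) := rfl

end G0C

/-! ### Highest weight vectors for the Drinfeld double. -/

namespace TaftDouble

variable {k : Type u} [Field k] {n : ℕ} {q : k} {hn : 3 ≤ n} {hq : IsPrimitiveRoot q n}

theorem induction_on {P : TaftDouble hn hq → Prop} (x : TaftDouble hn hq)
    (hgen : ∀ y, P (gen hn hq y)) (hscalar : ∀ c : k, P (algebraMap k _ c))
    (hadd : ∀ x y, P x → P y → P (x + y)) (hmul : ∀ x y, P x → P y → P (x * y)) : P x := by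
  obtain ⟨x, rfl⟩ := RingQuot.mkAlgHom_surjective k (Rel n q) x
  induction x using FreeAlgebra.induction with
  | grade0 c => exact (AlgHom.commutes (RingQuot.mkAlgHom k (Rel n q)) c).symm ▸ hscalar c
  | grade1 y => exact hgen y
  | mul x y hx hy => exact (map_mul (RingQuot.mkAlgHom k (Rel n q)) x y).symm ▸ hmul _ _ hx hy
  | add x y hx hy => exact (map_add (RingQuot.mkAlgHom k (Rel n q)) x y).symm ▸ hadd _ _ hx hy

section Module

variable {M : Type*} [AddCommGroup M] [Module k M] [Module (TaftDouble hn hq) M]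
  [IsScalarTower k (TaftDouble hn hq) M]

/-- A linear map that commutes with the action of the generators is a homomorphism. -/
noncomputable def homOfGen {U : FDModule k (TaftDouble hn hq)} (f : U.carrier →ₗ[k] M)
    (h : ∀ x v, f (gen hn hq x • v) = gen hn hq x • f v) :
    U.carrier →ₗ[TaftDouble hn hq] M where
  toFun := f
  map_add' := f.map_add
  map_smul' x := by
    refine induction_on (P := fun x => ∀ v, f (x • v) = x • f v) x h ?_ ?_ ?_
    · intro c v
      simp
    · intro x y hx hy v
      rw [add_smul, map_add, hx, hy, add_smul]
    · intro x y hx hy v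
      rw [mul_smul, hx, hy, mul_smul]

/-- The vector `w` is a highest weight vector with the weight of `v₁ ∈ V(ℓ, r)`. -/
structure IsHighestWeight (hn : 3 ≤ n) (hq : IsPrimitiveRoot q n) {M : Type*} [AddCommGroup M]
    [Module k M] [Module (TaftDouble hn hq) M] (w : M) (ℓ : ℕ) (r : ℤ) : Prop where
  d_smul : gen hn hq .d • w = 0
  b_smul : gen hn hq .b • w = q ^ r • w
  c_smul : gen hn hq .c • w = q ^ (1 - r - ℓ) • w

omit [IsScalarTower k (TaftDouble hn hq) M] in
-- The labels enter only through powers of `q`, hence modulo `n`. This permits normalising `r`, and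
-- replacing the label `ℓ = n + 1` by `1` in `cls_tensor_two_self`.
theorem IsHighestWeight.congr {w : M} {ℓ ℓ' : ℕ} {r r' : ℤ} (h : IsHighestWeight hn hq w ℓ r)
    (hr : q ^ r = q ^ r') (hℓ : q ^ (1 - r - ℓ) = q ^ (1 - r' - ℓ')) :
    IsHighestWeight hn hq w ℓ' r' :=
  ⟨h.d_smul, hr ▸ h.b_smul, hℓ ▸ h.c_smul⟩

/-- The recursion imposed by `da = q ad + 1 - bc`: the last term is `1` minus the eigenvalue of `bc`
on `a^j w`, in which `r` cancels. -/
theorem alpha_succ (hn : 3 ≤ n) (hq : IsPrimitiveRoot q n) (ℓ j : ℕ) (r : ℤ) :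
    alpha q ℓ (j + 1) = q * alpha q ℓ j + (1 - q ^ (r + j) * q ^ ((j : ℤ) + 1 - r - ℓ)) := by
  have hq0 : q ≠ 0 := hq.ne_zero (by omega)
  have hq1 : q - 1 ≠ 0 := sub_ne_zero.2 (hq.ne_one (by omega))
  rw [← zpow_add₀ hq0, show r + (j : ℤ) + (j + 1 - r - ℓ) = (j : ℤ) + (j + 1 - ℓ) by ring,
    zpow_add₀ hq0, alpha, alpha,
    show ((j + 1 : ℕ) : ℤ) - ℓ = 1 + ((j : ℤ) - ℓ) by push_cast; ring,
    show (j : ℤ) + 1 - ℓ = 1 + ((j : ℤ) - ℓ) by ring, zpow_one_add₀ hq0, zpow_natCast]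
  field_simp
  ring

/-- Both `i` and `ℓ - i` lie strictly between `0` and `n`, so neither `q^i` nor `q^(i-ℓ)` equals
`1`. -/
theorem alpha_ne_zero (hn : 3 ≤ n) (hq : IsPrimitiveRoot q n) {ℓ i : ℕ} (hi : 0 < i) (hℓ : i < ℓ)
    (hℓn : ℓ ≤ n) : alpha q ℓ i ≠ 0 := by
  have hq1 : q - 1 ≠ 0 := sub_ne_zero.2 (hq.ne_one (by omega))
  refine div_ne_zero (mul_ne_zero ?_ ?_) hq1
  · exact sub_ne_zero.2 (hq.pow_ne_one_of_pos_of_lt (by omega) (by omega))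
  · refine sub_ne_zero.2 fun h => ?_
    have := Int.natAbs_dvd_natAbs.2 ((hq.zpow_eq_one_iff_dvd _).1 h.symm)
    have := Nat.le_of_dvd (by omega) this
    omega

theorem alpha_self (q : k) (ℓ : ℕ) : alpha q ℓ ℓ = 0 := by
  simp [alpha]

namespace IsHighestWeight

variable {w : M} {ℓ : ℕ} {r : ℤ} (h : IsHighestWeight hn hq w ℓ r)

include h

theorem b_smul_pow (j : ℕ) :
    gen hn hq .b • gen hn hq .a ^ j • w = q ^ (r + j) • gen hn hq .a ^ j • w := by
  have hq0 : q ≠ 0 := hq.ne_zero (by omega)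
  induction j with
  | zero => simpa using h.b_smul
  | succ j ih =>
    rw [pow_succ', mul_smul, ← mul_smul, rel_ba, smul_assoc, mul_smul, ih, smul_comm _ (_ ^ _),
      smul_smul, ← zpow_one_add₀ hq0]
    congr 2
    push_cast
    ring

theorem c_smul_pow (j : ℕ) :
    gen hn hq .c • gen hn hq .a ^ j • w = q ^ ((j : ℤ) + 1 - r - ℓ) • gen hn hq .a ^ j • w := by
  have hq0 : q ≠ 0 := hq.ne_zero (by omega)
  induction j with
  | zero => simpa using h.c_smul
  | succ j ih =>
    rw [pow_succ', mul_smul, ← mul_smul, rel_ca, smul_assoc, mul_smul, ih, smul_comm _ (_ ^ _),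
      smul_smul, ← zpow_one_add₀ hq0]
    congr 2
    push_cast
    ring

/-- Commuting `d` past one `a` at a time, the scalars follow the recursion `alpha_succ`. No relation
`a^ℓ w = 0` is needed, so the formulas of `V(ℓ, r)` hold on the powers of `a` applied to any highest
weight vector. -/
theorem d_smul_pow (j : ℕ) :
    gen hn hq .d • gen hn hq .a ^ (j + 1) • w = alpha q ℓ (j + 1) • gen hn hq .a ^ j • w := by
  have e : gen hn hq .d * gen hn hq .a =
      q • (gen hn hq .a * gen hn hq .d) + (1 - gen hn hq .b * gen hn hq .c) := by
    rw [← rel_da]; abel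
  have key : ∀ v : M, gen hn hq .d • gen hn hq .a • v = q • gen hn hq .a • gen hn hq .d • v +
      (v - gen hn hq .b • gen hn hq .c • v) := by
    intro v
    rw [← mul_smul, e, add_smul, sub_smul, one_smul, smul_assoc, mul_smul, mul_smul]
  induction j with
  | zero =>
    rw [zero_add, pow_one, pow_zero, one_smul, key, h.d_smul, smul_zero, smul_zero, zero_add,
      h.c_smul, smul_comm, h.b_smul, smul_smul, alpha_succ hn hq ℓ 0 r]
    simp [sub_smul, alpha, mul_comm]
  | succ j ih =>
    rw [pow_succ', mul_smul, key, ih, h.c_smul_pow, smul_comm (gen hn hq .b) (q ^ _),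
      h.b_smul_pow, smul_comm (gen hn hq .a) (alpha q ℓ (j + 1)), ← mul_smul (gen hn hq .a),
      ← pow_succ', alpha_succ hn hq ℓ (j + 1) r, add_smul, sub_smul, one_smul, mul_smul,
      mul_smul, smul_comm (q ^ (_ : ℤ)) (q ^ (_ : ℤ))]

/-- The vector `a^ℓ w` is again a highest weight vector. -/
theorem pow_smul (hℓ : ℓ ≤ n) :
    IsHighestWeight hn hq (gen hn hq .a ^ ℓ • w) (n - ℓ) (r + ℓ) := by
  refine ⟨?_, h.b_smul_pow ℓ, ?_⟩
  · cases ℓ with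
    | zero => simpa using h.d_smul
    -- The factor `1 - q^(ℓ-ℓ)` vanishes: this is the place where the string breaks.
    | succ ℓ => rw [h.d_smul_pow, alpha_self, zero_smul]
  · rw [h.c_smul_pow]
    congr 1
    have hq0 : q ≠ 0 := hq.ne_zero (by omega)
    rw [show 1 - (r + ℓ) - ((n - ℓ : ℕ) : ℤ) = (ℓ + 1 - r - ℓ) - (n : ℤ) by
      push_cast [hℓ]; ring, zpow_sub₀ hq0 _ (n : ℤ), zpow_natCast q n, hq.pow_eq_one, div_one]

end IsHighestWeight

end Module

/-! ### The modules `V(ℓ, r)` -/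

section V

variable (hn hq)

/-- The standard basis of `V(ℓ, r)`. -/
noncomputable def basisV (ℓ : ℕ) (hℓ : ℓ ≤ n) (r : ℤ) :
    Module.Basis (Fin ℓ) k (V hn hq ℓ hℓ r).carrier :=
  Pi.basisFun k (Fin ℓ)

/-- The vector `v_{j+1}` of `V(ℓ, r)`, which is zero for `j ≥ ℓ`. -/
def vec (ℓ : ℕ) (hℓ : ℓ ≤ n) (r : ℤ) (j : ℕ) : (V hn hq ℓ hℓ r).carrier :=
  stdVec k ℓ j

variable {hn hq} {ℓ : ℕ} {hℓ : ℓ ≤ n} {r : ℤ}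

theorem basisV_apply (j : Fin ℓ) : basisV hn hq ℓ hℓ r j = vec hn hq ℓ hℓ r j :=
  (stdVec_of_lt j.2).symm

theorem vec_of_le {j : ℕ} (h : ℓ ≤ j) : vec hn hq ℓ hℓ r j = 0 := stdVec_of_le h

theorem finrank_V : Module.finrank k (V hn hq ℓ hℓ r).carrier = ℓ := by
  rw [Module.finrank_eq_card_basis (basisV hn hq ℓ hℓ r), Fintype.card_fin]

theorem V_rho_gen (x : Gen) : (V hn hq ℓ hℓ r).ρ (gen hn hq x) =
    genMap (actA k ℓ) (actB q ℓ r) (actC q ℓ r) (actD q ℓ) x :=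
  lift_gen (satisfies hn hq hℓ r) x

theorem a_smul_vec (j : ℕ) :
    gen hn hq .a • vec hn hq ℓ hℓ r j = vec hn hq ℓ hℓ r (j + 1) := by
  rw [FDModule.smul_def, V_rho_gen]
  exact actA_apply ℓ j

theorem b_smul_vec (j : ℕ) :
    gen hn hq .b • vec hn hq ℓ hℓ r j = q ^ (r + j) • vec hn hq ℓ hℓ r j := by
  rw [FDModule.smul_def, V_rho_gen]
  exact actB_apply ℓ j r

theorem c_smul_vec (j : ℕ) :
    gen hn hq .c • vec hn hq ℓ hℓ r j = q ^ ((j : ℤ) + 1 - r - ℓ) • vec hn hq ℓ hℓ r j := by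
  rw [FDModule.smul_def, V_rho_gen]
  exact actC_apply ℓ j r

theorem d_smul_vec_zero : gen hn hq .d • vec hn hq ℓ hℓ r 0 = 0 := by
  rw [FDModule.smul_def, V_rho_gen]
  exact actD_zero ℓ

theorem d_smul_vec_succ (j : ℕ) :
    gen hn hq .d • vec hn hq ℓ hℓ r (j + 1) = alpha q ℓ (j + 1) • vec hn hq ℓ hℓ r j := by
  rw [FDModule.smul_def, V_rho_gen]
  exact actD_succ ℓ j

theorem a_pow_smul_vec (m j : ℕ) :
    gen hn hq .a ^ m • vec hn hq ℓ hℓ r j = vec hn hq ℓ hℓ r (j + m) := by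
  induction m with
  | zero => simp
  | succ m ih => rw [pow_succ', mul_smul, ih, a_smul_vec, add_assoc]

theorem isHighestWeight_vec : IsHighestWeight hn hq (vec hn hq ℓ hℓ r 0) ℓ r :=
  ⟨d_smul_vec_zero, by simpa using b_smul_vec 0, by simpa using c_smul_vec 0⟩

theorem vec_ne_zero {j : ℕ} (hj : j < ℓ) : vec hn hq ℓ hℓ r j ≠ 0 := by
  rw [show vec hn hq ℓ hℓ r j = basisV hn hq ℓ hℓ r ⟨j, hj⟩ from (basisV_apply ⟨j, hj⟩).symm]
  exact Module.Basis.ne_zero _ _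

/-- The kernel of `d` on `V(ℓ, r)` is spanned by `v₁`. -/
theorem exists_eq_smul_of_d_smul_eq_zero (h0 : 0 < ℓ) {w : (V hn hq ℓ hℓ r).carrier}
    (hw : gen hn hq .d • w = 0) : ∃ c : k, w = c • vec hn hq ℓ hℓ r 0 := by
  obtain ⟨m, rfl⟩ : ∃ m, ℓ = m + 1 := ⟨ℓ - 1, by omega⟩
  have e := (basisV hn hq (m + 1) hℓ r).sum_repr w
  set c := (basisV hn hq (m + 1) hℓ r).repr w
  rw [Fin.sum_univ_succ] at e
  -- Applying `d` shifts the expansion down by one and multiplies each remaining coefficient by a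
  -- nonzero scalar, so only the coefficient of the first basis vector is free.
  have hd : ∑ i : Fin m, (c i.succ * alpha q (m + 1) (i + 1)) •
      basisV hn hq (m + 1) hℓ r i.castSucc = 0 := by
    rw [← hw, ← e, smul_add, smul_comm, basisV_apply]
    simp only [Fin.val_zero, d_smul_vec_zero, smul_zero, zero_add, Finset.smul_sum]
    refine Finset.sum_congr rfl fun i _ => ?_
    rw [smul_comm, basisV_apply, basisV_apply, Fin.val_succ, d_smul_vec_succ, mul_smul]
    rfl
  have hli := ((basisV hn hq (m + 1) hℓ r).linearIndependent.comp _
    (Fin.castSucc_injective m))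
  have hc : ∀ i : Fin m, c i.succ = 0 := fun i =>
    (mul_eq_zero.1 (Fintype.linearIndependent_iff.1 hli _ hd i)).resolve_right
      (alpha_ne_zero hn hq (by omega) (by omega) hℓ)
  refine ⟨c 0, ?_⟩
  rw [← e, Finset.sum_eq_zero fun i _ => by rw [hc, zero_smul], add_zero, basisV_apply]
  rfl

section hom

variable {M : Type*} [AddCommGroup M] [Module k M] [Module (TaftDouble hn hq) M]
  [IsScalarTower k (TaftDouble hn hq) M]

/-- The homomorphism `V(ℓ, r) → M` given by a highest weight vector that is killed by `a^ℓ`. -/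
noncomputable def homOfHighestWeight {w : M} (h : IsHighestWeight hn hq w ℓ r)
    (ha : gen hn hq .a ^ ℓ • w = 0) : (V hn hq ℓ hℓ r).carrier →ₗ[TaftDouble hn hq] M :=
  homOfGen ((basisV hn hq ℓ hℓ r).constr k fun j => gen hn hq .a ^ (j : ℕ) • w) (by
    set f := (basisV hn hq ℓ hℓ r).constr k fun j => gen hn hq .a ^ (j : ℕ) • w with hf
    have hv : ∀ j, f (vec hn hq ℓ hℓ r j) = gen hn hq .a ^ j • w := by
      intro j
      rcases Nat.lt_or_ge j ℓ with hj | hj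
      · have := basisV_apply (hn := hn) (hq := hq) (hℓ := hℓ) (r := r) ⟨j, hj⟩
        rw [← this, hf, Module.Basis.constr_basis]
      -- Beyond the end of the basis both sides vanish; this is the one use of `a^ℓ w = 0`.
      · obtain ⟨m, rfl⟩ := Nat.exists_eq_add_of_le' hj
        rw [vec_of_le hj, map_zero, pow_add, mul_smul, ha, smul_zero]
    intro x
    refine LinearMap.congr_fun (f := f ∘ₗ Algebra.lsmul k k _ (gen hn hq x))
      (g := Algebra.lsmul k k _ (gen hn hq x) ∘ₗ f) ?_
    refine (basisV hn hq ℓ hℓ r).ext fun j => ?_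
    rw [basisV_apply]
    obtain ⟨j, hj⟩ := j
    simp only [LinearMap.comp_apply, Algebra.lsmul_coe, hv]
    cases x with
    | a => rw [a_smul_vec, hv, pow_succ', mul_smul]
    | b => rw [b_smul_vec, map_smul, hv, h.b_smul_pow]
    | c => rw [c_smul_vec, map_smul, hv, h.c_smul_pow]
    | d =>
      cases j with
      | zero => rw [d_smul_vec_zero, map_zero, pow_zero, one_smul, h.d_smul]
      | succ j => rw [d_smul_vec_succ, map_smul, hv, h.d_smul_pow])

theorem homOfHighestWeight_vec_zero {w : M} (h : IsHighestWeight hn hq w ℓ r)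
    (ha : gen hn hq .a ^ ℓ • w = 0) :
    homOfHighestWeight (hℓ := hℓ) h ha (vec hn hq ℓ hℓ r 0) = w := by
  -- For `ℓ = 0` the source is zero, and `a^0 w = 0` forces `w = 0` as well.
  rcases Nat.eq_zero_or_pos ℓ with rfl | h0
  · rw [vec_of_le le_rfl, map_zero, ← ha, pow_zero, one_smul]
  have := basisV_apply (hn := hn) (hq := hq) (hℓ := hℓ) (r := r) ⟨0, h0⟩
  change (basisV hn hq ℓ hℓ r).constr k _ (vec hn hq ℓ hℓ r 0) = w
  rw [← this, Module.Basis.constr_basis]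
  simp

omit [Module k M] [IsScalarTower k (TaftDouble hn hq) M] in
-- As `d^n = 0`, the sequence `v, dv, d²v, …` has a last nonzero term.
theorem exists_d_smul_eq_zero {v : M} (hv : v ≠ 0) :
    ∃ j, gen hn hq .d ^ j • v ≠ 0 ∧ gen hn hq .d • gen hn hq .d ^ j • v = 0 := by
  by_contra! h
  have : ∀ j, gen hn hq .d ^ j • v ≠ 0 := by
    intro j
    induction j with
    | zero => simpa using hv
    | succ j ih =>
      rw [pow_succ', mul_smul]
      exact h j ih
  exact this n (by rw [rel_d_pow, zero_smul])

end hom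

theorem span_vec_zero : Submodule.span (TaftDouble hn hq) {vec hn hq ℓ hℓ r 0} = ⊤ := by
  rw [eq_top_iff]
  intro v _
  rw [← (basisV hn hq ℓ hℓ r).sum_repr v]
  refine Submodule.sum_mem _ fun i _ => ?_
  rw [basisV_apply, ← zero_add (i : ℕ), ← a_pow_smul_vec, ← algebraMap_smul (TaftDouble hn hq)]
  exact Submodule.smul_mem _ _ (Submodule.smul_mem _ _ (Submodule.mem_span_singleton_self _))

/-- Powers of `d` carry any nonzero vector to a nonzero vector in the kernel of `d`. That kernel is
the line through the first basis vector, which generates the module. -/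
theorem isSimpleModule_V (h0 : 0 < ℓ) :
    IsSimpleModule (TaftDouble hn hq) (V hn hq ℓ hℓ r).carrier := by
  have : Nontrivial (V hn hq ℓ hℓ r).carrier := ⟨_, 0, vec_ne_zero h0⟩
  refine isSimpleModule_iff_toSpanSingleton_surjective.2 ⟨this, fun v hv => ?_⟩
  rw [← LinearMap.range_eq_top, LinearMap.range_toSpanSingleton, eq_top_iff, ← span_vec_zero,
    Submodule.span_le, Set.singleton_subset_iff, SetLike.mem_coe]
  obtain ⟨j, hj, hj'⟩ := exists_d_smul_eq_zero (hn := hn) (hq := hq) hv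
  obtain ⟨c, hc⟩ := exists_eq_smul_of_d_smul_eq_zero h0 hj'
  have hc0 : c ≠ 0 := by
    rintro rfl
    exact hj (by rw [hc, zero_smul])
  rw [← inv_smul_smul₀ hc0 (vec hn hq ℓ hℓ r 0), ← hc, ← algebraMap_smul (TaftDouble hn hq)]
  exact Submodule.smul_mem _ _ (Submodule.smul_mem _ _ (Submodule.mem_span_singleton_self _))

/-- The dimension recovers `ℓ`, and the eigenvalue of `b` on the kernel of `d` recovers `q^r`. -/
theorem eq_of_equiv_V {ℓ' : ℕ} {hℓ' : ℓ' ≤ n} {r' : ℤ} (h0 : 0 < ℓ)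
    (e : (V hn hq ℓ hℓ r).carrier ≃ₗ[TaftDouble hn hq] (V hn hq ℓ' hℓ' r').carrier) :
    ℓ = ℓ' ∧ q ^ r = q ^ r' := by
  have hℓℓ' : ℓ = ℓ' := by
    have := (e.restrictScalars k).finrank_eq
    rwa [finrank_V, finrank_V] at this
  subst hℓℓ'
  refine ⟨rfl, ?_⟩
  have hd : gen hn hq .d • e (vec hn hq ℓ hℓ r 0) = 0 := by
    rw [← map_smul, d_smul_vec_zero, map_zero]
  obtain ⟨c, hc⟩ := exists_eq_smul_of_d_smul_eq_zero h0 hd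
  have hne : e (vec hn hq ℓ hℓ r 0) ≠ 0 := e.map_ne_zero_iff.2 (vec_ne_zero h0)
  have hb : gen hn hq .b • e (vec hn hq ℓ hℓ r 0) = q ^ r • e (vec hn hq ℓ hℓ r 0) := by
    rw [← map_smul, isHighestWeight_vec.b_smul]
    exact (e.restrictScalars k).map_smul _ _
  have hb' : gen hn hq .b • e (vec hn hq ℓ hℓ r 0) = q ^ r' • e (vec hn hq ℓ hℓ r 0) := by
    rw [hc, smul_comm, isHighestWeight_vec.b_smul, smul_comm]
  exact smul_left_injective k hne (hb.symm.trans hb')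

section classification

variable [IsAlgClosed k]

/-- The kernel of `d` is nonzero and stable under `b`, and its intersection with an eigenspace of
`b` is stable under `c`. Over an algebraically closed field this yields a common eigenvector, whose
eigenvalues are `n`-th roots of unity, hence powers `q^s` and `q^t`. -/
theorem exists_isHighestWeight (M : FDModule k (TaftDouble hn hq)) [Nontrivial M.carrier] :
    ∃ (w : M.carrier) (ℓ : ℕ) (r : ℤ), w ≠ 0 ∧ 0 < ℓ ∧ ℓ ≤ n ∧
      IsHighestWeight hn hq w ℓ r := by
  have hq0 : q ≠ 0 := hq.ne_zero (by omega)
  have : NeZero n := ⟨by omega⟩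
  let B : Module.End k M.carrier := Algebra.lsmul k k _ (gen hn hq .b)
  let C : Module.End k M.carrier := Algebra.lsmul k k _ (gen hn hq .c)
  let D : Module.End k M.carrier := Algebra.lsmul k k _ (gen hn hq .d)
  have eigen : ∀ (T : Module.End k M.carrier) (p : Submodule k M.carrier), p ≠ ⊥ →
      (∀ x ∈ p, T x ∈ p) → ∃ (c : k) (w : M.carrier), w ∈ p ∧ w ≠ 0 ∧ T w = c • w := by
    intro T p hp hT
    have : Nontrivial p := Submodule.nontrivial_iff_ne_bot.2 hp
    obtain ⟨c, hc⟩ := Module.End.exists_eigenvalue (T.restrict hT)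
    obtain ⟨w, hw⟩ := hc.exists_hasEigenvector
    exact ⟨c, w, w.2, fun h => hw.2 (Subtype.ext h), congrArg Subtype.val hw.apply_eq_smul⟩
  have hker : LinearMap.ker D ≠ ⊥ := by
    obtain ⟨v, hv⟩ := exists_ne (0 : M.carrier)
    obtain ⟨j, hj, hj'⟩ := exists_d_smul_eq_zero (hn := hn) (hq := hq) hv
    exact (Submodule.ne_bot_iff _).2 ⟨_, hj', hj⟩
  obtain ⟨β, w₁, hw₁, hw₁0, hβ⟩ := eigen B _ hker fun x hx => by
    change gen hn hq .d • gen hn hq .b • x = 0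
    have hx : gen hn hq .d • x = 0 := hx
    rw [← mul_smul, rel_db, smul_assoc, mul_smul, hx, smul_zero, smul_zero]
  obtain ⟨γ, w, hw, hw0, hγ⟩ := eigen C (LinearMap.ker D ⊓ Module.End.eigenspace B β)
    ((Submodule.ne_bot_iff _).2 ⟨w₁, ⟨hw₁, Module.End.mem_eigenspace_iff.2 hβ⟩, hw₁0⟩)
    fun x hx => by
      have hd : gen hn hq .d • x = 0 := hx.1
      have hb : gen hn hq .b • x = β • x := Module.End.mem_eigenspace_iff.1 hx.2
      refine ⟨?_, Module.End.mem_eigenspace_iff.2 ?_⟩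
      · change gen hn hq .d • gen hn hq .c • x = 0
        rw [← mul_smul, rel_dc, smul_assoc, mul_smul, hd, smul_zero, smul_zero]
      · change gen hn hq .b • gen hn hq .c • x = β • gen hn hq .c • x
        rw [← mul_smul, rel_bc, mul_smul, hb, smul_comm]
  have hd : gen hn hq .d • w = 0 := hw.1
  have hb : gen hn hq .b • w = β • w := Module.End.mem_eigenspace_iff.1 hw.2
  have hc : gen hn hq .c • w = γ • w := hγ
  have root : ∀ (x : TaftDouble hn hq) (c : k), x ^ n = 1 → x • w = c • w → c ^ n = 1 := by
    intro x c hx hxc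
    have : ∀ m, x ^ m • w = c ^ m • w := by
      intro m
      induction m with
      | zero => simp
      | succ m ih => rw [pow_succ, mul_smul, hxc, smul_comm, ih, smul_smul, pow_succ']
    have := this n
    rw [hx, one_smul] at this
    refine smul_left_injective k hw0 ?_
    simp only [one_smul]
    exact this.symm
  obtain ⟨s, -, rfl⟩ := hq.eq_pow_of_pow_eq_one (root _ _ (rel_b_pow hn hq) hb)
  obtain ⟨t, -, rfl⟩ := hq.eq_pow_of_pow_eq_one (root _ _ (rel_c_pow hn hq) hc)
  -- With `r = s`, the label must satisfy `1 - s - ℓ ≡ t` modulo `n`. Adding one to the residue of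
  -- `-s - t` gives the solution in the range `1, …, n`.
  have h1 := Int.emod_nonneg (-(s : ℤ) - t) (show (n : ℤ) ≠ 0 by omega)
  have h2 := Int.emod_lt_of_pos (-(s : ℤ) - t) (show 0 < (n : ℤ) by omega)
  refine ⟨w, ((-(s : ℤ) - t) % n).toNat + 1, s, hw0, by omega, by omega, hd, ?_, ?_⟩
  · rw [zpow_natCast, hb]
  · rw [hc, ← zpow_natCast]
    congr 1
    rw [← div_eq_one_iff_eq (zpow_ne_zero _ hq0), ← zpow_sub₀ hq0, hq.zpow_eq_one_iff_dvd]
    push_cast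
    rw [Int.toNat_of_nonneg h1, Int.emod_def]
    exact ⟨-((-(s : ℤ) - t) / n), by ring⟩

/-- If `a^ℓ` does not kill the highest weight vector `w`, then `a^ℓ w` replaces `w`, with label `n -
ℓ`. A nonzero map from `V(ℓ, r)` to a simple module is bijective by Schur's lemma. Any `r'` with
`q^r = q^r'` is allowed, so that a representative in `0, …, n - 1` can be chosen later. -/
theorem exists_equiv_V (M : FDModule k (TaftDouble hn hq))
    [IsSimpleModule (TaftDouble hn hq) M.carrier] :
    ∃ (ℓ : ℕ) (hℓ : ℓ ≤ n) (r : ℤ), 0 < ℓ ∧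
      ∀ r', q ^ r = q ^ r' →
        Nonempty (M.carrier ≃ₗ[TaftDouble hn hq] (V hn hq ℓ hℓ r').carrier) := by
  have : Nontrivial M.carrier := IsSimpleModule.nontrivial (TaftDouble hn hq) M.carrier
  have key : ∀ (w : M.carrier) (ℓ : ℕ) (r : ℤ), w ≠ 0 → 0 < ℓ → ∀ hℓ : ℓ ≤ n,
      IsHighestWeight hn hq w ℓ r → gen hn hq .a ^ ℓ • w = 0 → ∀ r', q ^ r = q ^ r' →
      Nonempty (M.carrier ≃ₗ[TaftDouble hn hq] (V hn hq ℓ hℓ r').carrier) := by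
    intro w ℓ r hw h0 hℓ h ha r' hr
    have hq0 : q ≠ 0 := hq.ne_zero (by omega)
    have h' : IsHighestWeight hn hq w ℓ r' := h.congr hr (by
      rw [zpow_sub₀ hq0, zpow_sub₀ hq0, zpow_sub₀ hq0 (1 - r'), zpow_sub₀ hq0 1, hr])
    have := isSimpleModule_V (hn := hn) (hq := hq) (hℓ := hℓ) (r := r') h0
    let f := homOfHighestWeight (hℓ := hℓ) h' ha
    have hf : f ≠ 0 := fun h0' => hw <| by
      rw [← homOfHighestWeight_vec_zero (hℓ := hℓ) h' ha]
      exact LinearMap.congr_fun h0' _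
    exact ⟨(LinearEquiv.ofBijective f (LinearMap.bijective_of_ne_zero hf)).symm⟩
  obtain ⟨w, ℓ, r, hw, h0, hℓ, h⟩ := exists_isHighestWeight M
  by_cases ha : gen hn hq .a ^ ℓ • w = 0
  · exact ⟨ℓ, hℓ, r, h0, key w ℓ r hw h0 hℓ h ha⟩
  · have hlt : ℓ ≠ n := by
      rintro rfl
      exact ha (by rw [rel_a_pow, zero_smul])
    refine ⟨n - ℓ, by omega, r + ℓ, by omega,
      key _ _ _ ha (by omega) (by omega) (h.pow_smul hℓ) ?_⟩
    rw [← mul_smul, ← pow_add, Nat.sub_add_cancel hℓ, rel_a_pow, zero_smul]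

end classification

end V

section simpleModule

theorem isSimpleModule_simpleModule (i : Fin n × Fin n) :
    IsSimpleModule (TaftDouble hn hq) (simpleModule hn hq i).carrier :=
  isSimpleModule_V (Nat.succ_pos _)

theorem simpleModule_injective (i i' : Fin n × Fin n)
    (h : Nonempty ((simpleModule hn hq i).carrier ≃ₗ[TaftDouble hn hq]
      (simpleModule hn hq i').carrier)) : i = i' := by
  obtain ⟨e⟩ := h
  obtain ⟨h1, h2⟩ := eq_of_equiv_V (Nat.succ_pos _) e
  refine Prod.ext (Fin.ext (by omega)) (Fin.ext ?_)
  rw [zpow_natCast, zpow_natCast] at h2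
  exact hq.pow_inj i.2.2 i'.2.2 h2

theorem exists_equiv_simpleModule [IsAlgClosed k] (M : FDModule k (TaftDouble hn hq))
    (h : IsSimpleModule (TaftDouble hn hq) M.carrier) :
    ∃ i, Nonempty (M.carrier ≃ₗ[TaftDouble hn hq] (simpleModule hn hq i).carrier) := by
  obtain ⟨ℓ, hℓ, r, h0, hr⟩ := exists_equiv_V M
  obtain ⟨ℓ, rfl⟩ : ∃ m, ℓ = m + 1 := ⟨ℓ - 1, by omega⟩
  have : NeZero n := ⟨by omega⟩
  obtain ⟨s, hs, hsr⟩ := hq.eq_pow_of_pow_eq_one (ξ := q ^ r) (by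
    rw [← zpow_natCast, ← zpow_mul, mul_comm, zpow_mul, zpow_natCast, hq.pow_eq_one, one_zpow])
  exact ⟨(⟨ℓ, hℓ⟩, ⟨s, hs⟩), hr s (by rw [zpow_natCast, hsr])⟩

end simpleModule

end TaftDouble

/-! ### Filtrations with highest weight quotients, controlled by dimension. -/

/-- The subquotient `p' / p` is the image of `p'` in `M / p`. -/
noncomputable def Submodule.quotientComapSubtypeEquivMap {R M : Type*} [Ring R] [AddCommGroup M]
    [Module R M] (p p' : Submodule R M) : (p' ⧸ p.comap p'.subtype) ≃ₗ[R] p'.map p.mkQ :=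
  (Submodule.quotEquivOfEq _ _ (by ext; simp)).trans
    ((p.mkQ ∘ₗ p'.subtype).quotKerEquivRange.trans
      (LinearEquiv.ofEq _ _ (by rw [LinearMap.range_comp, Submodule.range_subtype])))

namespace FDModule

variable {k A : Type u} [Field k] [Ring A] [Algebra k A] {V : FDModule k A}

theorem finrank_eq_add {p p' : Submodule A V.carrier} (h : p ≤ p') :
    Module.finrank k p' = Module.finrank k p + Module.finrank k (p'.map p.mkQ) := by
  have e1 := ((Submodule.quotientComapSubtypeEquivMap p p').restrictScalars k).finrank_eq
  have e2 := (Submodule.comapSubtypeEquivOfLe h).restrictScalars k |>.finrank_eq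
  have e3 := Submodule.finrank_quotient_add_finrank ((p.comap p'.subtype).restrictScalars k)
  have e4 := (Submodule.Quotient.restrictScalarsEquiv k (p.comap p'.subtype)).finrank_eq
  have e5 : Module.finrank k ((p.comap p'.subtype).restrictScalars k) =
    Module.finrank k (p.comap p'.subtype) := rfl
  omega

end FDModule

namespace TaftDouble

variable {k : Type u} [Field k] {n : ℕ} {q : k} {hn : 3 ≤ n} {hq : IsPrimitiveRoot q n}

/-- Adjoining to a submodule a highest weight vector modulo that submodule. -/
theorem subCls_sup_span {W : FDModule k (TaftDouble hn hq)}
    (p : Submodule (TaftDouble hn hq) W.carrier) (w : W.carrier) {ℓ : ℕ} (hℓ : ℓ ≤ n) {r : ℤ}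
    (h : IsHighestWeight hn hq (p.mkQ w) ℓ r) (ha : gen hn hq .a ^ ℓ • w ∈ p) :
    Module.finrank k ↥(p ⊔ Submodule.span (TaftDouble hn hq) {w}) ≤ Module.finrank k p + ℓ ∧
      (Module.finrank k ↥(p ⊔ Submodule.span (TaftDouble hn hq) {w}) = Module.finrank k p + ℓ →
        FDModule.subCls (p ⊔ Submodule.span (TaftDouble hn hq) {w}) =
          FDModule.subCls p + G0.cls (V hn hq ℓ hℓ r)) := by
  have ha' : gen hn hq .a ^ ℓ • p.mkQ w = 0 := by
    rw [← map_smul]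
    exact (Submodule.Quotient.mk_eq_zero p).2 ha
  set p' := p ⊔ Submodule.span (TaftDouble hn hq) {w}
  -- This map sends `V(ℓ, r)` onto `p' / p`, which bounds the dimension; when the bound is attained
  -- the map is injective, so the quotient is `V(ℓ, r)`. In a filtration of the right total
  -- dimension all bounds are attained at once.
  let f := homOfHighestWeight (hℓ := hℓ) h ha'
  have hrange : LinearMap.range f = p'.map p.mkQ := by
    rw [LinearMap.range_eq_map, ← span_vec_zero, Submodule.map_span, Set.image_singleton,
      homOfHighestWeight_vec_zero, Submodule.map_sup, Submodule.map_span, Set.image_singleton,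
      Submodule.mkQ_map_self, bot_sup_eq]
  have hle : p ≤ p' := le_sup_left
  rw [FDModule.finrank_eq_add hle]
  have hr : Module.finrank k (LinearMap.range f) + Module.finrank k (LinearMap.ker f) = ℓ := by
    have := (f.restrictScalars k).finrank_range_add_finrank_ker
    rwa [finrank_V] at this
  have hr' : Module.finrank k (LinearMap.range f) = Module.finrank k (p'.map p.mkQ) :=
    ((LinearEquiv.ofEq _ _ hrange).restrictScalars k).finrank_eq
  refine ⟨by omega, fun heq => ?_⟩
  have hker : Module.finrank k ((LinearMap.ker f).restrictScalars k) = 0 := by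
    change Module.finrank k (LinearMap.ker f) = 0
    omega
  have hinj : Function.Injective f := by
    rw [Submodule.finrank_eq_zero, Submodule.restrictScalars_eq_bot_iff] at hker
    exact LinearMap.ker_eq_bot.1 hker
  exact FDModule.subCls_of_le hle ((Submodule.quotientComapSubtypeEquivMap p p').trans
    ((LinearEquiv.ofEq _ _ hrange.symm).trans (LinearEquiv.ofInjective f hinj).symm))

theorem mkQ_smul {W : FDModule k (TaftDouble hn hq)}
    (p : Submodule (TaftDouble hn hq) W.carrier) (c : k) (w : W.carrier) :
    p.mkQ (c • w) = c • p.mkQ w := rfl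

theorem IsHighestWeight.mkQ {W : FDModule k (TaftDouble hn hq)}
    (p : Submodule (TaftDouble hn hq) W.carrier) {w : W.carrier} {ℓ : ℕ} {r : ℤ}
    (h : IsHighestWeight hn hq w ℓ r) : IsHighestWeight hn hq (p.mkQ w) ℓ r := by
  refine ⟨?_, ?_, ?_⟩
  · rw [← map_smul, h.d_smul, map_zero]
  · rw [← map_smul, h.b_smul, mkQ_smul]
  · rw [← map_smul, h.c_smul, mkQ_smul]

theorem finrank_bot_sub {W : FDModule k (TaftDouble hn hq)} :
    Module.finrank k (⊥ : Submodule (TaftDouble hn hq) W.carrier) = 0 :=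
  Module.finrank_zero_of_subsingleton

theorem finrank_of_eq_top {W : FDModule k (TaftDouble hn hq)}
    {p : Submodule (TaftDouble hn hq) W.carrier} (h : p = ⊤) :
    Module.finrank k p = Module.finrank k W.carrier := by
  subst h
  exact (Submodule.topEquiv.restrictScalars k).finrank_eq

/-- A filtration with one step, starting from `⊥`. -/
theorem cls_eq_of_generator {W : FDModule k (TaftDouble hn hq)} {w : W.carrier} {ℓ : ℕ}
    (hℓ : ℓ ≤ n) {r : ℤ} (h : IsHighestWeight hn hq w ℓ r) (ha : gen hn hq .a ^ ℓ • w = 0)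
    (hw : Submodule.span (TaftDouble hn hq) {w} = ⊤) (hdim : Module.finrank k W.carrier = ℓ) :
    G0.cls W = G0.cls (V hn hq ℓ hℓ r) := by
  have := (subCls_sup_span ⊥ w hℓ (h.mkQ ⊥) (by rw [ha]; exact Submodule.zero_mem _)).2
  rw [bot_sup_eq, finrank_bot_sub, finrank_of_eq_top hw, hdim, zero_add, hw,
    FDModule.subCls_top, FDModule.subCls_bot, zero_add] at this
  exact this rfl

theorem cls_V_congr {ℓ : ℕ} (hℓ : ℓ ≤ n) {r r' : ℤ} (h : q ^ r = q ^ r') :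
    G0.cls (V hn hq ℓ hℓ r) = G0.cls (V hn hq ℓ hℓ r') := by
  have hq0 : q ≠ 0 := hq.ne_zero (by omega)
  refine cls_eq_of_generator hℓ (isHighestWeight_vec.congr h ?_) ?_ span_vec_zero finrank_V
  · rw [zpow_sub₀ hq0, zpow_sub₀ hq0, zpow_sub₀ hq0 (1 - r'), zpow_sub₀ hq0 1, h]
  · rw [a_pow_smul_vec, vec_of_le (by omega)]

theorem cls_V_zero {h : 0 ≤ n} {r : ℤ} : G0.cls (V hn hq 0 h r) = 0 := by
  rw [← G0.cls_zero]
  have : Subsingleton (FDModule.zero k (TaftDouble hn hq)).carrier :=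
    inferInstanceAs (Subsingleton PUnit)
  have : Subsingleton (V hn hq 0 h r).carrier := inferInstanceAs (Subsingleton (Fin 0 → k))
  exact G0.cls_of_equiv 0

/-! ### The action on tensor products. -/

section tensor

variable {U W : FDModule k (TaftDouble hn hq)}

/-- The pure tensor `x ⊗ y` as an element of the tensor product module. -/
noncomputable def tmul (x : U.carrier) (y : W.carrier) : (U.tensor W).carrier := x ⊗ₜ[k] y

theorem tmul_smul (c : k) (x : U.carrier) (y : W.carrier) : tmul x (c • y) = c • tmul x y :=
  TensorProduct.tmul_smul c x y

theorem smul_tmul (c : k) (x : U.carrier) (y : W.carrier) : tmul (c • x) y = c • tmul x y := rfl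

theorem tmul_zero (x : U.carrier) : tmul x (0 : W.carrier) = 0 :=
  TensorProduct.tmul_zero _ x

theorem zero_tmul (y : W.carrier) : tmul (0 : U.carrier) y = 0 :=
  TensorProduct.zero_tmul _ y

theorem a_smul_tmul (x : U.carrier) (y : W.carrier) : gen hn hq .a • tmul x y =
    tmul (gen hn hq .a • x) (gen hn hq .b • y) + tmul x (gen hn hq .a • y) := by
  refine (FDModule.tensorRep_tmul U.ρ W.ρ _ x y).trans ?_
  rw [show Coalgebra.comul (R := k) (gen hn hq .a) = _ from comul_gen .a]
  simp [genMap, tmul, FDModule.smul_def]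
  rfl

theorem d_smul_tmul (x : U.carrier) (y : W.carrier) : gen hn hq .d • tmul x y =
    tmul (gen hn hq .d • x) (gen hn hq .c • y) + tmul x (gen hn hq .d • y) := by
  refine (FDModule.tensorRep_tmul U.ρ W.ρ _ x y).trans ?_
  rw [show Coalgebra.comul (R := k) (gen hn hq .d) = _ from comul_gen .d]
  simp [genMap, tmul, FDModule.smul_def]
  rfl

theorem b_smul_tmul (x : U.carrier) (y : W.carrier) : gen hn hq .b • tmul x y =
    tmul (gen hn hq .b • x) (gen hn hq .b • y) := by
  refine (FDModule.tensorRep_tmul U.ρ W.ρ _ x y).trans ?_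
  rw [show Coalgebra.comul (R := k) (gen hn hq .b) = _ from comul_gen .b]
  simp [genMap, tmul, FDModule.smul_def]

theorem c_smul_tmul (x : U.carrier) (y : W.carrier) : gen hn hq .c • tmul x y =
    tmul (gen hn hq .c • x) (gen hn hq .c • y) := by
  refine (FDModule.tensorRep_tmul U.ρ W.ρ _ x y).trans ?_
  rw [show Coalgebra.comul (R := k) (gen hn hq .c) = _ from comul_gen .c]
  simp [genMap, tmul, FDModule.smul_def]

theorem finrank_tensor : Module.finrank k (U.tensor W).carrier =
    Module.finrank k U.carrier * Module.finrank k W.carrier :=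
  Module.finrank_tensorProduct

theorem smul_mem_sub {p : Submodule (TaftDouble hn hq) W.carrier} (c : k) {x : W.carrier}
    (hx : x ∈ p) : c • x ∈ p :=
  (p.restrictScalars k).smul_mem c hx

theorem smul_mem_iff_sub {p : Submodule (TaftDouble hn hq) W.carrier} {c : k} (hc : c ≠ 0)
    {x : W.carrier} : c • x ∈ p ↔ x ∈ p :=
  (p.restrictScalars k).smul_mem_iff hc

/-- A submodule of a tensor product that contains the tensors of basis vectors is everything. -/
theorem eq_top_of_tmul_vec_mem {ℓ ℓ' : ℕ} {hℓ : ℓ ≤ n} {hℓ' : ℓ' ≤ n} {r r' : ℤ}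
    {p : Submodule (TaftDouble hn hq) ((V hn hq ℓ hℓ r).tensor (V hn hq ℓ' hℓ' r')).carrier}
    (h : ∀ i < ℓ, ∀ j < ℓ', tmul (vec hn hq ℓ hℓ r i) (vec hn hq ℓ' hℓ' r' j) ∈ p) : p = ⊤ := by
  rw [← Submodule.restrictScalars_eq_top_iff k, eq_top_iff]
  have e := ((basisV hn hq ℓ hℓ r).tensorProduct (basisV hn hq ℓ' hℓ' r')).span_eq
  refine (e.symm.le).trans (Submodule.span_le.2 ?_)
  rintro _ ⟨⟨i, j⟩, rfl⟩
  rw [Module.Basis.tensorProduct_apply, basisV_apply, basisV_apply]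
  exact h i i.2 j j.2

end tensor

/-! ### Tensoring with one-dimensional modules. -/

section oneDimensional

variable {ℓ : ℕ} {hℓ : ℓ ≤ n} {h1 : 1 ≤ n} {r s : ℤ}

/-- The tensor of the first basis vectors is a highest weight generator: powers of `a` reach every
basis tensor up to a nonzero power of `q^s`. -/
theorem cls_tensor_one_right : G0.cls ((V hn hq ℓ hℓ r).tensor (V hn hq 1 h1 s)) =
    G0.cls (V hn hq ℓ hℓ (r + s)) := by
  have hq0 : q ≠ 0 := hq.ne_zero (by omega)
  have hpow : ∀ j, gen hn hq .a ^ j • tmul (vec hn hq ℓ hℓ r 0) (vec hn hq 1 h1 s 0) =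
      (q ^ s) ^ j • tmul (vec hn hq ℓ hℓ r j) (vec hn hq 1 h1 s 0) := by
    intro j
    induction j with
    | zero => simp
    | succ j ih =>
      rw [pow_succ', mul_smul, ih, smul_comm, a_smul_tmul, a_smul_vec, a_smul_vec, b_smul_vec,
        vec_of_le (ℓ := 1) (j := 0 + 1) le_rfl, tmul_zero, add_zero, tmul_smul, smul_smul, pow_succ]
      simp
  refine cls_eq_of_generator hℓ (w := tmul (vec hn hq ℓ hℓ r 0) (vec hn hq 1 h1 s 0))
    ⟨?_, ?_, ?_⟩ ?_ (eq_top_of_tmul_vec_mem ?_) ?_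
  · rw [d_smul_tmul, d_smul_vec_zero, d_smul_vec_zero, zero_tmul, tmul_zero, add_zero]
  · rw [b_smul_tmul, b_smul_vec, b_smul_vec, tmul_smul, smul_tmul, smul_smul, ← zpow_add₀ hq0]
    congr 2
    push_cast
    ring
  · rw [c_smul_tmul, c_smul_vec, c_smul_vec, tmul_smul, smul_tmul, smul_smul, ← zpow_add₀ hq0]
    congr 2
    push_cast
    ring
  · rw [hpow, vec_of_le le_rfl, zero_tmul, smul_zero]
  · intro i _ j hj
    obtain rfl : j = 0 := by omega
    rw [← smul_mem_iff_sub (pow_ne_zero i (zpow_ne_zero s hq0)), ← hpow]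
    exact Submodule.smul_mem _ _ (Submodule.mem_span_singleton_self _)
  · rw [finrank_tensor, finrank_V, finrank_V, mul_one]

/-- Here `a` acts on the second factor alone and no scalars appear. Agreement with the product in
the other order is what makes `g` and `x` commute. -/
theorem cls_tensor_one_left : G0.cls ((V hn hq 1 h1 s).tensor (V hn hq ℓ hℓ r)) =
    G0.cls (V hn hq ℓ hℓ (r + s)) := by
  have hq0 : q ≠ 0 := hq.ne_zero (by omega)
  have hpow : ∀ j, gen hn hq .a ^ j • tmul (vec hn hq 1 h1 s 0) (vec hn hq ℓ hℓ r 0) =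
      tmul (vec hn hq 1 h1 s 0) (vec hn hq ℓ hℓ r j) := by
    intro j
    induction j with
    | zero => simp
    | succ j ih =>
      rw [pow_succ', mul_smul, ih, a_smul_tmul, a_smul_vec, a_smul_vec,
        vec_of_le (ℓ := 1) (j := 0 + 1) le_rfl, zero_tmul, zero_add]
  refine cls_eq_of_generator hℓ (w := tmul (vec hn hq 1 h1 s 0) (vec hn hq ℓ hℓ r 0))
    ⟨?_, ?_, ?_⟩ ?_ (eq_top_of_tmul_vec_mem ?_) ?_
  · rw [d_smul_tmul, d_smul_vec_zero, d_smul_vec_zero, zero_tmul, tmul_zero, add_zero]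
  · rw [b_smul_tmul, b_smul_vec, b_smul_vec, tmul_smul, smul_tmul, smul_smul, ← zpow_add₀ hq0]
    congr 2
    push_cast
    ring
  · rw [c_smul_tmul, c_smul_vec, c_smul_vec, tmul_smul, smul_tmul, smul_smul, ← zpow_add₀ hq0]
    congr 2
    push_cast
    ring
  · rw [hpow, vec_of_le le_rfl, tmul_zero]
  · intro j hj i _
    obtain rfl : j = 0 := by omega
    rw [← hpow i]
    exact Submodule.smul_mem _ _ (Submodule.mem_span_singleton_self _)
  · rw [finrank_tensor, finrank_V, finrank_V, one_mul]

theorem cls_trivial :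
    G0.cls (FDModule.trivial k (TaftDouble hn hq)) = G0.cls (V hn hq 1 h1 0) := by
  have hs : ∀ x (c : (FDModule.trivial k (TaftDouble hn hq)).carrier), gen hn hq x • c =
      (genMap 0 1 1 0 x : k) • c := by
    intro x c
    rw [← counit_gen (hn := hn) (hq := hq) x]
    rfl
  let w : (FDModule.trivial k (TaftDouble hn hq)).carrier := (1 : k)
  refine cls_eq_of_generator h1 (w := w) ⟨?_, ?_, ?_⟩ ?_ ?_ ?_
  · rw [hs]
    exact zero_smul k w
  · rw [hs, zpow_zero]
    rfl
  · rw [hs]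
    simp [genMap]
  · rw [pow_one, hs]
    exact zero_smul k w
  · rw [eq_top_iff]
    intro c _
    have : c = (show k from c) • w := (mul_one (show k from c)).symm
    rw [this]
    exact smul_mem_sub _ (Submodule.mem_span_singleton_self _)
  · exact Module.finrank_self k

end oneDimensional

/-! ### Tensoring with the two-dimensional module. -/

section twoDimensional

variable {ℓ : ℕ} {hℓ : ℓ ≤ n} {h2 : 2 ≤ n} {r : ℤ}

variable (hn hq) in
/-- The tensor `v_{i+1} ⊗ v_{j+1}` in `V(ℓ, r) ⊗ V(2, 0)`. -/
noncomputable def tvec (ℓ : ℕ) (hℓ : ℓ ≤ n) (h2 : 2 ≤ n) (r : ℤ) (i j : ℕ) :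
    ((V hn hq ℓ hℓ r).tensor (V hn hq 2 h2 0)).carrier :=
  tmul (vec hn hq ℓ hℓ r i) (vec hn hq 2 h2 0 j)

theorem tvec_of_le {i j : ℕ} (h : ℓ ≤ i) : tvec hn hq ℓ hℓ h2 r i j = 0 := by
  rw [tvec, vec_of_le h, zero_tmul]

theorem a_smul_tvec_zero (i : ℕ) : gen hn hq .a • tvec hn hq ℓ hℓ h2 r i 0 =
    tvec hn hq ℓ hℓ h2 r (i + 1) 0 + tvec hn hq ℓ hℓ h2 r i 1 := by
  rw [tvec, a_smul_tmul, a_smul_vec, a_smul_vec, b_smul_vec]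
  simp [tvec]

theorem a_smul_tvec_one (i : ℕ) : gen hn hq .a • tvec hn hq ℓ hℓ h2 r i 1 =
    q • tvec hn hq ℓ hℓ h2 r (i + 1) 1 := by
  rw [tvec, a_smul_tmul, a_smul_vec, a_smul_vec, b_smul_vec, vec_of_le (ℓ := 2) le_rfl,
    tmul_zero, add_zero, tmul_smul]
  simp [tvec]

theorem a_pow_smul_tvec_one (m : ℕ) : gen hn hq .a ^ m • tvec hn hq ℓ hℓ h2 r 0 1 =
    q ^ m • tvec hn hq ℓ hℓ h2 r m 1 := by
  induction m with
  | zero => simp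
  | succ m ih =>
    rw [pow_succ', mul_smul, ih, smul_comm, a_smul_tvec_one, smul_smul, pow_succ]

/-- Each application of `a` multiplies the existing second term by `q` and adds one new copy, so a
`q`-integer accumulates. Whether the `q`-integer of `ℓ` vanishes separates `ℓ < n` from `ℓ = n`. -/
theorem a_pow_smul_tvec_zero (m : ℕ) : gen hn hq .a ^ (m + 1) • tvec hn hq ℓ hℓ h2 r 0 0 =
    tvec hn hq ℓ hℓ h2 r (m + 1) 0 +
      (∑ s ∈ Finset.range (m + 1), q ^ s) • tvec hn hq ℓ hℓ h2 r m 1 := by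
  induction m with
  | zero => simp [a_smul_tvec_zero]
  | succ m ih =>
    rw [pow_succ', mul_smul, ih, smul_add, a_smul_tvec_zero, smul_comm, a_smul_tvec_one, smul_smul,
      add_assoc, Finset.sum_range_succ' _ (m + 1)]
    simp only [pow_succ]
    rw [← Finset.sum_mul, add_smul, pow_zero, one_smul, add_comm (tvec hn hq ℓ hℓ h2 r (m + 1) 1)]

theorem isHighestWeight_tvec_zero :
    IsHighestWeight hn hq (tvec hn hq ℓ hℓ h2 r 0 0) (ℓ + 1) r := by
  have hq0 : q ≠ 0 := hq.ne_zero (by omega)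
  refine ⟨?_, ?_, ?_⟩
  · rw [tvec, d_smul_tmul, d_smul_vec_zero, d_smul_vec_zero, zero_tmul, tmul_zero, add_zero]
  · rw [tvec, b_smul_tmul, b_smul_vec, b_smul_vec, tmul_smul, smul_tmul]
    simp
  · rw [tvec, c_smul_tmul, c_smul_vec, c_smul_vec, tmul_smul, smul_tmul, smul_smul,
      ← zpow_add₀ hq0]
    congr 2
    push_cast
    ring

/-- Applying `d` to `v₁ ⊗ v₂` yields a multiple of `v₁ ⊗ v₁`, so the vector is of highest weight
only modulo `p`. -/
theorem isHighestWeight_mkQ_tvec_one (h0 : 0 < ℓ)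
    {p : Submodule (TaftDouble hn hq) ((V hn hq ℓ hℓ r).tensor (V hn hq 2 h2 0)).carrier}
    (hp : tvec hn hq ℓ hℓ h2 r 0 0 ∈ p) :
    IsHighestWeight hn hq (p.mkQ (tvec hn hq ℓ hℓ h2 r 0 1)) (ℓ - 1) (r + 1) := by
  have hq0 : q ≠ 0 := hq.ne_zero (by omega)
  refine ⟨?_, ?_, ?_⟩
  · rw [← map_smul, tvec, d_smul_tmul, d_smul_vec_zero, zero_tmul, zero_add, d_smul_vec_succ,
      tmul_smul]
    exact (Submodule.Quotient.mk_eq_zero p).2 (smul_mem_sub _ hp)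
  · rw [← map_smul, tvec, b_smul_tmul, b_smul_vec, b_smul_vec, tmul_smul, smul_tmul, smul_smul,
      ← zpow_add₀ hq0, mkQ_smul]
    congr 2
    push_cast
    ring
  · rw [← map_smul, tvec, c_smul_tmul, c_smul_vec, c_smul_vec, tmul_smul, smul_tmul, smul_smul,
      ← zpow_add₀ hq0, mkQ_smul]
    congr 2
    push_cast [Nat.cast_sub h0]
    ring

/-- Powers of `a` on `v₁ ⊗ v₂` reach all `v_i ⊗ v₂` up to units; subtracting these from powers of
`a` on `v₁ ⊗ v₁` leaves the `v_i ⊗ v₁`. -/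
theorem eq_top_of_tvec_mem
    {p : Submodule (TaftDouble hn hq) ((V hn hq ℓ hℓ r).tensor (V hn hq 2 h2 0)).carrier}
    (h0 : tvec hn hq ℓ hℓ h2 r 0 0 ∈ p) (h1 : tvec hn hq ℓ hℓ h2 r 0 1 ∈ p) : p = ⊤ := by
  have hq0 : q ≠ 0 := hq.ne_zero (by omega)
  have e1 : ∀ i, tvec hn hq ℓ hℓ h2 r i 1 ∈ p := by
    intro i
    rw [← smul_mem_iff_sub (pow_ne_zero i hq0), ← a_pow_smul_tvec_one]
    exact p.smul_mem _ h1
  refine eq_top_of_tmul_vec_mem fun i _ j hj => ?_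
  obtain rfl | rfl : j = 0 ∨ j = 1 := by omega
  · cases i with
    | zero => exact h0
    | succ i =>
      have := p.sub_mem (p.smul_mem (gen hn hq .a ^ (i + 1)) h0)
        (smul_mem_sub (∑ s ∈ Finset.range (i + 1), q ^ s) (e1 i))
      rwa [a_pow_smul_tvec_zero, add_sub_cancel_right] at this
  · exact e1 i

/-- Two steps: first the submodule generated by `v₁ ⊗ v₁`, then `v₁ ⊗ v₂` is adjoined. The bounds `ℓ
+ 1` and `ℓ - 1` add up to the dimension `2ℓ`, so both are attained. -/
theorem cls_tensor_two_of_lt (h0 : 0 < ℓ) (hlt : ℓ < n) :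
    G0.cls ((V hn hq ℓ hℓ r).tensor (V hn hq 2 h2 0)) =
      G0.cls (V hn hq (ℓ + 1) hlt r) + G0.cls (V hn hq (ℓ - 1) (by omega) (r + 1)) := by
  have hmem : ∀ {W : FDModule k (TaftDouble hn hq)} (p : Submodule (TaftDouble hn hq) W.carrier)
      (w : W.carrier), w ∈ p ⊔ Submodule.span (TaftDouble hn hq) {w} := fun p w =>
    Submodule.mem_sup_right (Submodule.mem_span_singleton_self w)
  obtain ⟨m, rfl⟩ : ∃ m, ℓ = m + 1 := ⟨ℓ - 1, by omega⟩
  have s1 := subCls_sup_span ⊥ (tvec hn hq (m + 1) hℓ h2 r 0 0) hlt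
    (isHighestWeight_tvec_zero.mkQ ⊥) (by
      rw [a_pow_smul_tvec_zero, tvec_of_le (by omega), tvec_of_le (by omega)]
      simp)
  have h00 := hmem ⊥ (tvec hn hq (m + 1) hℓ h2 r 0 0)
  set p := (⊥ : Submodule (TaftDouble hn hq)
    ((V hn hq (m + 1) hℓ r).tensor (V hn hq 2 h2 0)).carrier) ⊔
      Submodule.span (TaftDouble hn hq) {tvec hn hq (m + 1) hℓ h2 r 0 0}
  -- Since `a^ℓ (v₁ ⊗ v₁)` is this `q`-integer times `v_ℓ ⊗ v₂`, dividing by it puts `v_ℓ ⊗ v₂`, and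
  -- hence `a^(ℓ-1) (v₁ ⊗ v₂)`, into `p`.
  have hsum : ∑ s ∈ Finset.range (m + 1), q ^ s ≠ 0 := by
    intro h
    have := geom_sum_mul q (m + 1)
    rw [h, zero_mul] at this
    exact hq.pow_ne_one_of_pos_of_lt (by omega) hlt (sub_eq_zero.1 this.symm)
  have s2 := subCls_sup_span p (tvec hn hq (m + 1) hℓ h2 r 0 1) (ℓ := m + 1 - 1) (by omega)
    (isHighestWeight_mkQ_tvec_one h0 h00) (by
      rw [Nat.add_sub_cancel, a_pow_smul_tvec_one]
      refine smul_mem_sub _ ((smul_mem_iff_sub hsum).1 ?_)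
      have := p.smul_mem (gen hn hq .a ^ (m + 1)) h00
      rwa [a_pow_smul_tvec_zero, tvec_of_le le_rfl, zero_add] at this)
  have htop := eq_top_of_tvec_mem (Submodule.mem_sup_left h00)
    (hmem p (tvec hn hq (m + 1) hℓ h2 r 0 1))
  have hdim : Module.finrank k ((V hn hq (m + 1) hℓ r).tensor (V hn hq 2 h2 0)).carrier =
      (m + 1) * 2 := by
    rw [finrank_tensor, finrank_V, finrank_V]
  rw [finrank_of_eq_top htop, hdim, htop] at s2
  rw [finrank_bot_sub] at s1
  rw [FDModule.subCls_top, s1.2 (by omega), FDModule.subCls_bot, zero_add] at s2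
  exact s2.2 (by omega)

/-- Four steps, adjoining `a t0`, `t0`, `a^(n-1) t1` and `t1`, with quotients of dimension at most
`n - 1`, `1`, `1` and `n - 1`. These add up to `2n`, so every bound is attained. The two
intermediate generators exist because `a^n = 0` and strings break at their label. -/
theorem cls_tensor_two_self {hn' : n ≤ n} :
    G0.cls ((V hn hq n hn' r).tensor (V hn hq 2 h2 0)) =
      2 • G0.cls (V hn hq (n - 1) (Nat.sub_le n 1) (r + 1)) +
        2 • G0.cls (V hn hq 1 (one_le_two.trans h2) r) := by
  have hq0 : q ≠ 0 := hq.ne_zero (by omega)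
  have hmem : ∀ {W : FDModule k (TaftDouble hn hq)} (p : Submodule (TaftDouble hn hq) W.carrier)
      (w : W.carrier), w ∈ p ⊔ Submodule.span (TaftDouble hn hq) {w} := fun p w =>
    Submodule.mem_sup_right (Submodule.mem_span_singleton_self w)
  have hqn : ∀ z : ℤ, q ^ (z - n) = q ^ z := by
    intro z
    rw [zpow_sub₀ hq0, zpow_natCast, hq.pow_eq_one, div_one]
  -- The tensor carries the label `n + 1`, indistinguishable from `1` as `q^n = 1`.
  have w00 : IsHighestWeight hn hq (tvec hn hq n hn' h2 r 0 0) 1 r :=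
    isHighestWeight_tvec_zero.congr rfl (by
      rw [← hqn (1 - r - (1 : ℕ))]
      congr 1
      push_cast
      ring)
  set t0 := tvec hn hq n hn' h2 r 0 0
  set t1 := tvec hn hq n hn' h2 r 0 1
  have s1 := subCls_sup_span ⊥ (gen hn hq .a ^ 1 • t0) (ℓ := n - 1) (by omega)
    ((w00.pow_smul (by omega)).mkQ ⊥) (by
      rw [← mul_smul, ← pow_add, Nat.sub_add_cancel (by omega), rel_a_pow, zero_smul]
      exact Submodule.zero_mem _)
  have h1 := hmem ⊥ (gen hn hq .a ^ 1 • t0)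
  set p1 := (⊥ : Submodule (TaftDouble hn hq)
    ((V hn hq n hn' r).tensor (V hn hq 2 h2 0)).carrier) ⊔
      Submodule.span (TaftDouble hn hq) {gen hn hq .a ^ 1 • t0}
  have s2 := subCls_sup_span p1 t0 (ℓ := 1) (by omega) (w00.mkQ p1) h1
  have h2' := hmem p1 t0
  set p2 := p1 ⊔ Submodule.span (TaftDouble hn hq) {t0}
  have w01 : IsHighestWeight hn hq (p2.mkQ t1) (n - 1) (r + 1) :=
    isHighestWeight_mkQ_tvec_one (by omega) h2'
  have s3 := subCls_sup_span p2 (gen hn hq .a ^ (n - 1) • t1) (ℓ := 1) (r := r) (by omega)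
    (by
      rw [map_smul]
      have e : q ^ (r + 1 + (n - 1 : ℕ)) = q ^ r := by
        rw [← hqn]
        congr 1
        push_cast [Nat.cast_sub (show 1 ≤ n by omega)]
        ring
      refine (w01.pow_smul (by omega)).congr e ?_
      rw [zpow_sub₀ hq0, zpow_sub₀ hq0, e, zpow_sub₀ hq0 (1 - r), zpow_sub₀ hq0 1,
        show n - (n - 1) = 1 by omega])
    (by
      rw [← mul_smul, ← pow_add, show 1 + (n - 1) = n by omega, rel_a_pow, zero_smul]
      exact Submodule.zero_mem _)
  have h3 := hmem p2 (gen hn hq .a ^ (n - 1) • t1)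
  have h23 : p2 ≤ p2 ⊔ Submodule.span (TaftDouble hn hq) {gen hn hq .a ^ (n - 1) • t1} :=
    le_sup_left
  set p3 := p2 ⊔ Submodule.span (TaftDouble hn hq) {gen hn hq .a ^ (n - 1) • t1}
  have s4 := subCls_sup_span p3 t1 (ℓ := n - 1) (by omega)
    (isHighestWeight_mkQ_tvec_one (by omega) (h23 h2')) h3
  have htop := eq_top_of_tvec_mem (Submodule.mem_sup_left (h23 h2')) (hmem p3 t1)
  have hdim : Module.finrank k ((V hn hq n hn' r).tensor (V hn hq 2 h2 0)).carrier =
      n * 2 := by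
    rw [finrank_tensor, finrank_V, finrank_V]
  rw [finrank_of_eq_top htop, hdim, htop] at s4
  rw [finrank_bot_sub] at s1
  rw [FDModule.subCls_top, s3.2 (by omega), s2.2 (by omega), s1.2 (by omega), FDModule.subCls_bot,
    zero_add] at s4
  rw [s4.2 (by omega)]
  push_cast
  abel

end twoDimensional

end TaftDouble

/-! ### Dickson polynomials and the polynomial `f`. -/

section Dickson

open Polynomial

/-- The coefficients `(m + i) / m * (m choose i)` of the Dickson polynomials. -/
def dicksonCoeff : ℕ → ℕ → ℕ
  | 0, 0 => 2
  | _ + 1, 0 => 1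
  | 0, _ + 1 => 0
  | m + 1, i + 1 => dicksonCoeff m (i + 1) + dicksonCoeff m i

theorem dicksonCoeff_eq_zero : ∀ m i : ℕ, m < i → dicksonCoeff m i = 0
  | 0, i + 1, _ => by rw [dicksonCoeff]
  | m + 1, i + 1, h => by
    rw [dicksonCoeff, dicksonCoeff_eq_zero m (i + 1) (by omega),
      dicksonCoeff_eq_zero m i (by omega)]

/-- The closed form of the coefficients with the denominator cleared, by Pascal's rule. It is read
with `n = m + 1 + i`, so that `m + 1 = n - i`. -/
theorem succ_mul_dicksonCoeff (m i : ℕ) :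
    (m + 1) * dicksonCoeff (m + 1) i = (m + 1 + i) * (m + 1).choose i := by
  induction m generalizing i with
  | zero =>
    rcases i with _ | _ | i
    · simp [dicksonCoeff]
    · simp [dicksonCoeff]
    · rw [dicksonCoeff_eq_zero _ _ (by omega), Nat.choose_eq_zero_of_lt (by omega), mul_zero, mul_zero]
  | succ m ih =>
    cases i with
    | zero => simp [dicksonCoeff]
    | succ i =>
      have h1 := ih (i + 1)
      have h2 := ih i
      rcases Nat.lt_or_ge (m + 1) i with hi | hi
      · rw [dicksonCoeff_eq_zero _ _ (by omega), Nat.choose_eq_zero_of_lt (by omega), mul_zero, mul_zero]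
      have h3 := Nat.choose_succ_right_eq (m + 1) i
      rw [dicksonCoeff, Nat.choose_succ_succ' (m + 1) i]
      zify [hi] at h1 h2 h3 ⊢
      have hm : ((m : ℤ) + 1) ≠ 0 := by positivity
      refine mul_left_cancel₀ hm ?_
      linear_combination ((m : ℤ) + 2) * h1 + ((m : ℤ) + 2) * h2 + h3

variable {R : Type*} [CommRing R]

/-- Indexing by pairs with sum `n` turns the Dickson recursion into the Pascal-type rule for the
coefficients. The truncated exponent is harmless, as the coefficient is zero whenever `p.2 < p.1`.
-/
theorem dickson_eq_sum_antidiagonal (g : R) (n : ℕ) : dickson 1 g n =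
    ∑ p ∈ Finset.HasAntidiagonal.antidiagonal n,
      (dicksonCoeff p.2 p.1 : R[X]) * (-C g) ^ p.1 * X ^ (p.2 - p.1) := by
  induction n using Nat.twoStepInduction with
  | zero => simp [dicksonCoeff]; norm_num
  | one => simp [Finset.Nat.antidiagonal_succ, dicksonCoeff]
  | more n ih0 ih1 =>
    rw [dickson_add_two, ih0, ih1, Finset.Nat.sum_antidiagonal_succ,
      Finset.Nat.sum_antidiagonal_succ', Finset.Nat.sum_antidiagonal_succ, mul_add,
      Finset.mul_sum, Finset.mul_sum, add_sub_assoc, ← Finset.sum_sub_distrib]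
    simp only [dicksonCoeff, Nat.cast_zero, zero_mul, zero_add]
    congr 1
    · simp [pow_succ']
    · refine Finset.sum_congr rfl fun p _ => ?_
      rcases Nat.lt_or_ge p.2 (p.1 + 1) with h | h
      · rw [dicksonCoeff_eq_zero _ _ h, show p.2 + 1 - (p.1 + 1) = p.2 - p.1 by omega]
        push_cast
        ring
      · obtain ⟨t, ht⟩ := Nat.exists_eq_add_of_le h
        rw [ht, show p.1 + 1 + t + 1 - (p.1 + 1) = t + 1 by omega,
          show p.1 + 1 + t - (p.1 + 1) = t by omega, show p.1 + 1 + t - p.1 = t + 1 by omega]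
        push_cast
        ring

theorem chebF_eq_dickson [Algebra ℂ R] {n : ℕ} (hn : 0 < n) (g : R) :
    chebF n g = dickson 1 g n - 2 := by
  rw [chebF, dickson_eq_sum_antidiagonal, Finset.Nat.sum_antidiagonal_eq_sum_range_succ_mk]
  congr 1
  have hsub : Finset.range (n / 2 + 1) ⊆ Finset.range (n + 1) :=
    Finset.range_subset_range.2 (by omega)
  rw [← Finset.sum_subset hsub]
  · refine Finset.sum_congr rfl fun i hi => ?_
    rw [Finset.mem_range] at hi
    obtain ⟨m, hm⟩ : ∃ m, n = i + (m + 1) := ⟨n - i - 1, by omega⟩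
    have hc : (n : ℂ) / ((n : ℂ) - (i : ℂ)) * ((n - i).choose i : ℂ) =
        (dicksonCoeff (n - i) i : ℂ) := by
      have h : ((m : ℂ) + 1) ≠ 0 := by exact_mod_cast Nat.succ_ne_zero m
      have := succ_mul_dicksonCoeff m i
      rw [hm, Nat.add_sub_cancel_left, Nat.cast_add, add_sub_cancel_left, div_mul_eq_mul_div,
        div_eq_iff (by exact_mod_cast h)]
      rw [← Nat.cast_add, ← Nat.cast_mul, ← Nat.cast_mul, add_comm i (m + 1), ← this, mul_comm]
    rw [mul_assoc, hc, show n - i - i = n - 2 * i by omega]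
    congr 1
    simp only [map_mul, map_pow, map_neg, map_one, map_natCast]
    rw [neg_pow (C g)]
    ring
  · intro i _ hi
    rw [Finset.mem_range, not_lt] at hi
    rw [dicksonCoeff_eq_zero _ _ (by simp only; omega)]
    simp

/-- Both sides satisfy `s_{n+2} = (a + b) s_{n+1} - ab s_n` with the same initial values. -/
theorem dickson_eval_add (a b : R) (n : ℕ) : (dickson 1 (a * b) n).eval (a + b) = a ^ n + b ^ n := by
  induction n using Nat.twoStepInduction with
  | zero => simp; norm_num
  | one => simp
  | more n ih0 ih1 =>
    rw [dickson_add_two, eval_sub, eval_mul, eval_mul, ih0, ih1, eval_X, eval_C]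
    ring

theorem dickson_monic_natDegree [Nontrivial R] (g : R) (n : ℕ) :
    (dickson 1 g (n + 1)).Monic ∧ (dickson 1 g (n + 1)).natDegree = n + 1 := by
  -- The recursion has order two, so the induction also carries a degree bound for the preceding
  -- polynomial.
  have h : ∀ n, (dickson 1 g (n + 1)).Monic ∧ (dickson 1 g (n + 1)).natDegree = n + 1 ∧
      (dickson 1 g n).natDegree ≤ n := by
    intro n
    induction n with
    | zero => simp [monic_X]; norm_num
    | succ n ih =>
      obtain ⟨h1, h2, h3⟩ := ih
      have hm : (X * dickson 1 g (n + 1)).Monic := monic_X.mul h1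
      have hd : (X * dickson 1 g (n + 1)).natDegree = n + 2 := by
        rw [monic_X.natDegree_mul h1, natDegree_X, h2]
        ring
      have hlt : (C g * dickson 1 g n).degree < (X * dickson 1 g (n + 1)).degree := by
        rw [degree_eq_natDegree hm.ne_zero, hd]
        refine (degree_le_natDegree).trans_lt ?_
        have := (natDegree_C_mul_le g (dickson 1 g n)).trans h3
        exact_mod_cast (show (C g * dickson 1 g n).natDegree < n + 2 by omega)
      rw [dickson_add_two]
      refine ⟨hm.sub_of_left hlt, ?_, h2.le⟩
      rw [natDegree_eq_of_degree_eq (degree_sub_eq_left_of_degree_lt hlt), hd]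
  exact ⟨(h n).1, (h n).2.1⟩

theorem chebF_monic_natDegree [Algebra ℂ R] [Nontrivial R] {n : ℕ} (hn : 0 < n) (g : R) :
    (chebF n g).Monic ∧ (chebF n g).natDegree = n := by
  obtain ⟨m, rfl⟩ : ∃ m, n = m + 1 := ⟨n - 1, by omega⟩
  obtain ⟨h1, h2⟩ := dickson_monic_natDegree g m
  have hlt : (2 : R[X]).degree < (dickson 1 g (m + 1)).degree := by
    rw [degree_eq_natDegree h1.ne_zero, h2]
    refine degree_le_natDegree.trans_lt ?_
    rw [natDegree_ofNat]
    exact_mod_cast Nat.succ_pos m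
  rw [chebF_eq_dickson hn]
  exact ⟨h1.sub_of_left hlt,
    (natDegree_eq_of_degree_eq (degree_sub_eq_left_of_degree_lt hlt)).trans h2⟩

end Dickson

/-! ### The roots of `f` at a fixed power of `ζ`. -/

section Roots

open Polynomial

variable {n : ℕ} {ζ : ℂ}

theorem Finset.prod_Icc_one_eq_prod_range {M : Type*} [CommMonoid M] (m : ℕ) (f : ℕ → M) :
    ∏ j ∈ Finset.Icc 1 m, f j = ∏ j ∈ Finset.range m, f (j + 1) := by
  induction m with
  | zero => simp
  | succ m ih => rw [Finset.prod_Icc_succ_top (by omega), ih, Finset.prod_range_succ]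

/-- For odd `n`, the nontrivial `n`-th roots of unity fall into pairs of distinct inverses. -/
theorem IsPrimitiveRoot.pow_sub_one_eq_prod_pairs (hζ : IsPrimitiveRoot ζ n) (hodd : Odd n)
    (y : ℂ) : y ^ n - 1 =
      (y - 1) * ∏ j ∈ Finset.Icc 1 ((n - 1) / 2), ((y - ζ ^ j) * (y - (ζ ^ j)⁻¹)) := by
  obtain ⟨m, rfl⟩ := hodd
  have h := congrArg (eval y) (X_pow_sub_C_eq_prod hζ (Nat.succ_pos _) (one_pow (2 * m + 1)))
  simp only [eval_sub, eval_pow, eval_X, eval_C, eval_prod, mul_one] at h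
  rw [h, Finset.prod_range_succ', two_mul, Finset.prod_range_add, Finset.prod_Icc_one_eq_prod_range,
    Finset.prod_mul_distrib, pow_zero, mul_comm, show (m + m + 1 - 1) / 2 = m by omega]
  congr 2
  -- Reversing the upper half of the exponents matches each of them with the negative of one in the
  -- lower half.
  rw [← Finset.prod_range_reflect]
  refine Finset.prod_congr rfl fun j hj => ?_
  rw [Finset.mem_range] at hj
  congr 1
  refine eq_inv_of_mul_eq_one_left ?_
  rw [← pow_add, ← hζ.pow_eq_one]
  congr 1
  omega

/-- Clearing denominators gives `(ζ^j - ζ^j') (ζ^(j+j') - 1) = 0`. Since `j + j' < n`, the second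
factor vanishes only for `j = j' = 0`. -/
theorem lam_injective (hζ : IsPrimitiveRoot ζ n) (hn : 0 < n) (r : ℕ) {j j' : ℕ}
    (hj : j ≤ (n - 1) / 2) (hj' : j' ≤ (n - 1) / 2) (h : lam ζ j r = lam ζ j' r) : j = j' := by
  have hζ0 : ζ ≠ 0 := hζ.ne_zero (by omega)
  have h1 := mul_left_cancel₀ (pow_ne_zero r hζ0) h
  have h2 : (ζ ^ j - ζ ^ j') * (ζ ^ (j + j') - 1) = 0 := by
    have e1 : ζ ^ j * (ζ ^ j)⁻¹ = 1 := mul_inv_cancel₀ (pow_ne_zero _ hζ0)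
    have e2 : ζ ^ j' * (ζ ^ j')⁻¹ = 1 := mul_inv_cancel₀ (pow_ne_zero _ hζ0)
    rw [pow_add]
    linear_combination ζ ^ j * ζ ^ j' * h1 - ζ ^ j' * e1 + ζ ^ j * e2
  rcases mul_eq_zero.1 h2 with h3 | h3
  · exact hζ.pow_inj (by omega) (by omega) (sub_eq_zero.1 h3)
  · have := (hζ.pow_eq_one_iff_dvd _).1 (sub_eq_zero.1 h3)
    have := Nat.eq_zero_of_dvd_of_lt this (by omega)
    omega

/-- The factorization of `f(x, ζ^{2r})`. -/
theorem chebF_eq_prod (hζ : IsPrimitiveRoot ζ n) (hn : 0 < n) (hodd : Odd n) (r : ℕ) :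
    chebF n (ζ ^ (2 * r)) = (X - C (lam ζ 0 r)) *
      ∏ j ∈ Finset.Icc 1 ((n - 1) / 2), (X - C (lam ζ j r)) ^ 2 := by
  have hζ0 : ζ ≠ 0 := hζ.ne_zero (by omega)
  have hr0 := pow_ne_zero r hζ0
  refine Polynomial.funext fun z => ?_
  -- A root of `y² - (z / ζ^r) y + 1`, so that `z = ζ^r (y + y⁻¹)`.
  obtain ⟨y, hy⟩ := exists_quadratic_eq_zero (K := ℂ) (a := 1) (b := -(z / ζ ^ r)) (c := 1)
    one_ne_zero (IsAlgClosed.exists_eq_mul_self _)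
  have hy0 : y ≠ 0 := by
    rintro rfl
    simp at hy
  have hz : z = ζ ^ r * (y + y⁻¹) := by
    field_simp at hy ⊢
    linear_combination -hy
  have hfac : ∀ j, z - lam ζ j r = ζ ^ r * y⁻¹ * ((y - ζ ^ j) * (y - (ζ ^ j)⁻¹)) := by
    intro j
    have hj0 := pow_ne_zero j hζ0
    rw [hz, lam]
    field_simp
    ring
  -- The two factors have sum `z`, so `dickson_eval_add` applies. As `ζ^(rn) = 1`, the value of the
  -- Dickson polynomial is `y^n + y^{-n}`.
  rw [chebF_eq_dickson hn, show ζ ^ (2 * r) = (ζ ^ r * y) * (ζ ^ r * y⁻¹) by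
    field_simp; ring]
  simp only [eval_sub, eval_mul, eval_X, eval_C, eval_prod, eval_pow, hfac]
  nth_rw 1 [hz]
  rw [mul_add, dickson_eval_add, Finset.prod_pow, Finset.prod_mul_distrib, Finset.prod_const,
    Nat.card_Icc]
  have hp := hζ.pow_sub_one_eq_prod_pairs hodd y
  set P := ∏ j ∈ Finset.Icc 1 ((n - 1) / 2), ((y - ζ ^ j) * (y - (ζ ^ j)⁻¹))
  have hrn : (ζ ^ r) ^ n = 1 := by rw [← pow_mul, mul_comm, pow_mul, hζ.pow_eq_one, one_pow]
  have e : ζ ^ r * y⁻¹ * ((y - ζ ^ 0) * (y - (ζ ^ 0)⁻¹)) *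
      ((ζ ^ r * y⁻¹) ^ ((n - 1) / 2 + 1 - 1) * P) ^ 2 =
      (ζ ^ r * y⁻¹) ^ (2 * ((n - 1) / 2) + 1) * ((y - 1) * P) ^ 2 := by
    rw [pow_zero, inv_one, Nat.add_sub_cancel]
    ring
  rw [e, ← hp, show 2 * ((n - 1) / 2) + 1 = n by obtain ⟨m, rfl⟩ := hodd; omega, mul_pow, mul_pow,
    hrn, inv_pow]
  simp only [eval_ofNat]
  field_simp
  ring

end Roots

/-! ### Idempotents of the cyclic group generated by `g`. -/

section CyclicIdempotents

variable {R : Type*} [CommRing R] [Algebra ℂ R]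

/-- The element `(1/n) ∑_{v=0}^{n-1} ζ^{-uv} g^v`. -/
noncomputable def cycIdem (n : ℕ) (ζ : ℂ) (g : R) (u : ℕ) : R :=
  (1 / (n : ℂ)) • ∑ v ∈ Finset.range n, (ζ ^ (u * v))⁻¹ • g ^ v

variable {n : ℕ} {ζ : ℂ} {g : R}

theorem mul_cycIdem (hn : 0 < n) (hζ : IsPrimitiveRoot ζ n) (hg : g ^ n = 1) (u : ℕ) :
    g * cycIdem n ζ g u = ζ ^ u • cycIdem n ζ g u := by
  have hζ0 : ζ ≠ 0 := hζ.ne_zero (by omega)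
  rw [cycIdem, mul_smul_comm, smul_comm]
  congr 1
  -- A sum of `n + 1` terms is split at either end; the end terms agree because `g^n = 1`, so the
  -- sum may be shifted cyclically.
  have h := Finset.sum_range_succ (fun v => (ζ ^ (u * v))⁻¹ • g ^ v) n
  rw [Finset.sum_range_succ'] at h
  have hlast : (ζ ^ (u * n))⁻¹ • g ^ n = (ζ ^ (u * 0))⁻¹ • g ^ 0 := by
    rw [hg, mul_comm u n, pow_mul, hζ.pow_eq_one, one_pow, mul_zero, pow_zero, pow_zero]
  rw [hlast, add_left_inj] at h
  conv_rhs => rw [← h]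
  rw [Finset.mul_sum, Finset.smul_sum]
  refine Finset.sum_congr rfl fun v _ => ?_
  rw [mul_smul_comm, smul_smul, ← pow_succ']
  congr 1
  rw [mul_add, mul_one, pow_add, mul_inv]
  have := pow_ne_zero u hζ0
  field_simp

theorem pow_mul_cycIdem (hn : 0 < n) (hζ : IsPrimitiveRoot ζ n) (hg : g ^ n = 1) (u v : ℕ) :
    g ^ v * cycIdem n ζ g u = ζ ^ (u * v) • cycIdem n ζ g u := by
  induction v with
  | zero => simp
  | succ v ih =>
    rw [pow_succ, mul_assoc, mul_cycIdem hn hζ hg, mul_smul_comm, ih, smul_smul, ← pow_add]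
    congr 2
    ring

theorem sum_pow_eq_zero {w : ℂ} (hw : w ^ n = 1) (h1 : w ≠ 1) :
    ∑ v ∈ Finset.range n, w ^ v = 0 := by
  have := geom_sum_mul w n
  rw [hw, sub_self] at this
  exact (mul_eq_zero.1 this).resolve_right (sub_ne_zero.2 h1)

/-- For odd `n`, `ζ²` is again primitive. Hence the `E_{2r}` exhaust the idempotents, and each
eigenvalue of `g` has the form `ζ^(2r)`, with the square root `ζ^r` that enters `λ_{j,r}`. -/
theorem IsPrimitiveRoot.pow_two_mul_injective (hζ : IsPrimitiveRoot ζ n) (hodd : Odd n) {r s : ℕ}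
    (hr : r < n) (hs : s < n) (h : ζ ^ (2 * r) = ζ ^ (2 * s)) : r = s := by
  rw [pow_mul, pow_mul] at h
  exact (hζ.pow_of_coprime 2 (Nat.coprime_two_left.2 hodd)).pow_inj hr hs h

theorem cycIdem_mul_cycIdem (hn : 0 < n) (hζ : IsPrimitiveRoot ζ n) (hodd : Odd n)
    (hg : g ^ n = 1) {r s : ℕ} (hr : r < n) (hs : s < n) :
    cycIdem n ζ g (2 * r) * cycIdem n ζ g (2 * s) =
      if r = s then cycIdem n ζ g (2 * r) else 0 := by
  have hζ0 : ζ ≠ 0 := hζ.ne_zero (by omega)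
  have hn0 : (n : ℂ) ≠ 0 := by exact_mod_cast hn.ne'
  have h : cycIdem n ζ g (2 * r) * cycIdem n ζ g (2 * s) =
      ((1 / (n : ℂ)) * ∑ v ∈ Finset.range n, (ζ ^ (2 * s) / ζ ^ (2 * r)) ^ v) •
        cycIdem n ζ g (2 * s) := by
    conv_lhs => rw [cycIdem]
    rw [smul_mul_assoc, Finset.sum_mul, mul_smul, Finset.sum_smul]
    congr 1
    refine Finset.sum_congr rfl fun v _ => ?_
    rw [smul_mul_assoc, pow_mul_cycIdem hn hζ hg, smul_smul, div_pow, ← pow_mul, ← pow_mul]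
    congr 1
    rw [mul_comm, div_eq_mul_inv]
  rw [h]
  split_ifs with hrs
  · subst hrs
    rw [div_self (pow_ne_zero _ hζ0)]
    simp [hn0]
  · rw [sum_pow_eq_zero, mul_zero, zero_smul]
    · have e : ∀ a, (ζ ^ a) ^ n = 1 := fun a => by
        rw [← pow_mul, mul_comm, pow_mul, hζ.pow_eq_one, one_pow]
      rw [div_pow, e, e, div_one]
    · intro h1
      exact hrs (hζ.pow_two_mul_injective hodd hr hs
        ((div_eq_one_iff_eq (pow_ne_zero _ hζ0)).1 h1).symm)

/-- After exchanging the sums, orthogonality of characters leaves only the power `g^0`. -/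
theorem sum_cycIdem (hn : 0 < n) (hζ : IsPrimitiveRoot ζ n) (hodd : Odd n) :
    ∑ r ∈ Finset.range n, cycIdem n ζ g (2 * r) = 1 := by
  have hζ0 : ζ ≠ 0 := hζ.ne_zero (by omega)
  have hn0 : (n : ℂ) ≠ 0 := by exact_mod_cast hn.ne'
  simp only [cycIdem]
  rw [← Finset.smul_sum, Finset.sum_comm]
  simp only [← Finset.sum_smul]
  rw [Finset.sum_eq_single 0]
  · simp [smul_smul, hn0]
  · intro v hv hv0
    rw [Finset.mem_range] at hv
    have e : ∀ r, (ζ ^ (2 * r * v))⁻¹ = ((ζ ^ (2 * v))⁻¹) ^ r := by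
      intro r
      rw [inv_pow, ← pow_mul]
      congr 2
      ring
    simp only [e]
    rw [sum_pow_eq_zero, zero_smul]
    · rw [inv_pow, ← pow_mul, mul_comm _ n, pow_mul, hζ.pow_eq_one, one_pow, inv_one]
    · intro h1
      rw [inv_eq_one] at h1
      exact hv0 (hζ.pow_two_mul_injective hodd hv hn (by simpa using h1))
  · intro h
    exact absurd (Finset.mem_range.2 hn) h

open Polynomial in
-- Next to an eigenvector `E` of `g`, the coefficient `g` may be specialised to its eigenvalue; the
-- Dickson recursion propagates this.
theorem eval_chebF_mul {x E : R} {γ : ℂ} (hn : 0 < n) (h : g * E = γ • E) :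
    (chebF n g).eval x * E = aeval x (chebF n γ) * E := by
  have key : ∀ m, (dickson 1 g m).eval x * E = aeval x (dickson 1 γ m) * E := by
    intro m
    induction m using Nat.twoStepInduction with
    | zero => simp [map_ofNat (aeval x) 3]
    | one => simp
    | more m ih0 ih1 =>
      rw [dickson_add_two, dickson_add_two, eval_sub, eval_mul, eval_mul, eval_X, eval_C, map_sub,
        map_mul, map_mul, aeval_X, aeval_C, sub_mul, sub_mul, mul_assoc, ih1, mul_right_comm, h,
        smul_mul_assoc, mul_comm E, ih0, ← Algebra.smul_def]
      simp only [mul_assoc, smul_mul_assoc]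
  rw [chebF_eq_dickson hn, chebF_eq_dickson hn, eval_sub, map_sub, sub_mul, sub_mul, key]
  simp [map_ofNat (aeval x) 2]

end CyclicIdempotents

/-! ### Algebras generated by `g` and `x` with `g^n = 1` and `f(x, g) = 0` -/

section Polys

open Polynomial

/-- First-order Taylor expansion, by dividing by `X - a` twice. -/
theorem exists_linear_approx (z : ℂ[X]) (a : ℂ) :
    ∃ (ν : ℂ) (v : ℂ[X]), z = C (z.eval a) + C ν * (X - C a) + v * (X - C a) ^ 2 := by
  obtain ⟨w, hw⟩ := X_sub_C_dvd_sub_C_eval (a := a) (p := z)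
  obtain ⟨v, hv⟩ := X_sub_C_dvd_sub_C_eval (a := a) (p := w)
  exact ⟨w.eval a, v, by linear_combination hw + (X - C a) * hv⟩

variable {n : ℕ} {ζ : ℂ} (hn : 0 < n) (hζ : IsPrimitiveRoot ζ n) (hodd : Odd n)

theorem lam_zero (r : ℕ) : lam ζ 0 r = 2 * ζ ^ r := by
  rw [lam]
  norm_num
  ring

include hn hζ hodd

theorem chebF_divByMonic_zero (r : ℕ) :
    chebF n (ζ ^ (2 * r)) /ₘ (X - C (lam ζ 0 r)) =
      ∏ j ∈ Finset.Icc 1 ((n - 1) / 2), (X - C (lam ζ j r)) ^ 2 := by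
  rw [chebF_eq_prod hζ hn hodd, mul_divByMonic_cancel_left _ (monic_X_sub_C _)]

theorem chebF_eq_sq_mul {j : ℕ} (h1 : 1 ≤ j) (hj : j ≤ (n - 1) / 2) (r : ℕ) :
    chebF n (ζ ^ (2 * r)) = (X - C (lam ζ j r)) ^ 2 * ((X - C (lam ζ 0 r)) *
      ∏ k ∈ (Finset.Icc 1 ((n - 1) / 2)).erase j, (X - C (lam ζ k r)) ^ 2) := by
  rw [chebF_eq_prod hζ hn hodd, ← Finset.mul_prod_erase _ _ (Finset.mem_Icc.2 ⟨h1, hj⟩)]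
  ring

theorem chebF_divByMonic_sq {j : ℕ} (h1 : 1 ≤ j) (hj : j ≤ (n - 1) / 2) (r : ℕ) :
    chebF n (ζ ^ (2 * r)) /ₘ (X - C (lam ζ j r)) ^ 2 = (X - C (lam ζ 0 r)) *
      ∏ k ∈ (Finset.Icc 1 ((n - 1) / 2)).erase j, (X - C (lam ζ k r)) ^ 2 := by
  rw [chebF_eq_sq_mul hn hζ hodd h1 hj,
    mul_divByMonic_cancel_left _ ((monic_X_sub_C _).pow 2)]

theorem sq_mul_chebF_divByMonic_sq {j : ℕ} (h1 : 1 ≤ j) (hj : j ≤ (n - 1) / 2) (r : ℕ) :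
    (X - C (lam ζ j r)) ^ 2 * (chebF n (ζ ^ (2 * r)) /ₘ (X - C (lam ζ j r)) ^ 2) =
      chebF n (ζ ^ (2 * r)) := by
  rw [chebF_divByMonic_sq hn hζ hodd h1 hj, ← chebF_eq_sq_mul hn hζ hodd h1 hj]

theorem chebF_divByMonic_eq {j : ℕ} (h1 : 1 ≤ j) (hj : j ≤ (n - 1) / 2) (r : ℕ) :
    chebF n (ζ ^ (2 * r)) /ₘ (X - C (lam ζ j r)) =
      (X - C (lam ζ j r)) * (chebF n (ζ ^ (2 * r)) /ₘ (X - C (lam ζ j r)) ^ 2) := by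
  have h := sq_mul_chebF_divByMonic_sq hn hζ hodd h1 hj r
  generalize chebF n (ζ ^ (2 * r)) /ₘ (X - C (lam ζ j r)) ^ 2 = Q at h ⊢
  rw [← h, sq, mul_assoc, mul_divByMonic_cancel_left _ (monic_X_sub_C _)]

theorem mul_chebF_divByMonic {j : ℕ} (hj : j ≤ (n - 1) / 2) (r : ℕ) :
    (X - C (lam ζ j r)) * (chebF n (ζ ^ (2 * r)) /ₘ (X - C (lam ζ j r))) =
      chebF n (ζ ^ (2 * r)) := by
  rcases Nat.eq_zero_or_pos j with rfl | h1
  · rw [chebF_divByMonic_zero hn hζ hodd, ← chebF_eq_prod hζ hn hodd]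
  · rw [chebF_divByMonic_eq hn hζ hodd h1 hj, ← mul_assoc, ← sq,
      sq_mul_chebF_divByMonic_sq hn hζ hodd h1 hj]

theorem eval_chebF_lam {j : ℕ} (hj : j ≤ (n - 1) / 2) (r : ℕ) :
    (chebF n (ζ ^ (2 * r))).eval (lam ζ j r) = 0 := by
  rw [← mul_chebF_divByMonic hn hζ hodd hj]
  simp

/-- This and the following evaluations are structure constants of the algebra: a polynomial in `x`
acts on `F_{k,r}` by its value at `λ_{k,r}`. -/
theorem eval_chebF_divByMonic_of_ne {j k : ℕ} (hj : j ≤ (n - 1) / 2) (hk : k ≤ (n - 1) / 2)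
    (hjk : j ≠ k) (r : ℕ) :
    (chebF n (ζ ^ (2 * r)) /ₘ (X - C (lam ζ j r))).eval (lam ζ k r) = 0 := by
  have h := eval_chebF_lam hn hζ hodd hk r
  rw [← mul_chebF_divByMonic hn hζ hodd hj, eval_mul, eval_sub, eval_X, eval_C] at h
  exact (mul_eq_zero.1 h).resolve_left
    (sub_ne_zero.2 fun h => hjk (lam_injective hζ hn r hj hk h.symm))

theorem eval_chebF_divByMonic_self {j : ℕ} (h1 : 1 ≤ j) (hj : j ≤ (n - 1) / 2) (r : ℕ) :
    (chebF n (ζ ^ (2 * r)) /ₘ (X - C (lam ζ j r))).eval (lam ζ j r) = 0 := by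
  rw [chebF_divByMonic_eq hn hζ hodd h1 hj]
  simp

theorem eval_chebF_divByMonic_zero (r : ℕ) :
    (chebF n (ζ ^ (2 * r)) /ₘ (X - C (lam ζ 0 r))).eval (lam ζ 0 r) = xi n ζ r := by
  rw [chebF_divByMonic_zero hn hζ hodd, eval_prod, xi]
  simp [lam_zero]

theorem eval_chebF_divByMonic_sq_of_ne {j k : ℕ} (h1 : 1 ≤ j) (hj : j ≤ (n - 1) / 2)
    (hk : k ≤ (n - 1) / 2) (hjk : j ≠ k) (r : ℕ) :
    (chebF n (ζ ^ (2 * r)) /ₘ (X - C (lam ζ j r)) ^ 2).eval (lam ζ k r) = 0 := by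
  have h := eval_chebF_lam hn hζ hodd hk r
  rw [← sq_mul_chebF_divByMonic_sq hn hζ hodd h1 hj, eval_mul, eval_pow, eval_sub, eval_X,
    eval_C] at h
  exact (mul_eq_zero.1 h).resolve_left
    (pow_ne_zero 2 (sub_ne_zero.2 fun h => hjk (lam_injective hζ hn r hj hk h.symm)))

theorem eval_chebF_divByMonic_sq_self {j : ℕ} (h1 : 1 ≤ j) (hj : j ≤ (n - 1) / 2) (r : ℕ) :
    (chebF n (ζ ^ (2 * r)) /ₘ (X - C (lam ζ j r)) ^ 2).eval (lam ζ j r) = vartheta n ζ j r := by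
  rw [chebF_divByMonic_sq hn hζ hodd h1 hj, eval_mul, eval_prod, vartheta]
  simp

theorem sq_dvd_chebF_divByMonic_sq {j k : ℕ} (h1 : 1 ≤ j) (hj : j ≤ (n - 1) / 2) (h1' : 1 ≤ k)
    (hk : k ≤ (n - 1) / 2) (hjk : j ≠ k) (r : ℕ) :
    (X - C (lam ζ k r)) ^ 2 ∣ chebF n (ζ ^ (2 * r)) /ₘ (X - C (lam ζ j r)) ^ 2 := by
  rw [chebF_divByMonic_sq hn hζ hodd h1 hj]
  exact Dvd.dvd.mul_left (Finset.dvd_prod_of_mem (fun k => (X - C (lam ζ k r)) ^ 2)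
    (Finset.mem_erase.2 ⟨hjk.symm, Finset.mem_Icc.2 ⟨h1', hk⟩⟩)) _

omit hodd in
theorem xi_ne_zero (r : ℕ) : xi n ζ r ≠ 0 := by
  refine Finset.prod_ne_zero_iff.2 fun j hj => pow_ne_zero 2 ?_
  rw [Finset.mem_Icc] at hj
  rw [← lam_zero]
  exact sub_ne_zero.2 fun h => by
    have := lam_injective hζ hn r (Nat.zero_le _) hj.2 h
    omega

omit hodd in
theorem vartheta_ne_zero {j : ℕ} (h1 : 1 ≤ j) (hj : j ≤ (n - 1) / 2) (r : ℕ) :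
    vartheta n ζ j r ≠ 0 := by
  refine mul_ne_zero (sub_ne_zero.2 fun h => ?_)
    (Finset.prod_ne_zero_iff.2 fun k hk => pow_ne_zero 2 (sub_ne_zero.2 fun h => ?_))
  · have := lam_injective hζ hn r hj (Nat.zero_le _) h
    omega
  · rw [Finset.mem_erase, Finset.mem_Icc] at hk
    exact hk.1 (lam_injective hζ hn r hj hk.2.2 h).symm

/-- No root of `f(x, ζ^{2r})` has multiplicity above two, so vanishing at every root once suffices
for the square. -/
theorem chebF_dvd_sq {z : ℂ[X]} {r : ℕ} (h : ∀ j ≤ (n - 1) / 2, z.eval (lam ζ j r) = 0) :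
    chebF n (ζ ^ (2 * r)) ∣ z ^ 2 := by
  have hd : ∏ j ∈ Finset.range ((n - 1) / 2 + 1), (X - C (lam ζ j r)) ∣ z := by
    refine Finset.prod_dvd_of_coprime ?_ fun j hj => ?_
    · intro j hj k hk hjk
      rw [Finset.mem_coe, Finset.mem_range] at hj hk
      exact isCoprime_X_sub_C_of_isUnit_sub (sub_ne_zero.2 fun h => hjk
        (lam_injective hζ hn r (by omega) (by omega) h)).isUnit
    · rw [Finset.mem_range] at hj
      exact dvd_iff_isRoot.2 (h j (by omega))
  refine Dvd.dvd.trans ?_ (pow_dvd_pow_of_dvd hd 2)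
  rw [chebF_eq_prod hζ hn hodd, Finset.prod_range_succ', ← Finset.prod_Icc_one_eq_prod_range _
    (fun j => X - C (lam ζ j r)), mul_pow, ← Finset.prod_pow, mul_comm]
  exact mul_dvd_mul_left _ (dvd_pow_self _ two_ne_zero)

end Polys

/-! ### Products, basis, radical and idempotents in the abstract algebra. -/

section ChebyshevAlgebra

open Polynomial

variable {R : Type*} [CommRing R] [Algebra ℂ R]

/-- The element `(f(x, ζ^{2r}) / (x - λ_{j,r})) E_{2r}`. -/
noncomputable def chebQuot (n : ℕ) (ζ : ℂ) (g x : R) (j r : ℕ) : R :=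
  aeval x (chebF n (ζ ^ (2 * r)) /ₘ (X - C (lam ζ j r))) * cycIdem n ζ g (2 * r)

/-- The element `(f(x, ζ^{2r}) / (x - λ_{j,r})²) E_{2r}`. -/
noncomputable def chebQuotSq (n : ℕ) (ζ : ℂ) (g x : R) (j r : ℕ) : R :=
  aeval x (chebF n (ζ ^ (2 * r)) /ₘ (X - C (lam ζ j r)) ^ 2) * cycIdem n ζ g (2 * r)

/-- The algebra `R` is generated by `g` and `x`, which satisfy `g^n = 1` and `f(x, g) = 0`. -/
structure IsChebyshevAlgebra (n : ℕ) (ζ : ℂ) (g x : R) : Prop where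
  pos : 0 < n
  prim : IsPrimitiveRoot ζ n
  odd : Odd n
  pow_eq_one : g ^ n = 1
  eval_eq_zero : (chebF n g).eval x = 0
  adjoin_eq_top : Algebra.adjoin ℂ {g, x} = ⊤

namespace IsChebyshevAlgebra

variable {n : ℕ} {ζ : ℂ} {g x : R} (H : IsChebyshevAlgebra n ζ g x)

include H

theorem aeval_chebF_mul (r : ℕ) :
    aeval x (chebF n (ζ ^ (2 * r))) * cycIdem n ζ g (2 * r) = 0 := by
  rw [← eval_chebF_mul H.pos (mul_cycIdem H.pos H.prim H.pow_eq_one (2 * r)), H.eval_eq_zero,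
    zero_mul]

theorem aeval_mul_eq_zero_of_dvd {z : ℂ[X]} {r : ℕ} (h : chebF n (ζ ^ (2 * r)) ∣ z) :
    aeval x z * cycIdem n ζ g (2 * r) = 0 := by
  obtain ⟨w, rfl⟩ := h
  rw [map_mul, mul_right_comm, H.aeval_chebF_mul, zero_mul]

/-- The difference of `z` and its value at `λ_{j,r}` is divisible by `X - λ_{j,r}`, which completes
the quotient to `f` and so kills `F_{j,r}`. -/
theorem aeval_mul_chebQuot {j : ℕ} (hj : j ≤ (n - 1) / 2) (r : ℕ) (z : ℂ[X]) :
    aeval x z * chebQuot n ζ g x j r = z.eval (lam ζ j r) • chebQuot n ζ g x j r := by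
  obtain ⟨w, hw⟩ := X_sub_C_dvd_sub_C_eval (a := lam ζ j r) (p := z)
  have h : aeval x (z - C (z.eval (lam ζ j r))) * chebQuot n ζ g x j r = 0 := by
    rw [chebQuot, ← mul_assoc, ← map_mul]
    refine H.aeval_mul_eq_zero_of_dvd ⟨w, ?_⟩
    rw [hw]
    linear_combination w * mul_chebF_divByMonic H.pos H.prim H.odd hj r
  rw [map_sub, aeval_C, sub_mul, sub_eq_zero, ← Algebra.smul_def] at h
  exact h

theorem aeval_X_sub_C_mul_chebQuotSq {j : ℕ} (h1 : 1 ≤ j) (hj : j ≤ (n - 1) / 2) (r : ℕ) :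
    aeval x (X - C (lam ζ j r)) * chebQuotSq n ζ g x j r = chebQuot n ζ g x j r := by
  rw [chebQuot, chebF_divByMonic_eq H.pos H.prim H.odd h1 hj, map_mul, chebQuotSq, mul_assoc]

theorem sq_mul_chebQuotSq {j : ℕ} (h1 : 1 ≤ j) (hj : j ≤ (n - 1) / 2) (r : ℕ) :
    aeval x ((X - C (lam ζ j r)) ^ 2) * chebQuotSq n ζ g x j r = 0 := by
  rw [chebQuotSq, ← mul_assoc, ← map_mul]
  exact H.aeval_mul_eq_zero_of_dvd
    (sq_mul_chebF_divByMonic_sq H.pos H.prim H.odd h1 hj r).symm.dvd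

/-- In the Taylor expansion of `z` at `λ_{j,r}`, the linear factor sends `G_{j,r}` to `F_{j,r}` and
its square kills `G_{j,r}`. -/
theorem aeval_mul_chebQuotSq {j : ℕ} (h1 : 1 ≤ j) (hj : j ≤ (n - 1) / 2) (r : ℕ) (z : ℂ[X]) :
    ∃ ν : ℂ, aeval x z * chebQuotSq n ζ g x j r =
      z.eval (lam ζ j r) • chebQuotSq n ζ g x j r + ν • chebQuot n ζ g x j r := by
  obtain ⟨ν, v, hv⟩ := exists_linear_approx z (lam ζ j r)
  refine ⟨ν, ?_⟩
  have h := congrArg (fun p => aeval x p * chebQuotSq n ζ g x j r) hv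
  rw [h, map_add, map_add, map_mul, map_mul, add_mul, add_mul, mul_assoc, mul_assoc,
    H.sq_mul_chebQuotSq h1 hj, H.aeval_X_sub_C_mul_chebQuotSq h1 hj, aeval_C, aeval_C, mul_zero,
    add_zero, Algebra.smul_def, Algebra.smul_def]

theorem x_mul_chebQuot {j : ℕ} (hj : j ≤ (n - 1) / 2) (r : ℕ) :
    x * chebQuot n ζ g x j r = lam ζ j r • chebQuot n ζ g x j r := by
  simpa using H.aeval_mul_chebQuot hj r X

theorem x_mul_chebQuotSq {j : ℕ} (h1 : 1 ≤ j) (hj : j ≤ (n - 1) / 2) (r : ℕ) :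
    x * chebQuotSq n ζ g x j r =
      lam ζ j r • chebQuotSq n ζ g x j r + chebQuot n ζ g x j r := by
  have := H.aeval_X_sub_C_mul_chebQuotSq h1 hj r
  rw [map_sub, aeval_X, aeval_C, sub_mul, ← Algebra.smul_def, sub_eq_iff_eq_add'] at this
  exact this

/-- On the block of `E_{2r}` the element `g` is a scalar, so every element of the algebra acts there
as a polynomial in `x`. -/
theorem exists_mul_cycIdem_eq_aeval (w : R) (r : ℕ) :
    ∃ z : ℂ[X], w * cycIdem n ζ g (2 * r) = aeval x z * cycIdem n ζ g (2 * r) := by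
  have hw : w ∈ Algebra.adjoin ℂ {g, x} := by rw [H.adjoin_eq_top]; trivial
  induction hw using Algebra.adjoin_induction with
  | mem w hw =>
    rcases hw with rfl | rfl
    · exact ⟨C (ζ ^ (2 * r)), by
        rw [mul_cycIdem H.pos H.prim H.pow_eq_one, aeval_C, Algebra.smul_def]⟩
    · exact ⟨X, by rw [aeval_X]⟩
  | algebraMap c => exact ⟨C c, by rw [aeval_C]⟩
  | add w w' _ _ h h' =>
    obtain ⟨z, hz⟩ := h
    obtain ⟨z', hz'⟩ := h'
    exact ⟨z + z', by rw [add_mul, hz, hz', map_add, add_mul]⟩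
  | mul w w' _ _ h h' =>
    obtain ⟨z, hz⟩ := h
    obtain ⟨z', hz'⟩ := h'
    exact ⟨z * z', by rw [mul_assoc, hz', mul_left_comm, hz, map_mul]; ring⟩

/-- Every element of the algebra acts on the `F_{j,r}` and `G_{j,r}` in triangular form. -/
theorem exists_mul_eq (w : R) : ∃ μ : ℕ → ℕ → ℂ,
    (∀ j r, j ≤ (n - 1) / 2 → w * chebQuot n ζ g x j r = μ j r • chebQuot n ζ g x j r) ∧
    ∀ j r, 1 ≤ j → j ≤ (n - 1) / 2 → ∃ ν : ℂ, w * chebQuotSq n ζ g x j r =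
      μ j r • chebQuotSq n ζ g x j r + ν • chebQuot n ζ g x j r := by
  choose z hz using H.exists_mul_cycIdem_eq_aeval w
  have h : ∀ (p : ℂ[X]) r, w * (aeval x p * cycIdem n ζ g (2 * r)) =
      aeval x (z r) * (aeval x p * cycIdem n ζ g (2 * r)) := by
    intro p r
    rw [mul_left_comm, hz, mul_left_comm]
  refine ⟨fun j r => (z r).eval (lam ζ j r), fun j r hj => ?_, fun j r h1 hj => ?_⟩
  · rw [← H.aeval_mul_chebQuot hj]
    exact h _ r
  · obtain ⟨ν, hν⟩ := H.aeval_mul_chebQuotSq h1 hj r (z r)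
    exact ⟨ν, (h _ r).trans hν⟩

theorem cycIdem_mul_self {r : ℕ} (hr : r < n) :
    cycIdem n ζ g (2 * r) * cycIdem n ζ g (2 * r) = cycIdem n ζ g (2 * r) := by
  rw [cycIdem_mul_cycIdem H.pos H.prim H.odd H.pow_eq_one hr hr, if_pos rfl]

theorem mul_of_ne {r s : ℕ} (hr : r < n) (hs : s < n) (hrs : r ≠ s) (p p' : R) :
    (p * cycIdem n ζ g (2 * r)) * (p' * cycIdem n ζ g (2 * s)) = 0 := by
  rw [mul_mul_mul_comm, cycIdem_mul_cycIdem H.pos H.prim H.odd H.pow_eq_one hr hs, if_neg hrs,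
    mul_zero]

theorem mul_of_eq {r : ℕ} (hr : r < n) (p p' : R) :
    (p * cycIdem n ζ g (2 * r)) * (p' * cycIdem n ζ g (2 * r)) =
      p * (p' * cycIdem n ζ g (2 * r)) := by
  rw [mul_mul_mul_comm, H.cycIdem_mul_self hr, mul_assoc]

/-- The hypothesis excludes only the squares of the `F_{0,r}`: at the simple root `λ_{0,r}` the
quotient does not vanish, whereas at a double root it does. -/
theorem chebQuot_mul_chebQuot {j k r s : ℕ} (hj : j ≤ (n - 1) / 2) (hk : k ≤ (n - 1) / 2)
    (hr : r < n) (hs : s < n) (h : (j, r) ≠ (k, s) ∨ 1 ≤ j) :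
    chebQuot n ζ g x j r * chebQuot n ζ g x k s = 0 := by
  by_cases hrs : r = s
  · subst hrs
    rw [chebQuot, chebQuot, H.mul_of_eq hr, ← chebQuot, H.aeval_mul_chebQuot hk]
    by_cases hjk : j = k
    · subst hjk
      rw [eval_chebF_divByMonic_self H.pos H.prim H.odd (by simpa using h) hj, zero_smul]
    · rw [eval_chebF_divByMonic_of_ne H.pos H.prim H.odd hj hk hjk, zero_smul]
  · exact H.mul_of_ne hr hs hrs _ _

theorem chebQuot_zero_mul_self {r : ℕ} (hr : r < n) :
    chebQuot n ζ g x 0 r * chebQuot n ζ g x 0 r = xi n ζ r • chebQuot n ζ g x 0 r := by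
  rw [← eval_chebF_divByMonic_zero H.pos H.prim H.odd, ← H.aeval_mul_chebQuot (Nat.zero_le _)]
  exact H.mul_of_eq hr _ _

theorem chebQuotSq_mul_chebQuot_of_ne {j k r s : ℕ} (h1 : 1 ≤ j) (hj : j ≤ (n - 1) / 2)
    (hk : k ≤ (n - 1) / 2) (hr : r < n) (hs : s < n) (h : (j, r) ≠ (k, s)) :
    chebQuotSq n ζ g x j r * chebQuot n ζ g x k s = 0 := by
  by_cases hrs : r = s
  · subst hrs
    rw [chebQuot, chebQuotSq, H.mul_of_eq hr, ← chebQuot, H.aeval_mul_chebQuot hk,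
      eval_chebF_divByMonic_sq_of_ne H.pos H.prim H.odd h1 hj hk (fun e => h (by rw [e])),
      zero_smul]
  · exact H.mul_of_ne hr hs hrs _ _

theorem chebQuotSq_mul_chebQuot_self {j r : ℕ} (h1 : 1 ≤ j) (hj : j ≤ (n - 1) / 2) (hr : r < n) :
    chebQuotSq n ζ g x j r * chebQuot n ζ g x j r =
      vartheta n ζ j r • chebQuot n ζ g x j r := by
  rw [← eval_chebF_divByMonic_sq_self H.pos H.prim H.odd h1 hj, ← H.aeval_mul_chebQuot hj]
  exact H.mul_of_eq hr _ _

/-- Within one block, the quotient for `j` still contains the factor `(X - λ_{k,r})²`, which kills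
`G_{k,r}`. -/
theorem chebQuotSq_mul_chebQuotSq_of_ne {j k r s : ℕ} (h1 : 1 ≤ j) (hj : j ≤ (n - 1) / 2)
    (h1' : 1 ≤ k) (hk : k ≤ (n - 1) / 2) (hr : r < n) (hs : s < n) (h : (j, r) ≠ (k, s)) :
    chebQuotSq n ζ g x j r * chebQuotSq n ζ g x k s = 0 := by
  by_cases hrs : r = s
  · subst hrs
    obtain ⟨v, hv⟩ := sq_dvd_chebF_divByMonic_sq H.pos H.prim H.odd h1 hj h1' hk
      (fun e => h (by rw [e])) r
    conv_lhs => rw [chebQuotSq, hv, chebQuotSq]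
    rw [H.mul_of_eq hr, ← chebQuotSq, mul_comm ((X - C _) ^ 2), map_mul, mul_assoc,
      H.sq_mul_chebQuotSq h1' hk, mul_zero]
  · exact H.mul_of_ne hr hs hrs _ _

theorem exists_chebQuotSq_mul_self {j r : ℕ} (h1 : 1 ≤ j) (hj : j ≤ (n - 1) / 2) (hr : r < n) :
    ∃ ν : ℂ, chebQuotSq n ζ g x j r * chebQuotSq n ζ g x j r =
      vartheta n ζ j r • chebQuotSq n ζ g x j r + ν • chebQuot n ζ g x j r := by
  obtain ⟨ν, hν⟩ := H.aeval_mul_chebQuotSq h1 hj r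
    (chebF n (ζ ^ (2 * r)) /ₘ (X - C (lam ζ j r)) ^ 2)
  rw [eval_chebF_divByMonic_sq_self H.pos H.prim H.odd h1 hj] at hν
  exact ⟨ν, (H.mul_of_eq hr _ _).trans hν⟩

omit H in
/-- The family of all `F_{j,r}` and `G_{j,r}`. -/
noncomputable def family (n : ℕ) (ζ : ℂ) (g x : R) :
    (Fin ((n + 1) / 2) × Fin n) ⊕ (Fin ((n - 1) / 2) × Fin n) → R :=
  Sum.elim (fun p => chebQuot n ζ g x p.1 p.2) (fun p => chebQuotSq n ζ g x (p.1 + 1) p.2)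

omit H in
theorem chebQuot_mem_span {j r : ℕ} (hj : j ≤ (n - 1) / 2) (hr : r < n) :
    chebQuot n ζ g x j r ∈ Submodule.span ℂ (Set.range (family n ζ g x)) :=
  Submodule.subset_span ⟨Sum.inl (⟨j, by omega⟩, ⟨r, hr⟩), rfl⟩

omit H in
theorem chebQuotSq_mem_span {j r : ℕ} (h1 : 1 ≤ j) (hj : j ≤ (n - 1) / 2) (hr : r < n) :
    chebQuotSq n ζ g x j r ∈ Submodule.span ℂ (Set.range (family n ζ g x)) :=
  Submodule.subset_span ⟨Sum.inr (⟨j - 1, by omega⟩, ⟨r, hr⟩), by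
    simp [family, Nat.sub_add_cancel h1]⟩

theorem mul_mem_span {v : R} (w : R) (hv : v ∈ Submodule.span ℂ (Set.range (family n ζ g x))) :
    w * v ∈ Submodule.span ℂ (Set.range (family n ζ g x)) := by
  have hodd := Nat.odd_iff.1 H.odd
  obtain ⟨μ, h1, h2⟩ := H.exists_mul_eq w
  induction hv using Submodule.span_induction with
  | mem v hv =>
    obtain ⟨p | p, rfl⟩ := hv
    · change w * chebQuot n ζ g x p.1 p.2 ∈ _
      rw [h1 _ _ (by omega)]
      exact Submodule.smul_mem _ _ (chebQuot_mem_span (by omega) p.2.2)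
    · change w * chebQuotSq n ζ g x (p.1 + 1) p.2 ∈ _
      obtain ⟨ν, hν⟩ := h2 (p.1 + 1) p.2 (by omega) (by omega)
      rw [hν]
      exact Submodule.add_mem _
        (Submodule.smul_mem _ _ (chebQuotSq_mem_span (by omega) (by omega) p.2.2))
        (Submodule.smul_mem _ _ (chebQuot_mem_span (by omega) p.2.2))
  | zero => simp
  | add v v' _ _ h h' => rw [mul_add]; exact Submodule.add_mem _ h h'
  | smul c v _ h => rw [mul_smul_comm]; exact Submodule.smul_mem _ _ h

theorem cycIdem_mem_span {r : ℕ} (hr : r < n) :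
    cycIdem n ζ g (2 * r) ∈ Submodule.span ℂ (Set.range (family n ζ g x)) := by
  -- A Lagrange-type combination with value `1` at every root. At double roots `L - 1` need only
  -- vanish once, so `L` represents the identity of the block only up to a nilpotent.
  let L : ℂ[X] := C (xi n ζ r)⁻¹ * (chebF n (ζ ^ (2 * r)) /ₘ (X - C (lam ζ 0 r))) +
    ∑ j ∈ Finset.Icc 1 ((n - 1) / 2), C (vartheta n ζ j r)⁻¹ *
      (chebF n (ζ ^ (2 * r)) /ₘ (X - C (lam ζ j r)) ^ 2)
  have hL : ∀ k ≤ (n - 1) / 2, (L - 1).eval (lam ζ k r) = 0 := by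
    intro k hk
    simp only [L, eval_sub, eval_add, eval_mul, eval_C, eval_finsetSum, eval_one]
    rcases Nat.eq_zero_or_pos k with rfl | h1
    · rw [eval_chebF_divByMonic_zero H.pos H.prim H.odd, inv_mul_cancel₀ (xi_ne_zero H.pos H.prim r),
        Finset.sum_eq_zero, add_zero, sub_self]
      intro j hj
      rw [Finset.mem_Icc] at hj
      rw [eval_chebF_divByMonic_sq_of_ne H.pos H.prim H.odd hj.1 hj.2 hk (by omega), mul_zero]
    · rw [eval_chebF_divByMonic_of_ne H.pos H.prim H.odd (Nat.zero_le _) hk (by omega), mul_zero,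
        zero_add, Finset.sum_eq_single_of_mem k (Finset.mem_Icc.2 ⟨h1, hk⟩),
        eval_chebF_divByMonic_sq_self H.pos H.prim H.odd h1 hk,
        inv_mul_cancel₀ (vartheta_ne_zero H.pos H.prim h1 hk r), sub_self]
      intro j hj hjk
      rw [Finset.mem_Icc] at hj
      rw [eval_chebF_divByMonic_sq_of_ne H.pos H.prim H.odd hj.1 hj.2 hk hjk, mul_zero]
  have hmem : aeval x L * cycIdem n ζ g (2 * r) ∈
      Submodule.span ℂ (Set.range (family n ζ g x)) := by
    simp only [L, map_add, map_sum, map_mul, aeval_C, add_mul, Finset.sum_mul,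
      ← Algebra.smul_def, smul_mul_assoc]
    refine Submodule.add_mem _ (Submodule.smul_mem _ _ (chebQuot_mem_span (Nat.zero_le _) hr))
      (Submodule.sum_mem _ fun j hj => Submodule.smul_mem _ _ ?_)
    rw [Finset.mem_Icc] at hj
    exact chebQuotSq_mem_span hj.1 hj.2 hr
  have h0 := H.aeval_mul_eq_zero_of_dvd (chebF_dvd_sq H.pos H.prim H.odd hL)
  -- As `(L - 1)²` dies on the block, `2 - L` is the inverse of `L` there; the span is stable under
  -- multiplication, so it contains the idempotent.
  have e : cycIdem n ζ g (2 * r) = aeval x (2 - L) * (aeval x L * cycIdem n ζ g (2 * r)) := by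
    rw [← mul_assoc, ← map_mul]
    have : (L - 1) ^ 2 = 1 - (2 - L) * L := by ring
    rw [this, map_sub, map_one, sub_mul, one_mul, sub_eq_zero] at h0
    exact h0
  rw [e]
  exact H.mul_mem_span _ hmem

/-- The span is an ideal containing all block idempotents, hence their sum `1`. -/
theorem span_family : Submodule.span ℂ (Set.range (family n ζ g x)) = ⊤ := by
  rw [eq_top_iff]
  intro w _
  rw [← mul_one w, ← sum_cycIdem (g := g) H.pos H.prim H.odd]
  exact H.mul_mem_span _ (Submodule.sum_mem _ fun r hr =>
    H.cycIdem_mem_span (Finset.mem_range.1 hr))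

/-- The spanning family has `((n+1)/2 + (n-1)/2) n = n²` members, as many as the dimension. -/
theorem linearIndependent_family (hdim : Module.finrank ℂ R = n * n) :
    LinearIndependent ℂ (family n ζ g x) := by
  refine linearIndependent_of_top_le_span_of_card_eq_finrank H.span_family.ge ?_
  have hodd := Nat.odd_iff.1 H.odd
  rw [hdim, Fintype.card_sum, Fintype.card_prod, Fintype.card_prod, Fintype.card_fin,
    Fintype.card_fin, Fintype.card_fin, ← add_mul, show (n + 1) / 2 + (n - 1) / 2 = n by omega]

variable (hdim : Module.finrank ℂ R = n * n)
include hdim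

theorem chebQuot_ne_zero {j r : ℕ} (hj : j ≤ (n - 1) / 2) (hr : r < n) :
    chebQuot n ζ g x j r ≠ 0 := by
  have hj' : j < (n + 1) / 2 := by
    have := H.pos
    omega
  have h := (H.linearIndependent_family hdim).ne_zero (Sum.inl (⟨j, hj'⟩, ⟨r, hr⟩))
  rwa [family, Sum.elim_inl] at h

theorem linearIndependent_chebQuot_succ : LinearIndependent ℂ
    (fun p : Fin ((n - 1) / 2) × Fin n => chebQuot n ζ g x (p.1 + 1) p.2) := by
  have hodd := Nat.odd_iff.1 H.odd
  have hlt : ∀ i : Fin ((n - 1) / 2), (i : ℕ) + 1 < (n + 1) / 2 := fun i => by omega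
  let σ : Fin ((n - 1) / 2) × Fin n →
      (Fin ((n + 1) / 2) × Fin n) ⊕ (Fin ((n - 1) / 2) × Fin n) :=
    fun p => Sum.inl (⟨p.1 + 1, hlt p.1⟩, p.2)
  have hσ : Function.Injective σ := fun p p' h => by
    simp only [σ, Sum.inl.injEq, Prod.mk.injEq, Fin.mk.injEq] at h
    exact Prod.ext (Fin.ext (by omega)) h.2
  have e : (fun p : Fin ((n - 1) / 2) × Fin n => chebQuot n ζ g x (p.1 + 1) p.2) =
      family n ζ g x ∘ σ := by
    funext p
    rw [Function.comp_apply, family, Sum.elim_inl]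
  rw [e]
  exact (H.linearIndependent_family hdim).comp σ hσ

theorem eq_zero_of_isNilpotent {z : R} (hz : IsNilpotent z) {j r : ℕ} (hj : j ≤ (n - 1) / 2)
    (hr : r < n) {μ : ℂ} (h : z * chebQuot n ζ g x j r = μ • chebQuot n ζ g x j r) : μ = 0 := by
  obtain ⟨N, hN⟩ := hz
  have hp : ∀ N, z ^ N * chebQuot n ζ g x j r = μ ^ N • chebQuot n ζ g x j r := by
    intro N
    induction N with
    | zero => simp
    | succ N ih => rw [pow_succ, mul_assoc, h, mul_smul_comm, ih, smul_smul, pow_succ']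
  have := hp N
  rw [hN, zero_mul] at this
  exact eq_zero_of_pow_eq_zero
    ((smul_eq_zero.1 this.symm).resolve_right (H.chebQuot_ne_zero hdim hj hr))

/-- A finite-dimensional algebra is Artinian, so its radical is nilpotent; by commutativity every
nilpotent element lies in it. -/
theorem mem_jacobson_iff_isNilpotent (z : R) : z ∈ Ring.jacobson R ↔ IsNilpotent z := by
  have hfin : Module.Finite ℂ R :=
    Module.finite_of_finrank_pos (by rw [hdim]; exact Nat.mul_pos H.pos H.pos)
  have hart : IsArtinianRing R := isArtinian_of_tower ℂ inferInstance
  refine ⟨fun hz => ?_, fun hz => nilradical_le_jacobson R (mem_nilradical.2 hz)⟩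
  obtain ⟨N, hN⟩ := IsArtinianRing.isNilpotent_jacobson_bot (R := R)
  refine ⟨N, ?_⟩
  rw [Ideal.jacobson_bot] at hN
  have := Ideal.pow_mem_pow hz N
  rw [hN] at this
  exact this

/-- The expansion of an element in the family, by its action on the `F_{j,r}`. -/
theorem mem_span_chebQuot_of_isNilpotent {z : R} (hz : IsNilpotent z) :
    z ∈ Submodule.span ℂ (Set.range
      (fun p : Fin ((n - 1) / 2) × Fin n => chebQuot n ζ g x (p.1 + 1) p.2)) := by
  have hodd := Nat.odd_iff.1 H.odd
  have hmem : z ∈ Submodule.span ℂ (Set.range (family n ζ g x)) := by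
    rw [H.span_family]; trivial
  obtain ⟨c, hc⟩ := (Submodule.mem_span_range_iff_exists_fun ℂ).1 hmem
  -- Multiplication by `F_{0,r}` isolates one coefficient as an eigenvalue of `z`, and eigenvalues
  -- of a nilpotent vanish. The coefficients of the `G_{j,r}` are treated in the same way with
  -- `F_{j,r}`.
  have h0 : ∀ r : Fin n, c (Sum.inl (⟨0, by omega⟩, r)) = 0 := by
    intro r
    have h : z * chebQuot n ζ g x 0 r =
        (c (Sum.inl (⟨0, by omega⟩, r)) * xi n ζ r) • chebQuot n ζ g x 0 r := by
      rw [← hc, Finset.sum_mul, Finset.sum_eq_single (Sum.inl (⟨0, by omega⟩, r)), smul_mul_assoc]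
      · change _ • (chebQuot n ζ g x 0 r * _) = _
        rw [H.chebQuot_zero_mul_self r.2, smul_smul]
      · rintro (p | p) - hp
        · rw [smul_mul_assoc]
          change _ • (chebQuot n ζ g x p.1 p.2 * _) = 0
          rw [H.chebQuot_mul_chebQuot (by omega) (Nat.zero_le _) p.2.2 r.2, smul_zero]
          left
          intro e
          simp only [Prod.mk.injEq] at e
          exact hp (congrArg Sum.inl (Prod.ext (Fin.ext e.1) (Fin.ext e.2)))
        · rw [smul_mul_assoc]
          change _ • (chebQuotSq n ζ g x (p.1 + 1) p.2 * _) = 0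
          rw [H.chebQuotSq_mul_chebQuot_of_ne (by omega) (by omega) (Nat.zero_le _) p.2.2 r.2
            (by simp), smul_zero]
      · simp
    exact (mul_eq_zero.1 (H.eq_zero_of_isNilpotent hdim hz (Nat.zero_le _) r.2 h)).resolve_right
      (xi_ne_zero H.pos H.prim _)
  have h1 : ∀ p, c (Sum.inr p) = 0 := by
    intro p
    have h : z * chebQuot n ζ g x (p.1 + 1) p.2 =
        (c (Sum.inr p) * vartheta n ζ (p.1 + 1) p.2) • chebQuot n ζ g x (p.1 + 1) p.2 := by
      rw [← hc, Finset.sum_mul, Finset.sum_eq_single (Sum.inr p), smul_mul_assoc]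
      · change _ • (chebQuotSq n ζ g x (p.1 + 1) p.2 * _) = _
        rw [H.chebQuotSq_mul_chebQuot_self (by omega) (by omega) p.2.2, smul_smul]
      · rintro (p' | p') - hp
        · rw [smul_mul_assoc]
          change _ • (chebQuot n ζ g x p'.1 p'.2 * _) = 0
          rw [mul_comm, H.chebQuot_mul_chebQuot (by omega) (by omega) p.2.2 p'.2.2
            (Or.inr (by omega)), smul_zero]
        · rw [smul_mul_assoc]
          change _ • (chebQuotSq n ζ g x (p'.1 + 1) p'.2 * _) = 0
          rw [H.chebQuotSq_mul_chebQuot_of_ne (by omega) (by omega) (by omega) p'.2.2 p.2.2,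
            smul_zero]
          intro e
          simp only [Prod.mk.injEq, add_left_inj] at e
          exact hp (congrArg Sum.inr (Prod.ext (Fin.ext e.1) (Fin.ext e.2)))
      · simp
    exact (mul_eq_zero.1 (H.eq_zero_of_isNilpotent hdim hz (by omega) p.2.2 h)).resolve_right
      (vartheta_ne_zero H.pos H.prim (by omega) (by omega) _)
  rw [← hc]
  refine Submodule.sum_mem _ ?_
  rintro (⟨⟨j, hj⟩, r⟩ | p) -
  · cases j with
    | zero => rw [h0, zero_smul]; exact Submodule.zero_mem _
    | succ j =>
      exact Submodule.smul_mem _ _ (Submodule.subset_span ⟨(⟨j, by omega⟩, r), rfl⟩)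
  · rw [h1, zero_smul]; exact Submodule.zero_mem _

omit hdim in
theorem isNilpotent_of_mem_span {z : R} (hz : z ∈ Submodule.span ℂ (Set.range
    (fun p : Fin ((n - 1) / 2) × Fin n => chebQuot n ζ g x (p.1 + 1) p.2))) : IsNilpotent z := by
  induction hz using Submodule.span_induction with
  | mem z hz =>
    obtain ⟨p, rfl⟩ := hz
    refine ⟨2, ?_⟩
    rw [sq]
    exact H.chebQuot_mul_chebQuot (by omega) (by omega) p.2.2 p.2.2 (Or.inr (by omega))
  | zero => exact IsNilpotent.zero
  | add z z' _ _ h h' => exact (Commute.all z z').isNilpotent_add h h'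
  | smul c z _ h => exact h.smul c

theorem span_chebQuot_eq_jacobson : Submodule.span ℂ (Set.range
      (fun p : Fin ((n - 1) / 2) × Fin n => chebQuot n ζ g x (p.1 + 1) p.2)) =
    (Ring.jacobson R).restrictScalars ℂ := by
  ext z
  rw [Submodule.restrictScalars_mem, H.mem_jacobson_iff_isNilpotent hdim]
  exact ⟨H.isNilpotent_of_mem_span, H.mem_span_chebQuot_of_isNilpotent hdim⟩

theorem jacobson_mul_jacobson : Ring.jacobson R * Ring.jacobson R = ⊥ := by
  rw [eq_bot_iff, Ideal.mul_le]
  intro z hz w hw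
  rw [← Submodule.restrictScalars_mem ℂ, ← H.span_chebQuot_eq_jacobson hdim] at hz hw
  rw [Ideal.mem_bot]
  induction hz using Submodule.span_induction with
  | mem z hz =>
    obtain ⟨p, rfl⟩ := hz
    induction hw using Submodule.span_induction with
    | mem w hw =>
      obtain ⟨p', rfl⟩ := hw
      exact H.chebQuot_mul_chebQuot (by omega) (by omega) p.2.2 p'.2.2 (Or.inr (by omega))
    | zero => exact mul_zero _
    | add w w' _ _ h h' => rw [mul_add, h, h', add_zero]
    | smul c w _ h => rw [mul_smul_comm, h, smul_zero]
  | zero => exact zero_mul _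
  | add z z' _ _ h h' => rw [add_mul, h, h', add_zero]
  | smul c z _ h => rw [smul_mul_assoc, h, smul_zero]

/-- The orthogonal idempotents modulo the Jacobson radical. -/
theorem exists_orthogonalIdempotents :
    ∃ (ν : Fin ((n - 1) / 2) × Fin n → ℂ)
        (e : Fin n ⊕ Fin ((n - 1) / 2) × Fin n → R),
      (∀ p, chebQuotSq n ζ g x (p.1 + 1) p.2 ^ 2 =
        vartheta n ζ (p.1 + 1) p.2 • chebQuotSq n ζ g x (p.1 + 1) p.2 +
          ν p • chebQuot n ζ g x (p.1 + 1) p.2) ∧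
      (∀ r, e (Sum.inl r) = (xi n ζ r)⁻¹ • chebQuot n ζ g x 0 r) ∧
      (∀ p, e (Sum.inr p) = (vartheta n ζ (p.1 + 1) p.2)⁻¹ •
        (chebQuotSq n ζ g x (p.1 + 1) p.2 -
          (ν p / vartheta n ζ (p.1 + 1) p.2) • chebQuot n ζ g x (p.1 + 1) p.2)) ∧
      OrthogonalIdempotents e ∧
      LinearIndependent ℂ (fun t => ((Ring.jacobson R).restrictScalars ℂ).mkQ (e t)) ∧
      Submodule.span ℂ (Set.range (fun t =>
        ((Ring.jacobson R).restrictScalars ℂ).mkQ (e t))) = ⊤ := by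
  have hodd := Nat.odd_iff.1 H.odd
  have hν : ∀ p : Fin ((n - 1) / 2) × Fin n, ∃ ν : ℂ, chebQuotSq n ζ g x (p.1 + 1) p.2 ^ 2 =
      vartheta n ζ (p.1 + 1) p.2 • chebQuotSq n ζ g x (p.1 + 1) p.2 +
        ν • chebQuot n ζ g x (p.1 + 1) p.2 := fun p => by
    rw [sq]
    exact H.exists_chebQuotSq_mul_self (by omega) (by omega) p.2.2
  choose ν hν using hν
  have hξ := fun r => xi_ne_zero H.pos H.prim (ζ := ζ) (n := n) r
  have hθ : ∀ p : Fin ((n - 1) / 2) × Fin n, vartheta n ζ (p.1 + 1) p.2 ≠ 0 := fun p =>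
    vartheta_ne_zero H.pos H.prim (by omega) (by omega) _
  let F0 : Fin n → R := fun r => chebQuot n ζ g x 0 r
  let F : Fin ((n - 1) / 2) × Fin n → R := fun p => chebQuot n ζ g x (p.1 + 1) p.2
  let G : Fin ((n - 1) / 2) × Fin n → R := fun p => chebQuotSq n ζ g x (p.1 + 1) p.2
  have hne : ∀ p p' : Fin ((n - 1) / 2) × Fin n, p ≠ p' →
      ((p.1 : ℕ) + 1, (p.2 : ℕ)) ≠ ((p'.1 : ℕ) + 1, (p'.2 : ℕ)) := by
    intro p p' h e
    simp only [Prod.mk.injEq, add_left_inj] at e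
    exact h (Prod.ext (Fin.ext e.1) (Fin.ext e.2))
  have FF : ∀ p p', F p * F p' = 0 := fun p p' =>
    H.chebQuot_mul_chebQuot (by omega) (by omega) p.2.2 p'.2.2 (Or.inr (by omega))
  have F0F : ∀ r p, F0 r * F p = 0 := fun r p =>
    H.chebQuot_mul_chebQuot (by omega) (by omega) r.2 p.2.2 (Or.inl (by simp))
  have F0F0 : ∀ r s, r ≠ s → F0 r * F0 s = 0 := fun r s h =>
    H.chebQuot_mul_chebQuot (by omega) (by omega) r.2 s.2 (Or.inl (by simpa [Fin.ext_iff] using h))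
  have F0self : ∀ r : Fin n, F0 r * F0 r = xi n ζ r • F0 r := fun r =>
    H.chebQuot_zero_mul_self r.2
  have GF0 : ∀ p r, G p * F0 r = 0 := fun p r =>
    H.chebQuotSq_mul_chebQuot_of_ne (by omega) (by omega) (by omega) p.2.2 r.2 (by simp)
  have GF : ∀ p p', p ≠ p' → G p * F p' = 0 := fun p p' h =>
    H.chebQuotSq_mul_chebQuot_of_ne (by omega) (by omega) (by omega) p.2.2 p'.2.2 (hne p p' h)
  have GFself : ∀ p, G p * F p = vartheta n ζ (p.1 + 1) p.2 • F p := fun p =>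
    H.chebQuotSq_mul_chebQuot_self (by omega) (by omega) p.2.2
  have GG : ∀ p p', p ≠ p' → G p * G p' = 0 := fun p p' h =>
    H.chebQuotSq_mul_chebQuotSq_of_ne (by omega) (by omega) (by omega) (by omega) p.2.2 p'.2.2
      (hne p p' h)
  have GGself : ∀ p, G p * G p = vartheta n ζ (p.1 + 1) p.2 • G p + ν p • F p := fun p => by
    rw [← sq]; exact hν p
  let e : Fin n ⊕ Fin ((n - 1) / 2) × Fin n → R := Sum.elim (fun r => (xi n ζ r)⁻¹ • F0 r)
    (fun p => (vartheta n ζ (p.1 + 1) p.2)⁻¹ •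
      (G p - (ν p / vartheta n ζ (p.1 + 1) p.2) • F p))
  have hidem : ∀ t, e t * e t = e t := by
    rintro (r | p)
    · simp only [e, Sum.elim_inl]
      rw [smul_mul_smul_comm, F0self, smul_smul, mul_assoc, inv_mul_cancel₀ (hξ _), mul_one]
    -- The cross terms of the square contribute `-2ν F`, turning `ϑ G + ν F` into `ϑ G - ν F`, which
    -- is `ϑ` times the corrected element.
    · simp only [e, Sum.elim_inr]
      rw [smul_mul_smul_comm, sub_mul, mul_sub, mul_sub, mul_smul_comm, smul_mul_assoc,
        smul_mul_assoc, mul_smul_comm, FF, smul_zero, smul_zero, mul_comm (F p), GFself, GGself,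
        sub_zero, smul_smul, div_mul_cancel₀ _ (hθ p), add_sub_cancel_right, smul_sub, smul_sub,
        smul_smul, smul_smul, smul_smul, mul_assoc, inv_mul_cancel₀ (hθ p), mul_one]
      congr 2
      have := hθ p
      field_simp
  have horth : ∀ t t', t ≠ t' → e t * e t' = 0 := by
    rintro (r | p) (s | p') h
    · simp only [e, Sum.elim_inl]
      rw [smul_mul_smul_comm, F0F0 _ _ (fun h' => h (by rw [h'])), smul_zero]
    · simp only [e, Sum.elim_inl, Sum.elim_inr]
      rw [smul_mul_smul_comm, mul_sub, mul_smul_comm, F0F, mul_comm (F0 r), GF0]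
      simp
    · simp only [e, Sum.elim_inl, Sum.elim_inr]
      rw [smul_mul_smul_comm, sub_mul, smul_mul_assoc, mul_comm (F p), F0F, GF0]
      simp
    · have hp : p ≠ p' := fun h' => h (by rw [h'])
      simp only [e, Sum.elim_inr]
      rw [smul_mul_smul_comm, sub_mul, mul_sub, mul_sub, mul_smul_comm, smul_mul_assoc,
        smul_mul_assoc, mul_smul_comm, FF, GG _ _ hp, GF _ _ hp, mul_comm (F p), GF _ _ hp.symm]
      simp
  -- A nilpotent idempotent is zero, but `e t` is a nonzero multiple of `F_{0,r}` or acts as the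
  -- identity on some `F_{j,r} ≠ 0`.
  have hnil : ∀ t, ¬ IsNilpotent (e t) := by
    intro t ht
    have h0 : e t = 0 := by
      obtain ⟨N, hN⟩ := ht
      have := IsIdempotentElem.pow_succ_eq N (hidem t)
      rw [pow_succ, hN, zero_mul] at this
      exact this.symm
    rcases t with r | p
    · refine H.chebQuot_ne_zero hdim (Nat.zero_le _) r.2 (?_ : F0 r = 0)
      have : (xi n ζ r)⁻¹ • F0 r = 0 := h0
      exact (smul_eq_zero.1 this).resolve_left (inv_ne_zero (hξ _))
    · refine H.chebQuot_ne_zero hdim (j := p.1 + 1) (by omega) p.2.2 (?_ : F p = 0)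
      have h1 : e (Sum.inr p) * F p = 0 := by rw [h0, zero_mul]
      simp only [e, Sum.elim_inr] at h1
      rw [smul_mul_assoc, sub_mul, smul_mul_assoc, FF, smul_zero, sub_zero, GFself, smul_smul,
        inv_mul_cancel₀ (hθ p), one_smul] at h1
      exact h1
  refine ⟨ν, e, hν, fun _ => rfl, fun _ => rfl, ⟨hidem, fun t t' h => horth t t' h⟩, ?_, ?_⟩
  · rw [Fintype.linearIndependent_iff]
    intro a ha t
    have ha : ((Ring.jacobson R).restrictScalars ℂ).mkQ (∑ i, a i • e i) = 0 := by
      rw [map_sum, ← ha]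
      exact Finset.sum_congr rfl fun i _ => map_smul _ _ _
    rw [Submodule.mkQ_apply, Submodule.Quotient.mk_eq_zero, Submodule.restrictScalars_mem] at ha
    -- Multiplying a relation modulo the radical by `e t` leaves only the multiple `a t • e t`,
    -- which cannot be nilpotent unless `a t = 0`.
    have h1 := (Ring.jacobson R).mul_mem_left (e t) ha
    rw [Finset.mul_sum, Finset.sum_eq_single t, mul_smul_comm, hidem] at h1
    · by_contra hat
      have h2 := ((Ring.jacobson R).restrictScalars ℂ).smul_mem (a t)⁻¹ h1
      rw [inv_smul_smul₀ hat] at h2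
      exact hnil t ((H.mem_jacobson_iff_isNilpotent hdim _).1 h2)
    · intro t' _ h
      rw [mul_smul_comm, horth _ _ h.symm, smul_zero]
    · simp
  · rw [eq_top_iff, ← Submodule.range_mkQ, LinearMap.range_eq_map, ← H.span_family,
      Submodule.map_span, Submodule.span_le]
    have hF : ∀ p, ((Ring.jacobson R).restrictScalars ℂ).mkQ (F p) = 0 := by
      intro p
      rw [Submodule.mkQ_apply, Submodule.Quotient.mk_eq_zero, ← H.span_chebQuot_eq_jacobson hdim]
      exact Submodule.subset_span ⟨p, rfl⟩
    have hmem : ∀ t, ((Ring.jacobson R).restrictScalars ℂ).mkQ (e t) ∈ Submodule.span ℂ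
        (Set.range (fun t => ((Ring.jacobson R).restrictScalars ℂ).mkQ (e t))) := fun t =>
      Submodule.subset_span ⟨t, rfl⟩
    rintro _ ⟨_, ⟨(⟨⟨j, hj⟩, r⟩ | p), rfl⟩, rfl⟩
    · cases j with
      | zero =>
        have : family n ζ g x (Sum.inl (⟨0, hj⟩, r)) = xi n ζ r • e (Sum.inl r) :=
          (smul_inv_smul₀ (hξ r) (F0 r)).symm
        rw [this, map_smul]
        exact Submodule.smul_mem _ _ (hmem _)
      | succ j =>
        have := hF (⟨j, by omega⟩, r)
        change ((Ring.jacobson R).restrictScalars ℂ).mkQ (F (⟨j, by omega⟩, r)) ∈ _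
        rw [this]
        exact Submodule.zero_mem _
    · have : family n ζ g x (Sum.inr p) = vartheta n ζ (p.1 + 1) p.2 • e (Sum.inr p) +
          (ν p / vartheta n ζ (p.1 + 1) p.2) • F p := by
        change G p = vartheta n ζ (p.1 + 1) p.2 • ((vartheta n ζ (p.1 + 1) p.2)⁻¹ •
          (G p - (ν p / vartheta n ζ (p.1 + 1) p.2) • F p)) + _
        rw [smul_inv_smul₀ (hθ p), sub_add_cancel]
      rw [this, map_add, map_smul, map_smul, hF, smul_zero, add_zero]
      exact Submodule.smul_mem _ _ (hmem _)

end IsChebyshevAlgebra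

end ChebyshevAlgebra

/-! ### Eigenspaces of operators in triangular form. -/

namespace Module.End

variable {K V ι : Type*} [Field K] [AddCommGroup V] [Module K V]

/-- If generalized eigenvectors span, then they span every generalized eigenspace. -/
theorem maxGenEigenspace_eq_span_of_span_eq_top (T : Module.End K V) (v : ι → V) (μ : ι → K)
    (hv : ∀ i, v i ∈ T.maxGenEigenspace (μ i)) (hspan : Submodule.span K (Set.range v) = ⊤) (t : K) :
    T.maxGenEigenspace t = Submodule.span K {w | ∃ i, μ i = t ∧ w = v i} := by
  set N : K → Submodule K V := fun s => Submodule.span K {w | ∃ i, μ i = s ∧ w = v i} with hN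
  have hle : ∀ s, N s ≤ T.maxGenEigenspace s := fun s => Submodule.span_le.2 <| by
    rintro _ ⟨i, rfl, rfl⟩
    exact hv i
  have htop : N t ⊔ ⨆ (s) (_ : s ≠ t), N s = ⊤ := by
    rw [eq_top_iff, ← hspan, Submodule.span_le]
    rintro _ ⟨i, rfl⟩
    have hi : v i ∈ N (μ i) := Submodule.subset_span ⟨i, rfl, rfl⟩
    by_cases h : μ i = t
    · exact Submodule.mem_sup_left (h ▸ hi)
    · exact Submodule.mem_sup_right (Submodule.mem_iSup_of_mem (μ i)
        (Submodule.mem_iSup_of_mem h hi))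
  -- The spans for the other eigenvalues meet the generalized eigenspace of `t` trivially; with the
  -- modular law this leaves nothing outside `N t`.
  have hdis := (T.independent_maxGenEigenspace t).mono_right
    (iSup₂_mono fun s (_ : s ≠ t) => hle s)
  calc T.maxGenEigenspace t = (N t ⊔ ⨆ (s) (_ : s ≠ t), N s) ⊓ T.maxGenEigenspace t := by
        rw [htop, top_inf_eq]
    _ = N t ⊔ (⨆ (s) (_ : s ≠ t), N s) ⊓ T.maxGenEigenspace t := sup_inf_assoc_of_le _ (hle t)
    _ = N t := by rw [inf_comm, hdis.eq_bot, sup_bot_eq]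

theorem mem_maxGenEigenspace_of_triangular {T : Module.End K V} {f g : V} {μ ν : K}
    (hf : T f = μ • f) (hg : T g = μ • g + ν • f) : g ∈ T.maxGenEigenspace μ := by
  refine (mem_maxGenEigenspace T μ g).2 ⟨2, ?_⟩
  rw [sq, mul_apply]
  simp [hf, hg]

theorem mem_maxGenEigenspace_of_apply_eq {T : Module.End K V} {f : V} {μ : K}
    (hf : T f = μ • f) : f ∈ T.maxGenEigenspace μ :=
  (mem_maxGenEigenspace T μ f).2 ⟨1, by simp [hf]⟩

/-- The eigenspaces of an operator with Jordan blocks of sizes one and two. -/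
theorem eigenspace_eq_span_of_jordan {κ : Type*} [Fintype ι] [Fintype κ] [DecidableEq ι]
    [DecidableEq κ] (T : Module.End K V)
    (f : ι → V) (g : κ → V) (σ : κ → ι) (hσ : Function.Injective σ) (μ : ι → K)
    (hf : ∀ i, T (f i) = μ i • f i) (hg : ∀ p, T (g p) = μ (σ p) • g p + f (σ p))
    (hli : LinearIndependent K (Sum.elim f g))
    (hspan : Submodule.span K (Set.range (Sum.elim f g)) = ⊤) (t : K) :
    T.eigenspace t = Submodule.span K {w | ∃ i, μ i = t ∧ w = f i} := by
  refine le_antisymm (fun v hv => ?_) (Submodule.span_le.2 ?_)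
  · rw [mem_eigenspace_iff] at hv
    have hmem : v ∈ Submodule.span K (Set.range (Sum.elim f g)) := by rw [hspan]; trivial
    obtain ⟨c, rfl⟩ := (Submodule.mem_span_range_iff_exists_fun K).1 hmem
    rw [Fintype.sum_sum_type] at hv ⊢
    simp only [Sum.elim_inl, Sum.elim_inr] at hv ⊢
    -- The coordinates of `(T - t) v`: each `g p` also contributes to the coordinate of `f (σ p)`.
    let d : ι ⊕ κ → K := Sum.elim
      (fun i => c (Sum.inl i) * (μ i - t) + ∑ p, if σ p = i then c (Sum.inr p) else 0)
      (fun p => c (Sum.inr p) * (μ (σ p) - t))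
    have hd : ∑ i, d i • Sum.elim f g i = 0 := by
      rw [Fintype.sum_sum_type]
      simp only [d, Sum.elim_inl, Sum.elim_inr, add_smul, Finset.sum_add_distrib, Finset.sum_smul]
      rw [Finset.sum_comm (γ := ι)]
      have e : ∀ p, ∑ i, (if σ p = i then c (Sum.inr p) else 0) • f i = c (Sum.inr p) • f (σ p) := by
        intro p
        rw [Finset.sum_eq_single (σ p)]
        · rw [if_pos rfl]
        · intro i _ hi
          rw [if_neg hi.symm, zero_smul]
        · simp
      simp only [e, mul_sub, sub_smul, Finset.sum_sub_distrib]
      rw [map_add, map_sum, map_sum, smul_add, Finset.smul_sum, Finset.smul_sum] at hv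
      simp only [map_smul, hf, hg, smul_add, Finset.sum_add_distrib, smul_smul] at hv
      simp only [mul_comm t] at hv
      rw [← sub_eq_zero] at hv
      rw [← hv]
      abel
    have h0 := Fintype.linearIndependent_iff.1 hli d hd
    -- If `μ (σ p) ≠ t`, the coordinate at `g p` gives this. Otherwise the coordinate at `f (σ p)`
    -- reduces to `c (Sum.inr p)`, because `σ` is injective.
    have hc : ∀ p, c (Sum.inr p) = 0 := by
      intro p
      have h1 : c (Sum.inr p) * (μ (σ p) - t) = 0 := h0 (Sum.inr p)
      rcases mul_eq_zero.1 h1 with h | h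
      · exact h
      · have h2 : c (Sum.inl (σ p)) * (μ (σ p) - t) +
            ∑ p', (if σ p' = σ p then c (Sum.inr p') else 0) = 0 := h0 (Sum.inl (σ p))
        rw [h, mul_zero, zero_add, Finset.sum_eq_single p, if_pos rfl] at h2
        · exact h2
        · intro p' _ hp'
          rw [if_neg fun e => hp' (hσ e)]
        · simp
    simp only [hc, zero_smul, Finset.sum_const_zero, add_zero]
    refine Submodule.sum_mem _ fun i _ => ?_
    by_cases h : μ i = t
    · exact Submodule.smul_mem _ _ (Submodule.subset_span ⟨i, h, rfl⟩)
    · have h1 : c (Sum.inl i) * (μ i - t) +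
          ∑ p', (if σ p' = i then c (Sum.inr p') else 0) = 0 := h0 (Sum.inl i)
      simp only [hc, ite_self, Finset.sum_const_zero, add_zero] at h1
      rw [(mul_eq_zero.1 h1).resolve_right (sub_ne_zero.2 h), zero_smul]
      exact Submodule.zero_mem _
  · rintro _ ⟨i, rfl, rfl⟩
    exact mem_eigenspace_iff.2 (hf i)

end Module.End

/-! ### The same results for families indexed by `j` and `r`. -/

section LeftEigenvectors

variable {V : Type*} [AddCommGroup V] [Module ℂ V] {n : ℕ} {f g : ℕ → ℕ → V}

theorem maxGenEigenspace_eq_span_union (hodd : Odd n) (T : Module.End ℂ V) (μ : ℕ → ℕ → ℂ)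
    (hf : ∀ j r, j ≤ (n - 1) / 2 → r < n → T (f j r) = μ j r • f j r)
    (hg : ∀ j r, 1 ≤ j → j ≤ (n - 1) / 2 → r < n → ∃ ν : ℂ,
      T (g j r) = μ j r • g j r + ν • f j r)
    (hspan : Submodule.span ℂ (Set.range (Sum.elim
        (fun p : Fin ((n + 1) / 2) × Fin n => f p.1 p.2)
        (fun p : Fin ((n - 1) / 2) × Fin n => g (p.1 + 1) p.2))) = ⊤) (t : ℂ) :
    T.maxGenEigenspace t = Submodule.span ℂ
      ({v | ∃ j r, j ≤ (n - 1) / 2 ∧ r < n ∧ μ j r = t ∧ v = f j r} ∪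
        {v | ∃ j r, 1 ≤ j ∧ j ≤ (n - 1) / 2 ∧ r < n ∧ μ j r = t ∧ v = g j r}) := by
  rw [Nat.odd_iff] at hodd
  rw [Module.End.maxGenEigenspace_eq_span_of_span_eq_top T _ (Sum.elim
    (fun p : Fin ((n + 1) / 2) × Fin n => μ p.1 p.2)
    (fun p : Fin ((n - 1) / 2) × Fin n => μ (p.1 + 1) p.2)) _ hspan t]
  · congr 1
    ext v
    constructor
    · rintro ⟨p | p, h, rfl⟩
      · exact Or.inl ⟨p.1, p.2, by omega, p.2.2, h, rfl⟩
      · exact Or.inr ⟨p.1 + 1, p.2, by omega, by omega, p.2.2, h, rfl⟩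
    · rintro (⟨j, r, hj, hr, h, rfl⟩ | ⟨j, r, h1, hj, hr, h, rfl⟩)
      · exact ⟨Sum.inl (⟨j, by omega⟩, ⟨r, hr⟩), h, rfl⟩
      · refine ⟨Sum.inr (⟨j - 1, by omega⟩, ⟨r, hr⟩), ?_, ?_⟩ <;>
          simp [Nat.sub_add_cancel h1, h]
  · rintro (p | p)
    · exact Module.End.mem_maxGenEigenspace_of_apply_eq (hf _ _ (by omega) p.2.2)
    · obtain ⟨ν, hν⟩ := hg (p.1 + 1) p.2 (by omega) (by omega) p.2.2
      exact Module.End.mem_maxGenEigenspace_of_triangular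
        (hf (p.1 + 1) p.2 (by omega) p.2.2) hν

theorem eigenspace_eq_span (hodd : Odd n) (T : Module.End ℂ V) (μ : ℕ → ℕ → ℂ)
    (hf : ∀ j r, j ≤ (n - 1) / 2 → r < n → T (f j r) = μ j r • f j r)
    (hg : ∀ j r, 1 ≤ j → j ≤ (n - 1) / 2 → r < n → T (g j r) = μ j r • g j r + f j r)
    (hli : LinearIndependent ℂ (Sum.elim
        (fun p : Fin ((n + 1) / 2) × Fin n => f p.1 p.2)
        (fun p : Fin ((n - 1) / 2) × Fin n => g (p.1 + 1) p.2)))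
    (hspan : Submodule.span ℂ (Set.range (Sum.elim
        (fun p : Fin ((n + 1) / 2) × Fin n => f p.1 p.2)
        (fun p : Fin ((n - 1) / 2) × Fin n => g (p.1 + 1) p.2))) = ⊤) (t : ℂ) :
    T.eigenspace t = Submodule.span ℂ
      {v | ∃ j r, j ≤ (n - 1) / 2 ∧ r < n ∧ μ j r = t ∧ v = f j r} := by
  rw [Nat.odd_iff] at hodd
  have hlt : ∀ i : Fin ((n - 1) / 2), (i : ℕ) + 1 < (n + 1) / 2 := fun i => by omega
  rw [Module.End.eigenspace_eq_span_of_jordan T _ _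
    (fun p => (⟨p.1 + 1, hlt p.1⟩, p.2)) ?_
    (fun p : Fin ((n + 1) / 2) × Fin n => μ p.1 p.2) ?_ ?_ hli hspan t]
  · congr 1
    ext v
    constructor
    · rintro ⟨p, h, rfl⟩
      exact ⟨p.1, p.2, by omega, p.2.2, h, rfl⟩
    · rintro ⟨j, r, hj, hr, h, rfl⟩
      exact ⟨(⟨j, by omega⟩, ⟨r, hr⟩), h, rfl⟩
  · intro p p' h
    simp only [Prod.mk.injEq, Fin.mk.injEq] at h
    exact Prod.ext (Fin.ext (by omega)) h.2
  · exact fun p => hf _ _ (by omega) p.2.2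
  · exact fun p => hg _ _ (by omega) (by omega) p.2.2

end LeftEigenvectors

/-! ### Relations between `g` and `x` in the Grothendieck algebra. -/

namespace TaftDouble

variable {k : Type u} [Field k] {n : ℕ} {q : k} (hn : 3 ≤ n) (hq : IsPrimitiveRoot q n)

theorem grothCls_one_mul {ℓ : ℕ} (hℓ : ℓ ≤ n) (h1 : 1 ≤ n) (r s : ℤ) :
    G0C.cls (V hn hq 1 h1 s) * G0C.cls (V hn hq ℓ hℓ r) = G0C.cls (V hn hq ℓ hℓ (r + s)) := by
  rw [G0C.cls_mul_cls, G0C.cls, G0C.cls, cls_tensor_one_left]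

theorem grothCls_mul_one {ℓ : ℕ} (hℓ : ℓ ≤ n) (h1 : 1 ≤ n) (r s : ℤ) :
    G0C.cls (V hn hq ℓ hℓ r) * G0C.cls (V hn hq 1 h1 s) = G0C.cls (V hn hq ℓ hℓ (r + s)) := by
  rw [G0C.cls_mul_cls, G0C.cls, G0C.cls, cls_tensor_one_right]

theorem one_eq_grothCls (h1 : 1 ≤ n) :
    (1 : Groth hn hq) = G0C.cls (V hn hq 1 h1 0) := by
  rw [G0C.one_def, G0C.cls, G0C.cls, cls_trivial]

theorem gElt_pow (m : ℕ) : gElt hn hq ^ m = G0C.cls (V hn hq 1 (by omega) m) := by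
  induction m with
  | zero => rw [pow_zero, one_eq_grothCls hn hq (by omega), Nat.cast_zero]
  | succ m ih => rw [pow_succ, ih, gElt, grothCls_mul_one, Nat.cast_succ]

theorem gElt_pow_card : gElt hn hq ^ n = 1 := by
  rw [gElt_pow, one_eq_grothCls hn hq (by omega), G0C.cls, G0C.cls,
    cls_V_congr (r' := 0) _ (by rw [zpow_natCast, hq.pow_eq_one, zpow_zero])]

theorem grothCls_mul_gElt_pow {ℓ : ℕ} (hℓ : ℓ ≤ n) (r : ℤ) (m : ℕ) :
    G0C.cls (V hn hq ℓ hℓ r) * gElt hn hq ^ m = G0C.cls (V hn hq ℓ hℓ (r + m)) := by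
  rw [gElt_pow, grothCls_mul_one]

theorem gElt_mul_grothCls {ℓ : ℕ} (hℓ : ℓ ≤ n) (r : ℤ) :
    gElt hn hq * G0C.cls (V hn hq ℓ hℓ r) = G0C.cls (V hn hq ℓ hℓ (r + 1)) :=
  grothCls_one_mul hn hq hℓ (by omega) r 1

/-- The class of `V(ℓ, 0)`, extended by zero. -/
noncomputable def uElt (ℓ : ℕ) : Groth hn hq :=
  if h : ℓ ≤ n then G0C.cls (V hn hq ℓ h 0) else 0

theorem uElt_of_le {ℓ : ℕ} (h : ℓ ≤ n) : uElt hn hq ℓ = G0C.cls (V hn hq ℓ h 0) := dif_pos h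

theorem uElt_zero : uElt hn hq 0 = 0 := by
  rw [uElt_of_le hn hq (Nat.zero_le n), G0C.cls, cls_V_zero, TensorProduct.tmul_zero]

theorem uElt_one : uElt hn hq 1 = 1 := by
  rw [uElt_of_le hn hq (by omega), ← one_eq_grothCls]

theorem uElt_two : uElt hn hq 2 = xElt hn hq := uElt_of_le hn hq (by omega)

theorem grothCls_eq {ℓ : ℕ} (h : ℓ ≤ n) (r : ℕ) :
    G0C.cls (V hn hq ℓ h r) = uElt hn hq ℓ * gElt hn hq ^ r := by
  rw [uElt_of_le hn hq h, grothCls_mul_gElt_pow, zero_add]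

theorem uElt_mul_xElt {ℓ : ℕ} (h0 : 0 < ℓ) (hlt : ℓ < n) :
    uElt hn hq ℓ * xElt hn hq =
      uElt hn hq (ℓ + 1) + uElt hn hq (ℓ - 1) * gElt hn hq := by
  have h := grothCls_mul_gElt_pow hn hq (ℓ := ℓ - 1) (by omega) 0 1
  rw [pow_one] at h
  rw [uElt_of_le hn hq hlt.le, uElt_of_le hn hq hlt, uElt_of_le hn hq (ℓ := ℓ - 1) (by omega), h,
    xElt, G0C.cls_mul_cls, G0C.cls, cls_tensor_two_of_lt h0 hlt, TensorProduct.tmul_add]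
  rfl

theorem uElt_card_mul_xElt :
    uElt hn hq n * xElt hn hq = 2 * (uElt hn hq (n - 1) * gElt hn hq) + 2 := by
  have h1 : 1 ≤ n := by omega
  have h := grothCls_mul_gElt_pow hn hq (ℓ := n - 1) (by omega) 0 1
  rw [pow_one] at h
  rw [← mul_one (2 : Groth hn hq), mul_assoc, one_mul, one_eq_grothCls hn hq h1,
    uElt_of_le hn hq le_rfl, uElt_of_le hn hq (ℓ := n - 1) (by omega), h,
    xElt, G0C.cls_mul_cls, G0C.cls, cls_tensor_two_self, TensorProduct.tmul_add,
    TensorProduct.tmul_smul, TensorProduct.tmul_smul, two_mul, two_mul, two_smul, two_smul]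
  rfl

/-- The tensor rule solved for the largest module: `u_{ℓ+1} = u_ℓ x - u_{ℓ-1} g`. -/
theorem uElt_mem_adjoin (ℓ : ℕ) :
    uElt hn hq ℓ ∈ Algebra.adjoin ℂ {gElt hn hq, xElt hn hq} := by
  induction ℓ using Nat.twoStepInduction with
  | zero => exact uElt_zero hn hq ▸ zero_mem _
  | one => exact uElt_one hn hq ▸ one_mem _
  | more ℓ h0 h1 =>
    by_cases h : ℓ + 1 < n
    · have := uElt_mul_xElt hn hq (Nat.succ_pos ℓ) h
      rw [← sub_eq_iff_eq_add] at this
      rw [← this]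
      exact sub_mem (mul_mem h1 (Algebra.subset_adjoin (by simp)))
        (mul_mem h0 (Algebra.subset_adjoin (by simp)))
    · rw [uElt, dif_neg (by omega)]
      exact zero_mem _

variable [IsAlgClosed k]

/-- The basis of classes of simple modules. -/
noncomputable def grothBasis : Module.Basis (Fin n × Fin n) ℂ (Groth hn hq) :=
  G0C.simpleBasis (simpleModule hn hq) isSimpleModule_simpleModule simpleModule_injective
    exists_equiv_simpleModule

theorem grothBasis_apply (i : Fin n × Fin n) :
    grothBasis hn hq i = G0C.cls (simpleModule hn hq i) :=
  G0C.simpleBasis_apply ..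

theorem grothBasis_repr_cls (W : FDModule k (TaftDouble hn hq)) (i : Fin n × Fin n) :
    (grothBasis hn hq).repr (G0C.cls W) i = W.multiplicity (simpleModule hn hq i) :=
  G0C.simpleBasis_repr_cls ..

theorem finrank_groth : Module.finrank ℂ (Groth hn hq) = n * n := by
  rw [Module.finrank_eq_card_basis (grothBasis hn hq), Fintype.card_prod, Fintype.card_fin]

theorem adjoin_gElt_xElt : Algebra.adjoin ℂ {gElt hn hq, xElt hn hq} = ⊤ := by
  rw [eq_top_iff]
  intro z _
  rw [← (grothBasis hn hq).sum_repr z]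
  refine sum_mem fun i _ => Subalgebra.smul_mem _ ?_ _
  rw [grothBasis_apply, simpleModule, grothCls_eq]
  exact mul_mem (uElt_mem_adjoin hn hq _) (pow_mem (Algebra.subset_adjoin (by simp)) _)

/-- It suffices that the generators `g` and `x` commute, and `V(1,1)` may be tensored on either side
with the same class. -/
theorem groth_mul_comm (z w : Groth hn hq) : z * w = w * z := by
  have hgx : gElt hn hq * xElt hn hq = xElt hn hq * gElt hn hq := by
    rw [xElt, gElt_mul_grothCls, gElt, grothCls_mul_one]
  have h : ∀ a ∈ ({gElt hn hq, xElt hn hq} : Set (Groth hn hq)),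
      ∀ b ∈ ({gElt hn hq, xElt hn hq} : Set (Groth hn hq)), a * b = b * a := by
    rintro _ (rfl | rfl) _ (rfl | rfl)
    exacts [rfl, hgx, hgx.symm, rfl]
  have hz : ∀ z, z ∈ Algebra.adjoin ℂ {gElt hn hq, xElt hn hq} := by
    rw [adjoin_gElt_xElt]
    exact fun _ => trivial
  have := Algebra.isMulCommutative_adjoin ℂ h
  exact congrArg Subtype.val (mul_comm' (⟨z, hz z⟩ : Algebra.adjoin ℂ _) ⟨w, hz w⟩)

/-- The Grothendieck algebra is commutative. -/
@[reducible] noncomputable def grothCommRing : CommRing (Groth hn hq) :=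
  { (inferInstance : Ring (Groth hn hq)) with mul_comm := groth_mul_comm hn hq }

theorem isChebyshevAlgebra (hodd : Odd n) {ζ : ℂ} (hζ : IsPrimitiveRoot ζ n) :
    letI := grothCommRing hn hq
    IsChebyshevAlgebra n ζ (gElt hn hq) (xElt hn hq) := by
  let := grothCommRing hn hq
  refine ⟨by omega, hζ, hodd, gElt_pow_card hn hq, ?_, adjoin_gElt_xElt hn hq⟩
  -- The Dickson polynomials satisfy the recursion of the tensor rule with other initial values. The
  -- formula fails for `m = 0`, where the polynomial is `2`, so the step to `m = 2` is treated
  -- separately.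
  have hD : ∀ m, 1 ≤ m → m < n →
      (Polynomial.dickson 1 (gElt hn hq) m).eval (xElt hn hq) =
        uElt hn hq (m + 1) - uElt hn hq (m - 1) * gElt hn hq := by
    intro m
    induction m using Nat.twoStepInduction with
    | zero => simp
    | one =>
      intro _ _
      simp [uElt_two, uElt_zero]
    | more m h0 h1 =>
      intro _ hm
      rw [Polynomial.dickson_add_two, Polynomial.eval_sub, Polynomial.eval_mul,
        Polynomial.eval_mul, Polynomial.eval_X, Polynomial.eval_C, h1 (by omega) (by omega)]
      have e2 := uElt_mul_xElt hn hq (ℓ := m + 2) (by omega) hm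
      simp only [Nat.add_sub_cancel, Nat.add_succ_sub_one] at e2 ⊢
      rcases Nat.eq_zero_or_pos m with rfl | hm0
      · have h2 : (3 - ((1 : ℕ) : Polynomial (Groth hn hq))) = 2 := by norm_num
        simp only [Polynomial.dickson_zero, zero_add, uElt_zero, zero_mul, sub_zero, uElt_one,
          one_mul, uElt_two, h2, Polynomial.eval_ofNat, one_add_one_eq_two] at e2 ⊢
        linear_combination e2
      · rw [h0 hm0 (by omega)]
        have e3 := uElt_mul_xElt hn hq (ℓ := m) hm0 (by omega)
        linear_combination e2 - gElt hn hq * e3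
  obtain ⟨m, rfl⟩ : ∃ m, n = m + 2 := ⟨n - 2, by omega⟩
  rw [chebF_eq_dickson (by omega), Polynomial.dickson_add_two, Polynomial.eval_sub,
    Polynomial.eval_sub, Polynomial.eval_mul,
    Polynomial.eval_mul, Polynomial.eval_X, Polynomial.eval_C, hD _ (by omega) (by omega),
    hD _ (by omega) (by omega), Polynomial.eval_ofNat]
  have e1 := uElt_card_mul_xElt hn hq
  have e2 := uElt_mul_xElt hn hq (ℓ := m) (by omega) (by omega)
  simp only [Nat.add_sub_cancel, Nat.add_succ_sub_one] at e1 e2 ⊢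
  -- The doubled term `2 g u_{n-1}` of the boundary rule cancels completely, leaving the constant
  -- `2`.
  linear_combination e1 - gElt hn hq * e2

end TaftDouble

/-! ### The presentation by generators and relations. -/

section Presentation

open Polynomial

variable {R : Type*} [CommRing R] [Algebra ℂ R] {n : ℕ}

/-- The algebra map from the group algebra of a cyclic group of order `n` that sends the generator
to `g`. -/
noncomputable def cyclicLift [NeZero n] (g : R) (hg : g ^ n = 1) :
    MonoidAlgebra ℂ (Multiplicative (ZMod n)) →ₐ[ℂ] R :=
  MonoidAlgebra.lift ℂ R (Multiplicative (ZMod n))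
    { toFun := fun z => g ^ z.toAdd.val
      map_one' := by simp
      map_mul' := fun z w => by
        rw [toAdd_mul, ZMod.val_add, ← pow_eq_pow_mod _ hg, pow_add] }

theorem cyclicLift_single [NeZero n] (g : R) (hg : g ^ n = 1) :
    cyclicLift g hg (MonoidAlgebra.single (Multiplicative.ofAdd (1 : ZMod n)) 1) = g := by
  rw [cyclicLift, MonoidAlgebra.lift_single, one_smul]
  change g ^ (1 : ZMod n).val = g
  rw [ZMod.val_one_eq_one_mod, ← pow_eq_pow_mod _ hg, pow_one]

theorem map_chebF (hn : 0 < n) {S : Type*} [CommRing S] [Algebra ℂ S] (φ : R →ₐ[ℂ] S) (g : R) :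
    (chebF n g).map φ.toRingHom = chebF n (φ g) := by
  rw [chebF_eq_dickson hn, chebF_eq_dickson hn, Polynomial.map_sub, map_dickson,
    Polynomial.map_ofNat]
  rfl

/-- The induced map is surjective because `g` and `x` generate. Since `f` is monic of degree `n`
over an algebra of dimension `n`, the source has dimension `n²`, and surjectivity implies
injectivity. -/
theorem IsChebyshevAlgebra.exists_algEquiv {ζ : ℂ} {g x : R} (H : IsChebyshevAlgebra n ζ g x)
    (hdim : Module.finrank ℂ R = n * n) :
    ∃ Φ : AdjoinRoot (chebF n
          (MonoidAlgebra.single (Multiplicative.ofAdd (1 : ZMod n)) (1 : ℂ))) ≃ₐ[ℂ] R,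
        Φ (AdjoinRoot.of _ (MonoidAlgebra.single (Multiplicative.ofAdd (1 : ZMod n)) (1 : ℂ))) =
          g ∧
        Φ (AdjoinRoot.root _) = x := by
  have : NeZero n := ⟨H.pos.ne'⟩
  set γ : MonoidAlgebra ℂ (Multiplicative (ZMod n)) :=
    MonoidAlgebra.single (Multiplicative.ofAdd (1 : ZMod n)) (1 : ℂ) with hγ
  have hφ : cyclicLift g H.pow_eq_one γ = g := cyclicLift_single g H.pow_eq_one
  have hroot : (chebF n γ).eval₂ (cyclicLift g H.pow_eq_one).toRingHom x = 0 := by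
    rw [← eval_map, map_chebF H.pos, hφ, H.eval_eq_zero]
  let Φ := AdjoinRoot.liftAlgHom (chebF n γ) (cyclicLift g H.pow_eq_one) x hroot
  have hg : Φ (AdjoinRoot.of _ γ) = g :=
    (AdjoinRoot.liftAlgHom_of ..).trans hφ
  have hx : Φ (AdjoinRoot.root _) = x := AdjoinRoot.liftAlgHom_root ..
  have hsurj : Function.Surjective Φ := by
    rw [← AlgHom.range_eq_top, eq_top_iff, ← H.adjoin_eq_top, Algebra.adjoin_le_iff]
    rintro _ (rfl | rfl)
    exacts [⟨_, hg⟩, ⟨_, hx⟩]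
  obtain ⟨hmon, hdeg⟩ := chebF_monic_natDegree H.pos γ
  have hgroup : Module.finrank ℂ (MonoidAlgebra ℂ (Multiplicative (ZMod n))) = n := by
    rw [(MonoidAlgebra.coeffLinearEquiv ℂ).finrank_eq, Module.finrank_finsupp_self]
    simp
  have hfree : Module.Free (MonoidAlgebra ℂ (Multiplicative (ZMod n))) (AdjoinRoot (chebF n γ)) :=
    Module.Free.of_basis (AdjoinRoot.powerBasis' hmon).basis
  have hrank : Module.finrank ℂ (AdjoinRoot (chebF n γ)) = n * n := by
    rw [← Module.finrank_mul_finrank ℂ (MonoidAlgebra ℂ (Multiplicative (ZMod n))), hgroup,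
      (AdjoinRoot.powerBasis' hmon).finrank, AdjoinRoot.powerBasis'_dim, hdeg]
  have hpos : 0 < n * n := Nat.mul_pos H.pos H.pos
  have : Module.Finite ℂ (AdjoinRoot (chebF n γ)) :=
    Module.finite_of_finrank_pos (hrank ▸ hpos)
  have : Module.Finite ℂ R := Module.finite_of_finrank_pos (hdim ▸ hpos)
  have hinj : Function.Injective Φ :=
    (LinearMap.injective_iff_surjective_of_finrank_eq_finrank (f := Φ.toLinearMap)
      (hrank.trans hdim.symm)).2 hsurj
  exact ⟨AlgEquiv.ofBijective Φ ⟨hinj, hsurj⟩, hg, hx⟩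

end Presentation

/-! ### McKay matrices as multiplication operators. -/

namespace TaftDouble

variable {k : Type u} [Field k] [IsAlgClosed k] {n : ℕ} {q : k} (hn : 3 ≤ n)
  (hq : IsPrimitiveRoot q n)

/-- Multiplication from the right by the McKay matrix of `W` is multiplication by `[W]`. -/
theorem vecMul_mcKay (W : FDModule k (TaftDouble hn hq)) (z : Groth hn hq) :
    Matrix.vecMul ((grothBasis hn hq).equivFun z) (mcKay hn hq W) =
      (grothBasis hn hq).equivFun (G0C.cls W * z) := by
  rw [groth_mul_comm]
  -- On basis vectors: the row of the matrix at `i` lists the coordinates of `[S_i ⊗ W] = [S_i]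
  -- [W]`.
  have h : (mcKay hn hq W).vecMulLinear ∘ₗ (grothBasis hn hq).equivFun.toLinearMap =
      (grothBasis hn hq).equivFun.toLinearMap ∘ₗ LinearMap.mulRight ℂ (G0C.cls W) := by
    refine (grothBasis hn hq).ext fun i => ?_
    ext j
    simp only [LinearMap.comp_apply, LinearEquiv.coe_coe, Matrix.vecMulLinear_apply,
      LinearMap.mulRight_apply]
    rw [show (grothBasis hn hq).equivFun (grothBasis hn hq i) = Pi.single i 1 from
        funext fun i' => by rw [Module.Basis.equivFun_apply, Module.Basis.repr_self,
          Finsupp.single_eq_pi_single],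
      Matrix.single_one_vecMul, Module.Basis.equivFun_apply, grothBasis_apply,
      G0C.cls_mul_cls, grothBasis_repr_cls]
    rfl
  exact LinearMap.congr_fun h z

end TaftDouble

theorem theorem3p20 {k : Type u} [Field k] [IsAlgClosed k] [CharZero k] {n : ℕ} (hn : 3 ≤ n)
    (hodd : Odd n) {q : k} (hq : IsPrimitiveRoot q n) (ζ : ℂ) (hζ : IsPrimitiveRoot ζ n) :
    -- the complex Grothendieck algebra is `ℂ⟨g⟩[x] / (f(x, g))`
    (∃ Φ : AdjoinRoot (chebF n
          (MonoidAlgebra.single (Multiplicative.ofAdd (1 : ZMod n)) (1 : ℂ))) ≃ₐ[ℂ]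
          TaftDouble.Groth hn hq,
        Φ (AdjoinRoot.of _ (MonoidAlgebra.single (Multiplicative.ofAdd (1 : ZMod n)) (1 : ℂ))) =
          TaftDouble.gElt hn hq ∧
        Φ (AdjoinRoot.root _) = TaftDouble.xElt hn hq) ∧
    -- the `V(ℓ, r)` are the simple modules, without repetition
    ((∀ i, IsSimpleModule (TaftDouble hn hq) (TaftDouble.simpleModule hn hq i).carrier) ∧
      (∀ i i', Nonempty ((TaftDouble.simpleModule hn hq i).carrier ≃ₗ[TaftDouble hn hq]
        (TaftDouble.simpleModule hn hq i').carrier) → i = i') ∧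
      (∀ S : FDModule k (TaftDouble hn hq), IsSimpleModule (TaftDouble hn hq) S.carrier →
        ∃ i, Nonempty (S.carrier ≃ₗ[TaftDouble hn hq]
          (TaftDouble.simpleModule hn hq i).carrier))) ∧
    -- (a)
    (LinearIndependent ℂ
        (fun p : Fin ((n - 1) / 2) × Fin n => TaftDouble.fElt hn hq ζ (p.1 + 1) p.2) ∧
      Submodule.span ℂ (Set.range
        (fun p : Fin ((n - 1) / 2) × Fin n => TaftDouble.fElt hn hq ζ (p.1 + 1) p.2)) =
          (Ring.jacobson (TaftDouble.Groth hn hq)).restrictScalars ℂ ∧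
      Ring.jacobson (TaftDouble.Groth hn hq) * Ring.jacobson (TaftDouble.Groth hn hq) = ⊥) ∧
    -- (b)
    (∃ (ν : Fin ((n - 1) / 2) × Fin n → ℂ)
        (e : Fin n ⊕ Fin ((n - 1) / 2) × Fin n → TaftDouble.Groth hn hq),
      (∀ p, TaftDouble.gjElt hn hq ζ (p.1 + 1) p.2 ^ 2 =
        vartheta n ζ (p.1 + 1) p.2 • TaftDouble.gjElt hn hq ζ (p.1 + 1) p.2 +
          ν p • TaftDouble.fElt hn hq ζ (p.1 + 1) p.2) ∧
      (∀ r, e (Sum.inl r) = (xi n ζ r)⁻¹ • TaftDouble.fElt hn hq ζ 0 r) ∧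
      -- the elements `G'_{j,r}`
      (∀ p, e (Sum.inr p) = (vartheta n ζ (p.1 + 1) p.2)⁻¹ •
        (TaftDouble.gjElt hn hq ζ (p.1 + 1) p.2 -
          (ν p / vartheta n ζ (p.1 + 1) p.2) • TaftDouble.fElt hn hq ζ (p.1 + 1) p.2)) ∧
      OrthogonalIdempotents e ∧
      LinearIndependent ℂ (fun t =>
        ((Ring.jacobson (TaftDouble.Groth hn hq)).restrictScalars ℂ).mkQ (e t)) ∧
      Submodule.span ℂ (Set.range (fun t =>
        ((Ring.jacobson (TaftDouble.Groth hn hq)).restrictScalars ℂ).mkQ (e t))) = ⊤) ∧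
    -- the classes of the simple modules form a basis; `f j r` and `g j r` are the coordinate
    -- vectors of `F_{j,r}` and `G_{j,r}`
    (∃ (b : Module.Basis (Fin n × Fin n) ℂ (TaftDouble.Groth hn hq))
        (f g : ℕ → ℕ → (Fin n × Fin n → ℂ)),
      (∀ i, b i = G0C.cls (TaftDouble.simpleModule hn hq i)) ∧
      (∀ j r i, f j r i = b.repr (TaftDouble.fElt hn hq ζ j r) i) ∧
      (∀ j r i, g j r i = b.repr (TaftDouble.gjElt hn hq ζ j r) i) ∧
      -- (c)
      (∀ j r, j ≤ (n - 1) / 2 → r < n → f j r ≠ 0 ∧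
        Matrix.vecMul (f j r) (TaftDouble.mcKay hn hq (TaftDouble.V hn hq 2 (by omega) 0)) =
          lam ζ j r • f j r) ∧
      -- (d)
      (∀ j r, 1 ≤ j → j ≤ (n - 1) / 2 → r < n →
        Matrix.vecMul (g j r) (TaftDouble.mcKay hn hq (TaftDouble.V hn hq 2 (by omega) 0)) =
          lam ζ j r • g j r + f j r) ∧
      -- (e): together, these vectors form a basis of the space of row vectors
      LinearIndependent ℂ (Sum.elim
        (fun p : Fin ((n + 1) / 2) × Fin n => f p.1 p.2)
        (fun p : Fin ((n - 1) / 2) × Fin n => g (p.1 + 1) p.2)) ∧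
      Submodule.span ℂ (Set.range (Sum.elim
        (fun p : Fin ((n + 1) / 2) × Fin n => f p.1 p.2)
        (fun p : Fin ((n - 1) / 2) × Fin n => g (p.1 + 1) p.2))) = ⊤ ∧
      -- the left eigenspaces and generalized left eigenspaces of the McKay matrix of `V(2,0)`
      (∀ t : ℂ, Module.End.eigenspace
          (TaftDouble.mcKay hn hq (TaftDouble.V hn hq 2 (by omega) 0)).vecMulLinear t =
        Submodule.span ℂ {v | ∃ j r, j ≤ (n - 1) / 2 ∧ r < n ∧ lam ζ j r = t ∧ v = f j r}) ∧
      (∀ t : ℂ, Module.End.maxGenEigenspace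
          (TaftDouble.mcKay hn hq (TaftDouble.V hn hq 2 (by omega) 0)).vecMulLinear t =
        Submodule.span ℂ
          ({v | ∃ j r, j ≤ (n - 1) / 2 ∧ r < n ∧ lam ζ j r = t ∧ v = f j r} ∪
            {v | ∃ j r, 1 ≤ j ∧ j ≤ (n - 1) / 2 ∧ r < n ∧ lam ζ j r = t ∧ v = g j r})) ∧
      -- the McKay matrix of an arbitrary simple module
      (∀ i, ∃ μ : ℕ → ℕ → ℂ,
        (∀ j r, j ≤ (n - 1) / 2 → r < n →
          Matrix.vecMul (f j r)
            (TaftDouble.mcKay hn hq (TaftDouble.simpleModule hn hq i)) = μ j r • f j r) ∧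
        (∀ j r, 1 ≤ j → j ≤ (n - 1) / 2 → r < n → ∃ c : ℂ,
          Matrix.vecMul (g j r)
            (TaftDouble.mcKay hn hq (TaftDouble.simpleModule hn hq i)) =
              μ j r • g j r + c • f j r) ∧
        (∀ t : ℂ, Module.End.maxGenEigenspace
            (TaftDouble.mcKay hn hq (TaftDouble.simpleModule hn hq i)).vecMulLinear t =
          Submodule.span ℂ
            ({v | ∃ j r, j ≤ (n - 1) / 2 ∧ r < n ∧ μ j r = t ∧ v = f j r} ∪
              {v | ∃ j r, 1 ≤ j ∧ j ≤ (n - 1) / 2 ∧ r < n ∧ μ j r = t ∧ v = g j r})))) := by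
  -- The commutative structure extends the ring structure of the statement, so the abstract results
  -- on `chebQuot` and `chebQuotSq` are by definition results on `fElt` and `gjElt`.
  let := TaftDouble.grothCommRing hn hq
  have H : IsChebyshevAlgebra n ζ (TaftDouble.gElt hn hq) (TaftDouble.xElt hn hq) :=
    TaftDouble.isChebyshevAlgebra hn hq hodd hζ
  have hdim := TaftDouble.finrank_groth hn hq
  have hli := H.linearIndependent_family hdim
  have hspan := H.span_family
  set e := (TaftDouble.grothBasis hn hq).equivFun with he
  have hfam : ∀ F G : ℕ → ℕ → TaftDouble.Groth hn hq, Sum.elim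
      (fun p : Fin ((n + 1) / 2) × Fin n => e (F p.1 p.2))
      (fun p : Fin ((n - 1) / 2) × Fin n => e (G (p.1 + 1) p.2)) =
      e ∘ Sum.elim (fun p : Fin ((n + 1) / 2) × Fin n => F p.1 p.2)
        (fun p : Fin ((n - 1) / 2) × Fin n => G (p.1 + 1) p.2) :=
    fun F G => (Sum.comp_elim _ _ _).symm
  have hli' : LinearIndependent ℂ (Sum.elim
      (fun p : Fin ((n + 1) / 2) × Fin n => e (TaftDouble.fElt hn hq ζ p.1 p.2))
      (fun p : Fin ((n - 1) / 2) × Fin n => e (TaftDouble.gjElt hn hq ζ (p.1 + 1) p.2))) := by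
    rw [hfam]
    exact hli.map' e.toLinearMap e.ker
  have hspan' : Submodule.span ℂ (Set.range (Sum.elim
      (fun p : Fin ((n + 1) / 2) × Fin n => e (TaftDouble.fElt hn hq ζ p.1 p.2))
      (fun p : Fin ((n - 1) / 2) × Fin n => e (TaftDouble.gjElt hn hq ζ (p.1 + 1) p.2)))) = ⊤ := by
    rw [hfam, Set.range_comp, ← LinearEquiv.coe_coe, Submodule.span_image]
    refine (congrArg (Submodule.map e.toLinearMap) hspan).trans ?_
    rw [Submodule.map_top, LinearEquiv.range]
  have hf : ∀ j r, j ≤ (n - 1) / 2 → r < n →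
      Matrix.vecMul (e (TaftDouble.fElt hn hq ζ j r))
        (TaftDouble.mcKay hn hq (TaftDouble.V hn hq 2 (by omega) 0)) =
          lam ζ j r • e (TaftDouble.fElt hn hq ζ j r) := by
    intro j r hj _
    rw [TaftDouble.vecMul_mcKay, ← map_smul]
    exact congrArg e (H.x_mul_chebQuot hj r)
  have hg : ∀ j r, 1 ≤ j → j ≤ (n - 1) / 2 → r < n →
      Matrix.vecMul (e (TaftDouble.gjElt hn hq ζ j r))
        (TaftDouble.mcKay hn hq (TaftDouble.V hn hq 2 (by omega) 0)) =
          lam ζ j r • e (TaftDouble.gjElt hn hq ζ j r) + e (TaftDouble.fElt hn hq ζ j r) := by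
    intro j r h1 hj _
    rw [TaftDouble.vecMul_mcKay, ← map_smul, ← map_add]
    exact congrArg e (H.x_mul_chebQuotSq h1 hj r)
  refine ⟨H.exists_algEquiv hdim, ⟨TaftDouble.isSimpleModule_simpleModule,
    TaftDouble.simpleModule_injective, TaftDouble.exists_equiv_simpleModule⟩,
    ⟨H.linearIndependent_chebQuot_succ hdim, H.span_chebQuot_eq_jacobson hdim,
      H.jacobson_mul_jacobson hdim⟩, H.exists_orthogonalIdempotents hdim,
    TaftDouble.grothBasis hn hq, fun j r => e (TaftDouble.fElt hn hq ζ j r),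
    fun j r => e (TaftDouble.gjElt hn hq ζ j r), TaftDouble.grothBasis_apply hn hq,
    fun _ _ _ => rfl, fun _ _ _ => rfl, fun j r hj hr => ⟨?_, hf j r hj hr⟩, hg, hli', hspan',
    ?_, ?_, fun i => ?_⟩
  · exact e.map_ne_zero_iff.2 (H.chebQuot_ne_zero hdim hj hr)
  · exact eigenspace_eq_span hodd _ (lam ζ) hf hg hli' hspan'
  · exact maxGenEigenspace_eq_span_union hodd _ (lam ζ) hf
      (fun j r h1 hj hr => ⟨1, by rw [one_smul]; exact hg j r h1 hj hr⟩) hspan'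
  -- The class of any simple module acts on each block as a polynomial in `x`; its values at the
  -- `λ_{j,r}` are the eigenvalues.
  · obtain ⟨μ, hμf, hμg⟩ := H.exists_mul_eq (G0C.cls (TaftDouble.simpleModule hn hq i))
    have hf' : ∀ j r, j ≤ (n - 1) / 2 → r < n →
        Matrix.vecMul (e (TaftDouble.fElt hn hq ζ j r))
          (TaftDouble.mcKay hn hq (TaftDouble.simpleModule hn hq i)) =
            μ j r • e (TaftDouble.fElt hn hq ζ j r) := by
      intro j r hj _
      rw [TaftDouble.vecMul_mcKay, ← map_smul]
      exact congrArg e (hμf j r hj)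
    have hg' : ∀ j r, 1 ≤ j → j ≤ (n - 1) / 2 → r < n → ∃ c : ℂ,
        Matrix.vecMul (e (TaftDouble.gjElt hn hq ζ j r))
          (TaftDouble.mcKay hn hq (TaftDouble.simpleModule hn hq i)) =
            μ j r • e (TaftDouble.gjElt hn hq ζ j r) +
              c • e (TaftDouble.fElt hn hq ζ j r) := by
      intro j r h1 hj _
      obtain ⟨c, hc⟩ := hμg j r h1 hj
      refine ⟨c, ?_⟩
      rw [TaftDouble.vecMul_mcKay, ← map_smul, ← map_smul, ← map_add]
      exact congrArg e hc
    exact ⟨μ, hf', hg', maxGenEigenspace_eq_span_union hodd _ μ hf' hg' hspan'⟩
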